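/- **Setting.** Let $A\in L^3_{\rm loc}(\mathbb R^3,\mathbb R^3)$ with $\lim_{|x|\to\infty}|A(x)|e^{-b|x|}=0$ for some $b>0$, let $0\le V\in L^1_{\rm loc}(\mathbb R^3)$ with $\lim_{|x|\to\infty}V(x)=+\infty$, and assume $$\lim_{|x|\to\infty}\frac{|A(x)|^2}{V(x)}=0 .$$ Let $\theta:\mathbb R^3\to[0,1]$ be smooth and radial with $\theta(x)=0$ for $|x|\le1$ and $\theta(x)=1$ for $|x|\ge2$, and let $U:\mathbb R^3\to[0,\infty)$ be smooth, radial, supported in $\{1/2\le|x|\le1\}$, with $\int U=4\pi a$ (for some constant $a$; in the application $a$ is the scattering length of the interaction). Put $\theta_R(x)=\theta(x/R)$, $U_R(x)=R^{-3}U(x/R)$, $p=-i\nabla$, $h=(-i\nabla+A)^2+V$. For $0<\varepsilon<1$ and $s>0$ let $$\tilde h=h-(1-\varepsilon)p^2\theta_s(p)-\kappa_{\varepsilon,s},\qquad \kappa_{\varepsilon,s}=\inf\sigma\big(h-(1-\varepsilon)p^2\theta_s(p)-1\big),$$ where $h-(1-\varepsilon)p^2\theta_s(p)$ is the self-adjoint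 operator on $L^2(\mathbb R^3)$ defined by its quadratic form. Write $\tilde h_j$ for $\tilde h$ acting on the $j$-th variable of $L^2((\mathbb R^3)^N)$, and $$W_N=\sum_{i\ne j}U_R(x_i-x_j)\prod_{k\ne i,j}\theta_{2R}(x_j-x_k),\qquad \tilde H_N=\sum_{j=1}^N\tilde h_j+\frac{(1-\varepsilon)^2}{N}W_N .$$ **Lemma (second moment estimate).** Fix $A,V,\theta,U$ as above, $0<\varepsilon<1$ and $s>0$. There is a constant $C$ such that, for every sequence $R=R(N)$ with $N^{2/3}R(N)\to\infty$ as $N\to\infty$, the following holds for all $N$ large enough. 1. On $L^2((\mathbb R^3)^N)$, hence in particular on its subspace $\bigotimes^N_{\rm sym}L^2(\mathbb R^3)$ of permutation-symmetric functions, one has the operator inequality $$(\tilde H_N)^2\ \ge\ \frac13\Big(\sum_{j=1}^N\tilde h_j\Big)^2,$$ that is, every $\Psi$ in the domain of $\tilde H_N$ is in the domain of $\sum_j\tilde h_j$ and $\|\tilde H_N\Psi\|^2\ge\frac13\|\sum_j\tilde h_j\Psi\|^2$. 2. Consequently, every normalised ground state $\Psi$ of $\tilde H_N$ on the bosonic space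 $\bigotimes^N_{\rm sym}L^2(\mathbb R^3)$ satisfies $$\langle\Psi,\tilde h_i\tilde h_j\Psi\rangle=\langle\tilde h_i\Psi,\tilde h_j\Psi\rangle\le C\qquad\text{for all } i\ne j,$$ in particular $\langle\Psi,\tilde h_1\tilde h_2\Psi\rangle\le C$. The constant $C$ does not depend on $N$ or on the sequence $R$. -/

import Mathlib

open MeasureTheory Filter Topology
open scoped ContDiff FourierTransform ENNReal

noncomputable section

namespace DysonGas

/-- Physical space `ℝ³`. -/
abbrev E3 : Type := EuclideanSpace ℝ (Fin 3)

/-- The one-particle Hilbert space `L²(ℝ³)`. -/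
abbrev L2 : Type := Lp ℂ 2 (volume : Measure E3)

/-- The configuration space `(ℝ³)^N`, with the product Lebesgue measure. -/
abbrev Config (N : ℕ) : Type := Fin N → E3

/-- The `N`-particle space `L²((ℝ³)^N)` (no symmetry imposed). -/
abbrev L2N (N : ℕ) : Type := Lp ℂ 2 (volume : Measure (Config N))

/-! ### Standing assumptions on the data -/

/-- `A ∈ L³_loc(ℝ³, ℝ³)` grows at most exponentially, `0 ≤ V ∈ L¹_loc(ℝ³)` is trapping, and
`|A|² / V → 0` at infinity. -/
structure FieldAssumptions (A : E3 → E3) (V : E3 → ℝ) : Prop where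
  A_loc : ∀ K : Set E3, IsCompact K → MemLp A 3 (volume.restrict K)
  A_growth : ∃ b : ℝ, 0 < b ∧
    Tendsto (fun x => ‖A x‖ * Real.exp (-b * ‖x‖)) (cocompact E3) (𝓝 0)
  V_nonneg : ∀ x, 0 ≤ V x
  V_loc : LocallyIntegrable V volume
  V_trap : Tendsto V (cocompact E3) atTop
  A_V : Tendsto (fun x => ‖A x‖ ^ 2 / V x) (cocompact E3) (𝓝 0)

/-- A radial smooth Heaviside-like function. -/
structure IsCutoff (θ : E3 → ℝ) : Prop where
  smooth : ContDiff ℝ ∞ θ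
  radial : ∀ x y, ‖x‖ = ‖y‖ → θ x = θ y
  nonneg : ∀ x, 0 ≤ θ x
  le_one : ∀ x, θ x ≤ 1
  eq_zero : ∀ x, ‖x‖ ≤ 1 → θ x = 0
  eq_one : ∀ x, 2 ≤ ‖x‖ → θ x = 1

/-- A radial smooth nonnegative function supported in the annulus `1/2 ≤ |x| ≤ 1`, of integral
`4πa`. -/
structure IsSoftPotential (a : ℝ) (U : E3 → ℝ) : Prop where
  smooth : ContDiff ℝ ∞ U
  radial : ∀ x y, ‖x‖ = ‖y‖ → U x = U y
  nonneg : ∀ x, 0 ≤ U x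
  support : ∀ x, U x ≠ 0 → 1 / 2 ≤ ‖x‖ ∧ ‖x‖ ≤ 1
  integral : ∫ x, U x = 4 * Real.pi * a

/-- `θ_R(x) = θ(x/R)`. -/
def scaleCutoff (θ : E3 → ℝ) (R : ℝ) (x : E3) : ℝ := θ (R⁻¹ • x)

/-- `U_R(x) = R⁻³ U(x/R)`. -/
def scalePotential (U : E3 → ℝ) (R : ℝ) (x : E3) : ℝ := (R ^ 3)⁻¹ * U (R⁻¹ • x)

/-! ### The one-body operator `h - (1-ε) p² θ_s(p)` -/

/-- `g = -i ∂_k u + A_k u` in the sense of distributions (for `u, g ∈ L²`). -/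
def IsMagneticDeriv (A : E3 → E3) (k : Fin 3) (u g : L2) : Prop :=
  LocallyIntegrable (fun x => (A x k : ℂ) * u x) volume ∧
  ∀ φ : E3 → ℂ, ContDiff ℝ ∞ φ → HasCompactSupport φ →
    ∫ x, g x * φ x =
      ∫ x, (Complex.I * (u x * fderiv ℝ φ x (EuclideanSpace.single k 1))
        + ((A x k : ℂ) * u x) * φ x)

/-- The symbol `|p| √θ_s(p)`, at `p = 2πξ`: with Mathlib's normalisation of the Fourier
transform, `p = -i∇` is multiplication by `2πξ` on the Fourier side. -/
def momentumSymbol (θ : E3 → ℝ) (s : ℝ) (ξ : E3) : ℝ :=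
  ‖(2 * Real.pi) • ξ‖ * √(scaleCutoff θ s ((2 * Real.pi) • ξ))

/-- `u` lies in the form domain of `h - (1-ε) p² θ_s(p)`, with `g = (-i∇ + A) u`, `w = √V u`, and
`m` the Fourier transform of `|p| √θ_s(p) u`, all of them square integrable. -/
structure FormData (A : E3 → E3) (V θ : E3 → ℝ) (s : ℝ) (u : L2) (g : Fin 3 → L2) (w m : L2) :
    Prop where
  kin : ∀ k, IsMagneticDeriv A k u (g k)
  pot : ∀ᵐ x, w x = (√(V x) : ℂ) * u x
  mom : ∀ᵐ ξ, m ξ = (momentumSymbol θ s ξ : ℂ) * (𝓕 u : L2) ξ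

/-- `(u, f)` is in the graph of the operator associated with the quadratic form
`‖(-i∇ + A) u‖² + ‖√V u‖² - (1-ε) ‖|p| √θ_s(p) u‖²`: `u` is in the form domain and the
sesquilinear form satisfies `q(v, u) = ⟨v, f⟩` for all `v` in the form domain. -/
def OneBodyRel (A : E3 → E3) (V θ : E3 → ℝ) (ε s : ℝ) (u f : L2) : Prop :=
  ∃ (g : Fin 3 → L2) (w m : L2), FormData A V θ s u g w m ∧
    ∀ (v : L2) (g' : Fin 3 → L2) (w' m' : L2), FormData A V θ s v g' w' m' →
      ∑ k, inner ℂ (g' k) (g k) + inner ℂ w' w - ((1 - ε : ℝ) : ℂ) * inner ℂ m' m = inner ℂ v f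

lemma integrable_L2_mul (u : L2) {φ : E3 → ℂ} (hc : Continuous φ) (hs : HasCompactSupport φ) :
    Integrable (fun x => u x * φ x) volume :=
  (Lp.memLp u).integrable_mul (hc.memLp_of_hasCompactSupport (p := 2) hs)

lemma integrable_loc_mul {F : E3 → ℂ} (hF : LocallyIntegrable F volume) {φ : E3 → ℂ}
    (hc : Continuous φ) (hs : HasCompactSupport φ) :
    Integrable (fun x => F x * φ x) volume := by
  have := hF.integrable_smul_left_of_hasCompactSupport hc hs
  refine this.congr (Eventually.of_forall fun x => ?_)
  simp [mul_comm]

lemma integrable_L2_mul_deriv (u : L2) {φ : E3 → ℂ} (hc : ContDiff ℝ ∞ φ)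
    (hs : HasCompactSupport φ) (e : E3) :
    Integrable (fun x => Complex.I * (u x * fderiv ℝ φ x e)) volume := by
  refine Integrable.const_mul (integrable_L2_mul u ?_ ?_) _
  · exact (hc.continuous_fderiv (by simp)).clm_apply continuous_const
  · exact hs.fderiv_apply (𝕜 := ℝ) e

lemma IsMagneticDeriv.add {A : E3 → E3} {k : Fin 3} {u u' g g' : L2}
    (h : IsMagneticDeriv A k u g) (h' : IsMagneticDeriv A k u' g') :
    IsMagneticDeriv A k (u + u') (g + g') := by
  have hu := Lp.coeFn_add u u'
  have hg := Lp.coeFn_add g g'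
  refine ⟨(h.1.add h'.1).congr ?_, fun φ hφ hs => ?_⟩
  · filter_upwards [hu] with x hx
    simp only [hx, Pi.add_apply]; ring
  · have e1 : ∫ x, (g + g') x * φ x = ∫ x, (g x * φ x + g' x * φ x) := by
      refine integral_congr_ae ?_
      filter_upwards [hg] with x hx
      simp only [hx, Pi.add_apply]; ring
    rw [e1, integral_add (integrable_L2_mul _ hφ.continuous hs)
      (integrable_L2_mul _ hφ.continuous hs), h.2 φ hφ hs, h'.2 φ hφ hs]
    refine (integral_add
      ((integrable_L2_mul_deriv u hφ hs _).add (integrable_loc_mul h.1 hφ.continuous hs))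
      ((integrable_L2_mul_deriv u' hφ hs _).add
        (integrable_loc_mul h'.1 hφ.continuous hs))).symm.trans ?_
    refine integral_congr_ae ?_
    filter_upwards [hu] with x hx
    simp only [hx, Pi.add_apply]; ring

lemma IsMagneticDeriv.smul {A : E3 → E3} {k : Fin 3} {u g : L2} (c : ℂ)
    (h : IsMagneticDeriv A k u g) : IsMagneticDeriv A k (c • u) (c • g) := by
  have hu := Lp.coeFn_smul c u
  have hg := Lp.coeFn_smul c g
  refine ⟨(h.1.smul c).congr ?_, fun φ hφ hs => ?_⟩
  · filter_upwards [hu] with x hx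
    simp only [hx, Pi.smul_apply, smul_eq_mul]; ring
  · have e1 : ∫ x, (c • g) x * φ x = c * ∫ x, g x * φ x := by
      rw [← integral_const_mul]
      refine integral_congr_ae ?_
      filter_upwards [hg] with x hx
      simp only [hx, Pi.smul_apply, smul_eq_mul]; ring
    rw [e1, h.2 φ hφ hs, ← integral_const_mul]
    refine integral_congr_ae ?_
    filter_upwards [hu] with x hx
    simp only [hx, Pi.smul_apply, smul_eq_mul]; ring

lemma FormData.add {A : E3 → E3} {V θ : E3 → ℝ} {s : ℝ} {u u' : L2} {g g' : Fin 3 → L2}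
    {w w' m m' : L2} (h : FormData A V θ s u g w m) (h' : FormData A V θ s u' g' w' m') :
    FormData A V θ s (u + u') (g + g') (w + w') (m + m') where
  kin k := (h.kin k).add (h'.kin k)
  pot := by
    filter_upwards [h.pot, h'.pot, Lp.coeFn_add u u', Lp.coeFn_add w w'] with x h1 h2 h3 h4
    simp only [h3, h4, Pi.add_apply, h1, h2]; ring
  mom := by
    rw [FourierTransform.fourier_add]
    filter_upwards [h.mom, h'.mom, Lp.coeFn_add (𝓕 u : L2) (𝓕 u'), Lp.coeFn_add m m']
      with x h1 h2 h3 h4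
    simp only [h3, h4, Pi.add_apply, h1, h2]; ring

lemma FormData.smul {A : E3 → E3} {V θ : E3 → ℝ} {s : ℝ} {u : L2} {g : Fin 3 → L2}
    {w m : L2} (c : ℂ) (h : FormData A V θ s u g w m) :
    FormData A V θ s (c • u) (c • g) (c • w) (c • m) where
  kin k := (h.kin k).smul c
  pot := by
    filter_upwards [h.pot, Lp.coeFn_smul c u, Lp.coeFn_smul c w] with x h1 h2 h3
    simp only [h2, h3, Pi.smul_apply, h1, smul_eq_mul]; ring
  mom := by
    rw [FourierTransform.fourier_smul]
    filter_upwards [h.mom, Lp.coeFn_smul c (𝓕 u : L2), Lp.coeFn_smul c m] with x h1 h2 h3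
    simp only [h2, h3, Pi.smul_apply, h1, smul_eq_mul]; ring

lemma OneBodyRel.add {A : E3 → E3} {V θ : E3 → ℝ} {ε s : ℝ} {u u' f f' : L2}
    (h : OneBodyRel A V θ ε s u f) (h' : OneBodyRel A V θ ε s u' f') :
    OneBodyRel A V θ ε s (u + u') (f + f') := by
  obtain ⟨g, w, m, hd, hq⟩ := h
  obtain ⟨g', w', m', hd', hq'⟩ := h'
  refine ⟨_, _, _, hd.add hd', fun v gv wv mv hv => ?_⟩
  have h1 := hq v gv wv mv hv
  have h2 := hq' v gv wv mv hv
  simp only [Pi.add_apply, inner_add_right, Finset.sum_add_distrib]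
  rw [← h1, ← h2]; ring

lemma OneBodyRel.smul {A : E3 → E3} {V θ : E3 → ℝ} {ε s : ℝ} {u f : L2} (c : ℂ)
    (h : OneBodyRel A V θ ε s u f) : OneBodyRel A V θ ε s (c • u) (c • f) := by
  obtain ⟨g, w, m, hd, hq⟩ := h
  refine ⟨_, _, _, hd.smul c, fun v gv wv mv hv => ?_⟩
  have h1 := hq v gv wv mv hv
  simp only [Pi.smul_apply, inner_smul_right, ← Finset.mul_sum]
  rw [← h1]; ring

lemma FormData.zero (A : E3 → E3) (V θ : E3 → ℝ) (s : ℝ) : FormData A V θ s 0 0 0 0 where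
  kin k := ⟨(locallyIntegrable_zero).congr (Eventually.of_forall fun x => by simp),
    fun φ _ _ => by simp⟩
  pot := Eventually.of_forall fun x => by simp
  mom := by
    rw [FourierTransform.fourier_zero]
    exact Eventually.of_forall fun x => by simp

/-- The graph of `h - (1-ε) p² θ_s(p)`, as a linear relation. -/
def oneBodyGraph (A : E3 → E3) (V θ : E3 → ℝ) (ε s : ℝ) : Submodule ℂ (L2 × L2) where
  carrier := {q | OneBodyRel A V θ ε s q.1 q.2}
  add_mem' h h' := OneBodyRel.add h h'
  zero_mem' := ⟨0, 0, 0, FormData.zero A V θ s, by simp⟩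
  smul_mem' c _ h := OneBodyRel.smul c h

/-- The operator `h - (1-ε) p² θ_s(p)` in `L²(ℝ³)`, with `h = (-i∇ + A)² + V`. -/
def oneBody (A : E3 → E3) (V θ : E3 → ℝ) (ε s : ℝ) : L2 →ₗ.[ℂ] L2 :=
  (oneBodyGraph A V θ ε s).toLinearPMap

/-! ### Unbounded operators: shifts, spectrum, squares, ground states -/

section Abstract

variable {H : Type*} [NormedAddCommGroup H] [InnerProductSpace ℂ H]

/-- `T - c`, on the domain of `T`. -/
def subConst (T : H →ₗ.[ℂ] H) (c : ℝ) : H →ₗ.[ℂ] H := (-(c : ℂ) • (LinearMap.id : H →ₗ[ℂ] H)) +ᵥ T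

/-- `z` is in the resolvent set of `T`: `T - z` is a bijection from the domain of `T` onto `H`
with bounded inverse `B`. -/
def InResolventSet (T : H →ₗ.[ℂ] H) (z : ℂ) : Prop :=
  ∃ B : H →L[ℂ] H,
    (∀ f : H, ∃ hf : B f ∈ T.domain, T ⟨B f, hf⟩ - z • B f = f) ∧
    ∀ u : T.domain, B (T u - z • (u : H)) = u

/-- `inf σ(T)`, the spectrum being the complement of the resolvent set. -/
def infSpectrum (T : H →ₗ.[ℂ] H) : ℝ := sInf {t : ℝ | ¬ InResolventSet T (t : ℂ)}

/-- The operator inequality `S² ≥ c T²`, in the sense of quadratic forms: the form domain of `S²`,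
which is the domain of `S`, is contained in that of `T²`, and `c ‖T ψ‖² ≤ ‖S ψ‖²` there. -/
def SqGe (S : H →ₗ.[ℂ] H) (c : ℝ) (T : H →ₗ.[ℂ] H) : Prop :=
  ∀ (ψ : H) (hS : ψ ∈ S.domain), ∃ hT : ψ ∈ T.domain, c * ‖T ⟨ψ, hT⟩‖ ^ 2 ≤ ‖S ⟨ψ, hS⟩‖ ^ 2

/-- `ψ` is a ground state of `T` in the sector of vectors satisfying `P`: a normalised vector that
minimises the energy `⟨φ, T φ⟩` among the normalised vectors of that sector. -/
def IsGroundState (P : H → Prop) (T : H →ₗ.[ℂ] H) (ψ : H) : Prop :=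
  P ψ ∧ ‖ψ‖ = 1 ∧ ∃ hψ : ψ ∈ T.domain, ∀ (φ : H) (hφ : φ ∈ T.domain), P φ → ‖φ‖ = 1 →
    (inner ℂ ψ (T ⟨ψ, hψ⟩)).re ≤ (inner ℂ φ (T ⟨φ, hφ⟩)).re

end Abstract

/-- `κ_{ε,s} = inf σ(h - (1-ε) p² θ_s(p) - 1)`. -/
def kappa (A : E3 → E3) (V θ : E3 → ℝ) (ε s : ℝ) : ℝ :=
  infSpectrum (subConst (oneBody A V θ ε s) 1)

/-- `h̃ = h - (1-ε) p² θ_s(p) - κ_{ε,s}`. -/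
def hTilde (A : E3 → E3) (V θ : E3 → ℝ) (ε s : ℝ) : L2 →ₗ.[ℂ] L2 :=
  subConst (oneBody A V θ ε s) (kappa A V θ ε s)

/-! ### Many-body operators -/

/-- The map replacing the `j`-th position does not charge null sets. -/
lemma ae_ae_update {N : ℕ} (j : Fin N) {P : Config N → Prop} (h : ∀ᵐ x, P x) :
    ∀ᵐ x : Config N, ∀ᵐ y : E3, P (Function.update x j y) := by
  obtain ⟨n, rfl⟩ : ∃ n, N = n + 1 := ⟨N - 1, by have := j.2; omega⟩
  have e := volume_preserving_piFinSuccAbove (fun _ : Fin (n + 1) => E3) j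
  have e' := e.symm
  have h1 : ∀ᵐ z : E3 × (Fin n → E3), P ((MeasurableEquiv.piFinSuccAbove (fun _ => E3) j).symm z) :=
    e'.quasiMeasurePreserving.ae h
  have h2 : ∀ᵐ x' : Fin n → E3, ∀ᵐ y : E3,
      P ((MeasurableEquiv.piFinSuccAbove (fun _ => E3) j).symm (y, x')) :=
    Measure.ae_ae_of_ae_prod (Measure.measurePreserving_swap.quasiMeasurePreserving.ae h1)
  have h3 := e.quasiMeasurePreserving.ae (Measure.quasiMeasurePreserving_snd.ae h2)
  filter_upwards [h3] with x hx
  filter_upwards [hx] with y hy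
  convert hy using 1
  ext1 i
  simp [MeasurableEquiv.piFinSuccAbove, Fin.insertNthEquiv]

/-- The graph of `T` acting on the `j`-th variable, through the identification
`L²((ℝ³)^N) = L²((ℝ³)^{N-1}; L²(ℝ³))`: `(Ψ, Φ)` belongs to it when, for almost every position of
the other particles, `Ψ(x₁, …, ·, …, x_N)` is in the domain of `T` and is mapped by `T` to
`Φ(x₁, …, ·, …, x_N)`. -/
def actGraph (N : ℕ) (T : L2 →ₗ.[ℂ] L2) (j : Fin N) : Submodule ℂ (L2N N × L2N N) where
  carrier := {q | ∀ᵐ x : Config N, ∃ u : T.domain,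
    (∀ᵐ y, (u : L2) y = q.1 (Function.update x j y)) ∧
    (∀ᵐ y, (T u) y = q.2 (Function.update x j y))}
  add_mem' := by
    rintro ⟨a, b⟩ ⟨a', b'⟩ h h'
    have ha := ae_ae_update j (Lp.coeFn_add a a')
    have hb := ae_ae_update j (Lp.coeFn_add b b')
    filter_upwards [h, h', ha, hb] with x ⟨u, hu, hTu⟩ ⟨u', hu', hTu'⟩ hax hbx
    refine ⟨u + u', ?_, ?_⟩
    · filter_upwards [hu, hu', hax, Lp.coeFn_add (u : L2) u'] with y h1 h2 h3 h4
      simp_all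
    · rw [LinearPMap.map_add]
      filter_upwards [hTu, hTu', hbx, Lp.coeFn_add (T u) (T u')] with y h1 h2 h3 h4
      simp_all
  zero_mem' := by
    have h0 : ∀ᵐ z : Config N, (0 : L2N N) z = 0 := Lp.coeFn_zero _ _ _
    have h1 : ∀ᵐ z : E3, (0 : L2) z = 0 := Lp.coeFn_zero _ _ _
    filter_upwards [ae_ae_update j h0] with x hx
    refine ⟨0, ?_, ?_⟩
    · filter_upwards [hx, h1] with y hy hz
      simp_all
    · rw [LinearPMap.map_zero]
      filter_upwards [hx, h1] with y hy hz
      simp_all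
  smul_mem' := by
    rintro c ⟨a, b⟩ h
    have ha := ae_ae_update j (Lp.coeFn_smul c a)
    have hb := ae_ae_update j (Lp.coeFn_smul c b)
    filter_upwards [h, ha, hb] with x ⟨u, hu, hTu⟩ hax hbx
    refine ⟨c • u, ?_, ?_⟩
    · filter_upwards [hu, hax, Lp.coeFn_smul c (u : L2)] with y h1 h2 h3
      simp_all
    · rw [LinearPMap.map_smul]
      filter_upwards [hTu, hbx, Lp.coeFn_smul c (T u)] with y h1 h2 h3
      simp_all

/-- `T_j`: the one-body operator `T` acting on the `j`-th variable. -/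
def actOn (N : ℕ) (T : L2 →ₗ.[ℂ] L2) (j : Fin N) : L2N N →ₗ.[ℂ] L2N N :=
  (actGraph N T j).toLinearPMap

/-- The graph of the multiplication by `F`. -/
def mulGraph (N : ℕ) (F : Config N → ℝ) : Submodule ℂ (L2N N × L2N N) where
  carrier := {q | ∀ᵐ x : Config N, q.2 x = (F x : ℂ) * q.1 x}
  add_mem' := by
    rintro ⟨a, b⟩ ⟨a', b'⟩ h h'
    filter_upwards [h, h', Lp.coeFn_add a a', Lp.coeFn_add b b'] with x h1 h2 h3 h4
    simp_all [mul_add]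
  zero_mem' := by
    have h0 : ∀ᵐ z : Config N, (0 : L2N N) z = 0 := Lp.coeFn_zero _ _ _
    filter_upwards [h0] with x hx
    simp_all
  smul_mem' := by
    rintro c ⟨a, b⟩ h
    filter_upwards [h, Lp.coeFn_smul c a, Lp.coeFn_smul c b] with x h1 h2 h3
    simp_all [mul_left_comm]

/-- Multiplication by `F`, on its maximal domain `{Ψ ∈ L² : F Ψ ∈ L²}`. -/
def mulOp (N : ℕ) (F : Config N → ℝ) : L2N N →ₗ.[ℂ] L2N N :=
  (mulGraph N F).toLinearPMap

/-- The nearest-neighbour potential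
`W_N = ∑_{i ≠ j} U_R(x_i - x_j) ∏_{k ≠ i, j} θ_{2R}(x_j - x_k)`. -/
def dysonPotential (θ U : E3 → ℝ) (N : ℕ) (R : ℝ) (x : Config N) : ℝ :=
  ∑ i, ∑ j with j ≠ i, scalePotential U R (x i - x j) *
    ∏ k with k ≠ i ∧ k ≠ j, scaleCutoff θ (2 * R) (x j - x k)

/-- `∑_j h̃_j`, on the intersection of the domains. -/
def sumH (A : E3 → E3) (V θ : E3 → ℝ) (ε s : ℝ) (N : ℕ) : L2N N →ₗ.[ℂ] L2N N :=
  ∑ j, actOn N (hTilde A V θ ε s) j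

/-- The effective Hamiltonian `H̃_N = ∑_j h̃_j + (1-ε)² / N · W_N`. -/
def effectiveHamiltonian (A : E3 → E3) (V θ U : E3 → ℝ) (ε s : ℝ) (N : ℕ) (R : ℝ) :
    L2N N →ₗ.[ℂ] L2N N :=
  sumH A V θ ε s N + (((1 - ε) ^ 2 / N : ℝ) : ℂ) • mulOp N (dysonPotential θ U N R)

/-- Permutation-symmetric wave functions. -/
def IsBosonic (N : ℕ) (Ψ : L2N N) : Prop :=
  ∀ σ : Equiv.Perm (Fin N), ∀ᵐ x : Config N, Ψ (fun i => x (σ i)) = Ψ x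

end DysonGas

end

open DysonGas

open MeasureTheory Filter Topology
open scoped ContDiff FourierTransform ENNReal

noncomputable section

namespace DysonGas

/-! ### Positive operators, and unbounded operators seen through their bounded inverses -/

section HilbertSpace

variable {H : Type*} [NormedAddCommGroup H] [InnerProductSpace ℂ H]

open ContinuousLinearMap

/-! The shift by `kappa` normalises `hTilde` so that h̃ ≥ 1. Unbounded operators are handled only
through inverses: h̃ has a positive bounded inverse `B` (`exists_inverse_hTilde`), `lift j B`
inverts h̃_j, and Ψ is in the domain of ∑ h̃_j exactly when there are vectors f_j = h̃_jΨ with `lift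
j B (f j) = Ψ` for all j. The domain claim of part 1 is then immediate, because W_N is bounded for
fixed N and R.

For the inequality put c = (1-ε)²/N and expand ‖∑ f_j + c WΨ‖². Only the cross terms 2c Re⟨f_j, WΨ⟩
can be negative. Split W = W' + E_j, where W' omits particle j. As W' ≥ 0 commutes with h̃_j,
Re⟨f_j, W'Ψ⟩ ≥ 0 (`re_inner_mul_nonneg_of_commute`). The error E_j is O(R⁻³) and vanishes unless
another particle lies within 4R of x_j (`exists_sub_partialPotential_sq_le`): the cutoffs allow only
boundedly many pairs to feel particle j, which is why no power of N is lost. Hence ‖E_jΨ‖² is at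
most a constant times R⁻⁶ ∑_k ‖1(|x_j - x_k| ≤ 4R)Ψ‖².

The decisive input is the two-body operator bound 1(|x_i - x_j| ≤ r) ≤ K r³ h̃_i h̃_j
(`two_body_bound`, `exists_nearBound`). It gives ‖E_jΨ‖² ≤ C R⁻³ ∑_{k≠j} Re⟨f_j, f_k⟩. With c ≤ 1/N
the loss is of relative size 1/(N²R³), which tends to zero because N^{2/3}R → ∞
(`norm_sq_sum_add_ge`, `norm_sq_sum_le`).

The two-body bound is proved in inverted form. The quadratic form of h̃ controls the H¹ norm: the
term p²θ_s(p) takes away at most the fraction 1-ε of the kinetic energy, and A is infinitesimally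
small relative to p² and V. Therefore B is dominated by (1+p²)⁻¹, hence by a multiple of an average
of translations with law `yukawa`. For different particles such averages commute, so B_iB_j is
dominated by the product of two averages. Compressed to {|x_i - x_j| ≤ r}, this product is bounded
by the probability that two independent `yukawa` vectors are 2r-close, which is O(r³)
(`lintegral_yukawa_closedBall`). The duality in `norm_sq_proj_le_of_commute` turns the bound back
into one on ⟨h̃_iΨ, h̃_jΨ⟩.

For part 2, a bosonic minimiser satisfies H̃Ψ = EΨ, and a condensate trial state gives 0 ≤ E ≤ C₀N.
Part 1 yields ‖∑ h̃_jΨ‖² ≤ 3E² ≤ 3C₀²N². By symmetry all N(N-1) pair terms ⟨h̃_iΨ, h̃_jΨ⟩ have the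
same real part, so each is bounded. -/

lemma _root_.ContinuousLinearMap.IsPositive.re_nonneg {T : H →L[ℂ] H} (hT : T.IsPositive) (x : H) :
    0 ≤ (inner ℂ x (T x)).re := hT.re_inner_nonneg_right x

lemma _root_.ContinuousLinearMap.IsPositive.symm_apply {T : H →L[ℂ] H} (hT : T.IsPositive)
    (x y : H) : inner ℂ (T x) y = inner ℂ x (T y) := hT.isSymmetric x y

lemma isPositive_of_forall {T : H →L[ℂ] H} (hs : ∀ x y, inner ℂ (T x) y = inner ℂ x (T y))
    (hp : ∀ x, 0 ≤ (inner ℂ x (T x)).re) : T.IsPositive := by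
  refine ⟨fun x y => hs x y, fun x => ?_⟩
  rw [reApplyInnerSelf_apply]
  have : inner ℂ (T x) x = inner ℂ x (T x) := hs x x
  rw [this]; exact hp x

lemma re_inner_self (x : H) : (inner ℂ x x).re = ‖x‖ ^ 2 := by
  rw [inner_self_eq_norm_sq_to_K]; norm_cast

/-- A positive operator satisfies `T² ≤ ‖T‖ T`. -/
lemma _root_.ContinuousLinearMap.IsPositive.norm_sq_le {T : H →L[ℂ] H} (hT : T.IsPositive)
    (x : H) : ‖T x‖ ^ 2 ≤ ‖T‖ * (inner ℂ x (T x)).re := by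
  rcases (norm_nonneg T).eq_or_lt with h0 | h0
  · have : T = 0 := norm_eq_zero.mp h0.symm
    simp [this]
  -- Expanded, this is ‖T‖²⟨x,Tx⟩ - 2‖T‖‖Tx‖² + ⟨Tx,T(Tx)⟩ ≥ 0, whose last term is at most ‖T‖‖Tx‖².
  have h1 := hT.re_nonneg (((‖T‖ : ℂ)) • x - T x)
  have h2 : (inner ℂ (T x) (T (T x))).re ≤ ‖T‖ * ‖T x‖ ^ 2 := by
    calc _ ≤ ‖inner ℂ (T x) (T (T x))‖ := Complex.re_le_norm _
      _ ≤ ‖T x‖ * ‖T (T x)‖ := norm_inner_le_norm _ _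
      _ ≤ ‖T x‖ * (‖T‖ * ‖T x‖) := by gcongr; exact T.le_opNorm _
      _ = _ := by ring
  have h3 : inner ℂ (T x) (T x) = ((‖T x‖ ^ 2 : ℝ) : ℂ) := by
    rw [inner_self_eq_norm_sq_to_K]; push_cast; rfl
  have h4 : inner ℂ x (T (T x)) = ((‖T x‖ ^ 2 : ℝ) : ℂ) := by rw [← hT.symm_apply, h3]
  simp only [map_sub, map_smul, inner_sub_left, inner_sub_right, inner_smul_left, inner_smul_right,
    h3, h4, Complex.sub_re, Complex.conj_ofReal, Complex.re_ofReal_mul, Complex.ofReal_re] at h1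
  nlinarith [h1, h2]

lemma subConst_apply (T : H →ₗ.[ℂ] H) (c : ℝ) (u : (subConst T c).domain) :
    subConst T c u = T ⟨u, u.2⟩ - (c : ℂ) • (u : H) := by
  change (-(c : ℂ) • (LinearMap.id : H →ₗ[ℂ] H)) u + T ⟨u, u.2⟩ = _
  simp [sub_eq_add_neg, add_comm]

/-- `B` is the inverse of `T`: the graph of `T` is `{(B f, f)}`. -/
def IsInverseOf (T : H →ₗ.[ℂ] H) (B : H →L[ℂ] H) : Prop :=
  ∀ u f : H, (∃ hu : u ∈ T.domain, T ⟨u, hu⟩ = f) ↔ u = B f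

variable [CompleteSpace H]

lemma isUnit_of_coercive_re {f : H →L[ℂ] H} {c : ℝ} (hc : 0 < c)
    (h : ∀ x, c * ‖x‖ ^ 2 ≤ (inner ℂ (f x) x).re) : IsUnit f := by
  refine isUnit_of_forall_le_norm_inner_map f (c := ⟨c, hc.le⟩) hc fun x => ?_
  calc ‖x‖ ^ 2 * c = c * ‖x‖ ^ 2 := mul_comm _ _
    _ ≤ _ := h x
    _ ≤ _ := Complex.re_le_norm _

/-- The orthogonal complement of the range of a self-adjoint operator is its kernel. -/
lemma dense_range_of_injective {T : H →L[ℂ] H} (hT : T.IsPositive)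
    (hi : Function.Injective T) : DenseRange T := by
  have h : (LinearMap.range (T : H →ₗ[ℂ] H)).topologicalClosure = ⊤ := by
    rw [Submodule.topologicalClosure_eq_top_iff, Submodule.eq_bot_iff]
    intro x hx
    apply hi
    rw [map_zero, ← inner_self_eq_zero (𝕜 := ℂ), hT.symm_apply, ← hT.symm_apply, hT.symm_apply,
      ← inner_conj_symm]
    rw [hx (T (T x)) ⟨_, rfl⟩, ]
    simp
  have := (Submodule.dense_iff_topologicalClosure_eq_top).mpr h
  rwa [LinearMap.coe_range] at this

/-- If `P`, `Q` are commuting positive operators and `P f = Q g`, then `⟨f, g⟩ ≥ 0`. -/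
lemma re_inner_nonneg_of_commute {P Q : H →L[ℂ] H} (hP : P.IsPositive) (hQ : Q.IsPositive)
    (hc : Commute P Q) (hi : Function.Injective Q) {f g : H} (hfg : P f = Q g) :
    0 ≤ (inner ℂ f g).re := by
  have hd := dense_range_of_injective hQ hi
  -- the resolvents `R t = (Q + t)⁻¹`
  have hunit : ∀ t : ℝ, 0 < t → IsUnit (Q + (t : ℂ) • (1 : H →L[ℂ] H)) := fun t ht => by
    refine isUnit_of_coercive_re ht fun x => ?_
    have := hQ.re_nonneg x
    rw [← hQ.symm_apply] at this
    simp only [add_apply, smul_apply, inner_add_left, inner_smul_left,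
      Complex.conj_ofReal, Complex.add_re, Complex.re_ofReal_mul]
    change _ ≤ _ + t * (inner ℂ x x).re
    rw [re_inner_self]; linarith
  -- With R = (Q+t)⁻¹ one has ⟨f, PRf⟩ ≥ 0, since f = (Q+t)Rf and QP ≥ 0, whereas PRf = RPf = RQg =
  -- g - tRg. The remainder tRg is small for small t because g is a limit of vectors Qh.
  have key : ∀ ε > 0, -ε ≤ (inner ℂ f g).re := by
    intro ε hε
    obtain ⟨h, hh⟩ := Metric.denseRange_iff.mp hd g (ε / (2 * (‖f‖ + 1))) (by positivity)
    -- Since ‖RQh‖ ≤ 2‖h‖, this t makes ‖tRQh‖ at most ε/(2(‖f‖+1)), the same as the approximation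
    -- error of g by Qh.
    set t : ℝ := ε / (4 * (‖f‖ + 1) * (‖h‖ + 1)) with ht_def
    have ht : 0 < t := by positivity
    obtain ⟨u, hu⟩ := hunit t ht
    set R : H →L[ℂ] H := ↑(u⁻¹) with hR
    have hRl : ∀ x, R (Q x + (t : ℂ) • x) = x := fun x => by
      have := congrArg (fun T : H →L[ℂ] H => T x) (Units.inv_mul u)
      rw [hu] at this; simpa using this
    have hRr : ∀ x, Q (R x) + (t : ℂ) • R x = x := fun x => by
      have := congrArg (fun T : H →L[ℂ] H => T x) (Units.mul_inv u)
      rw [hu] at this; simpa using this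
    have hcu : Commute P (u : H →L[ℂ] H) := by
      rw [hu]; exact hc.add_right ((Commute.one_right P).smul_right _)
    have hcR : Commute P R := hcu.units_inv_right
    have hPR : ∀ x, P (R x) = R (P x) := fun x => congrArg (fun T : H →L[ℂ] H => T x) hcR.eq
    have hcQ : Commute Q (u : H →L[ℂ] H) := by
      rw [hu]; exact (Commute.refl Q).add_right ((Commute.one_right Q).smul_right _)
    have hQR : ∀ x, Q (R x) = R (Q x) := fun x =>
      congrArg (fun T : H →L[ℂ] H => T x) hcQ.units_inv_right.eq
    -- bound `t ‖R x‖ ≤ ‖x‖`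
    have hRb : ∀ x, t * ‖R x‖ ≤ ‖x‖ := fun x => by
      have h1 : t * ‖R x‖ ^ 2 ≤ (inner ℂ (R x) x).re := by
        have h2 := hQ.re_nonneg (R x)
        have h3 := congrArg (fun z => (inner ℂ (R x) z).re) (hRr x)
        simp only [inner_add_right, inner_smul_right, Complex.add_re, Complex.re_ofReal_mul,
          re_inner_self] at h3
        linarith
      have h4 : (inner ℂ (R x) x).re ≤ ‖R x‖ * ‖x‖ :=
        (Complex.re_le_norm _).trans (norm_inner_le_norm _ _)
      rcases (norm_nonneg (R x)).eq_or_lt with h0 | h0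
      · rw [← h0]; simp
      · have : ‖R x‖ * (t * ‖R x‖) ≤ ‖R x‖ * ‖x‖ := by nlinarith
        exact le_of_mul_le_mul_left this h0
    have hPRpos : 0 ≤ (inner ℂ f (P (R f))).re := by
      have e : inner ℂ f (P (R f)) = inner ℂ (Q (R f)) (P (R f))
          + (t : ℂ) * inner ℂ (R f) (P (R f)) := by
        conv_lhs => rw [← hRr f]
        rw [inner_add_left, inner_smul_left, Complex.conj_ofReal]
        rw [hRr]
      have hPQ : (Q * P).IsPositive := by
        rw [← nonneg_iff_isPositive] at hP hQ ⊢
        exact Commute.mul_nonneg hQ hP hc.symm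
      rw [e, Complex.add_re, Complex.re_ofReal_mul, hQ.symm_apply]
      exact add_nonneg (hPQ.re_nonneg (R f)) (mul_nonneg ht.le (hP.re_nonneg _))
    have e2 : P (R f) = g - (t : ℂ) • R g := by
      rw [hPR, hfg, ← hQR, eq_sub_iff_add_eq, hRr]
    rw [e2, inner_sub_right, Complex.sub_re] at hPRpos
    have hsmall : ‖(t : ℂ) • R g‖ ≤ ε / (‖f‖ + 1) := by
      have e3 : (t : ℂ) • R g = (t : ℂ) • R (g - Q h) + (t : ℂ) • R (Q h) := by
        rw [← smul_add, ← map_add, sub_add_cancel]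
      have h5 : ‖(t : ℂ) • R (g - Q h)‖ ≤ ε / (2 * (‖f‖ + 1)) := by
        rw [norm_smul, Complex.norm_real, Real.norm_of_nonneg ht.le]
        refine (hRb _).trans ?_
        rw [← dist_eq_norm]; exact hh.le
      have h6 : ‖(t : ℂ) • R (Q h)‖ ≤ ε / (2 * (‖f‖ + 1)) := by
        have e4 : R (Q h) = h - (t : ℂ) • R h := by
          rw [← hQR, eq_sub_iff_add_eq, hRr]
        have h7 : ‖R (Q h)‖ ≤ 2 * ‖h‖ := by
          rw [e4]
          refine (norm_sub_le _ _).trans ?_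
          rw [norm_smul, Complex.norm_real, Real.norm_of_nonneg ht.le]
          linarith [hRb h]
        rw [norm_smul, Complex.norm_real, Real.norm_of_nonneg ht.le]
        calc t * ‖R (Q h)‖ ≤ t * (2 * (‖h‖ + 1)) := by gcongr; linarith
          _ = ε / (2 * (‖f‖ + 1)) := by rw [ht_def]; field_simp; ring
      rw [e3]
      refine (norm_add_le _ _).trans ?_
      refine (add_le_add h5 h6).trans (le_of_eq ?_)
      field_simp; ring
    have h8 : -(inner ℂ f ((t : ℂ) • R g)).re ≤ ‖f‖ * (ε / (‖f‖ + 1)) := by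
      refine (neg_le_abs _).trans ((Complex.abs_re_le_norm _).trans ((norm_inner_le_norm _ _).trans ?_))
      gcongr
    have h9 : ‖f‖ * (ε / (‖f‖ + 1)) ≤ ε := by
      rw [mul_div_assoc', div_le_iff₀ (by positivity)]
      nlinarith [norm_nonneg f]
    linarith
  exact le_of_forall_pos_le_add fun ε hε => by linarith [key ε hε]

/-- If `0 ≤ P ≤ K` and `0 ≤ Q ≤ L` commute, then `P Q ≤ K L`. -/
lemma re_inner_comp_le_of_commute {P Q K L : H →L[ℂ] H} (hP : P.IsPositive) (hQ : Q.IsPositive)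
    (hPK : (K - P).IsPositive) (hQL : (L - Q).IsPositive) (hKL : Commute K L)
    (hPL : Commute P L) (hPQ : Commute P Q) (x : H) :
    (inner ℂ x (P (Q x))).re ≤ (inner ℂ x (K (L x))).re := by
  have hL : L.IsPositive := by
    have := hQL.add hQ
    rwa [sub_add_cancel] at this
  rw [← nonneg_iff_isPositive] at hP hPK hQL hL
  -- KL - PQ = (K-P)L + P(L-Q), two products of commuting positive operators.
  have h1 := (nonneg_iff_isPositive _).mp (Commute.mul_nonneg hPK hL (hKL.sub_left hPL))
  have h2 := (nonneg_iff_isPositive _).mp (Commute.mul_nonneg hP hQL (hPL.sub_right hPQ))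
  have h3 := h1.re_nonneg x
  have h4 := h2.re_nonneg x
  simp only [mul_apply_eq_comp, sub_apply, map_sub, inner_sub_right, Complex.sub_re] at h3 h4
  linarith

/-- Let `P`, `Q` be commuting positive operators and `M` an orthogonal projection with
`M P Q M ≤ c`. If `ψ = P f = Q g`, then `‖M ψ‖² ≤ c ⟨f, g⟩`. -/
lemma norm_sq_proj_le_of_commute {P Q M : H →L[ℂ] H} (hP : P.IsPositive) (hQ : Q.IsPositive)
    (hc : Commute P Q) (hi : Function.Injective Q) {c : ℝ} (hc0 : 0 < c)
    (hMs : ∀ x, (inner ℂ x (M x)).re = ‖M x‖ ^ 2)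
    (hM : ∀ x, (inner ℂ (M x) (P (Q (M x)))).re ≤ c * ‖M x‖ ^ 2) {f g ψ : H}
    (hf : P f = ψ) (hg : Q g = ψ) : ‖M ψ‖ ^ 2 ≤ c * (inner ℂ f g).re := by
  set φ := M ψ with hφ
  have hPQ : ∀ x, P (Q x) = Q (P x) := fun x => congrArg (fun T : H →L[ℂ] H => T x) hc.eq
  -- The shifted pair corresponds to the vector ψ - c⁻¹PQφ. Expanding gives Re⟨f,g⟩ ≥ 2c⁻¹‖φ‖² -
  -- c⁻²Re⟨φ,PQφ⟩, and the hypothesis bounds the last term by c⁻¹‖φ‖².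
  have h1 := re_inner_nonneg_of_commute hP hQ hc hi
    (f := f - ((c⁻¹ : ℝ) : ℂ) • Q φ) (g := g - ((c⁻¹ : ℝ) : ℂ) • P φ)
    (by simp only [map_sub, map_smul, hf, hg, hPQ])
  have e1 : inner ℂ f (P φ) = inner ℂ ψ φ := by rw [← hP.symm_apply, hf]
  have e2 : inner ℂ (Q φ) g = inner ℂ φ ψ := by rw [hQ.symm_apply, hg]
  have e3 : inner ℂ (Q φ) (P φ) = inner ℂ φ (P (Q φ)) := by rw [hQ.symm_apply, hPQ]
  have e4 : (inner ℂ φ ψ).re = ‖φ‖ ^ 2 := by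
    rw [← hMs ψ, ← inner_conj_symm, Complex.conj_re]
  have e5 : (inner ℂ ψ φ).re = ‖φ‖ ^ 2 := hMs ψ
  simp only [inner_sub_left, inner_sub_right, inner_smul_left, inner_smul_right,
    Complex.conj_ofReal, Complex.sub_re, Complex.re_ofReal_mul, e1, e2, e3, e4, e5] at h1
  have h2 := hM ψ
  rw [← hφ] at h2
  have h3 : c⁻¹ * (c⁻¹ * (inner ℂ φ (P (Q φ))).re) ≤ c⁻¹ * ‖φ‖ ^ 2 := by
    gcongr
    rw [inv_mul_le_iff₀ hc0]; exact h2
  have h4 : c⁻¹ * ‖φ‖ ^ 2 ≤ (inner ℂ f g).re := by linarith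
  rwa [inv_mul_le_iff₀ hc0] at h4

/-- A real shift of an operator with positive inverse `B`, below the bottom of its spectrum, has a
positive inverse. -/
lemma exists_inverse_subConst {T : H →ₗ.[ℂ] H} {B : H →L[ℂ] H} (hB : B.IsPositive)
    (hT : IsInverseOf T B) (h0 : 0 < ‖B‖) {t : ℝ} (ht : t < ‖B‖⁻¹) :
    ∃ B' : H →L[ℂ] H, B'.IsPositive ∧ IsInverseOf (subConst T t) B' ∧
      ∀ f, (‖B‖⁻¹ - t) * ‖B' f‖ ^ 2 ≤ (inner ℂ f (B' f)).re := by
  -- (T-t)⁻¹ = B(1-tB)⁻¹, and 1-tB is coercive because t‖B‖ < 1; for t ≤ 0 it is even at least 1.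
  set G : H →L[ℂ] H := 1 - (t : ℂ) • B with hG
  have hBle : ∀ x, ‖B‖⁻¹ * ‖B x‖ ^ 2 ≤ (inner ℂ x (B x)).re := fun x => by
    rw [inv_mul_le_iff₀ h0]; exact hB.norm_sq_le x
  have hGa : ∀ x, G x = x - (t : ℂ) • B x := fun x => by simp [hG]
  have hu : IsUnit G := by
    refine isUnit_of_coercive_re (c := min 1 (1 - t * ‖B‖)) ?_ fun x => ?_
    · have : t * ‖B‖ < 1 := by rwa [← lt_inv_mul_iff₀' h0, mul_one]
      exact lt_min one_pos (by linarith)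
    · have h1 : (inner ℂ x (B x)).re ≤ ‖B‖ * ‖x‖ ^ 2 := by
        calc _ ≤ ‖inner ℂ x (B x)‖ := Complex.re_le_norm _
          _ ≤ ‖x‖ * ‖B x‖ := norm_inner_le_norm _ _
          _ ≤ ‖x‖ * (‖B‖ * ‖x‖) := by gcongr; exact B.le_opNorm _
          _ = _ := by ring
      have h2 := hB.re_nonneg x
      rw [hGa, inner_sub_left, inner_smul_left, Complex.conj_ofReal, hB.symm_apply, Complex.sub_re,
        Complex.re_ofReal_mul, re_inner_self]
      rcases le_total t 0 with h | h
      · nlinarith [min_le_left 1 (1 - t * ‖B‖), sq_nonneg ‖x‖]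
      · nlinarith [min_le_right 1 (1 - t * ‖B‖), sq_nonneg ‖x‖]
  obtain ⟨S, hr, hl⟩ : ∃ S : H →L[ℂ] H, (∀ x, G (S x) = x) ∧ ∀ x, S (G x) = x := by
    obtain ⟨u, hu⟩ := hu
    rw [← hu]
    exact ⟨↑(u⁻¹), fun x => congrArg (fun T : H →L[ℂ] H => T x) (Units.mul_inv u),
      fun x => congrArg (fun T : H →L[ℂ] H => T x) (Units.inv_mul u)⟩
  have hS : ∀ f, S f - (t : ℂ) • B (S f) = f := fun f => by rw [← hGa, hr]
  have hlow : ∀ f, (‖B‖⁻¹ - t) * ‖B (S f)‖ ^ 2 ≤ (inner ℂ f (B (S f))).re := fun f => by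
    have e : inner ℂ f (B (S f))
        = inner ℂ (S f) (B (S f)) - (t : ℂ) * inner ℂ (B (S f)) (B (S f)) := by
      conv_lhs => arg 2; rw [← hS f]
      rw [inner_sub_left, inner_smul_left, Complex.conj_ofReal]
    rw [e, Complex.sub_re, Complex.re_ofReal_mul, re_inner_self]
    linarith [hBle (S f)]
  refine ⟨B.comp S, isPositive_of_forall (fun x y => ?_) (fun x => ?_), fun v f => ?_, hlow⟩
  · change inner ℂ (B (S x)) y = inner ℂ x (B (S y))
    conv_lhs => arg 3; rw [← hS y]
    conv_rhs => arg 2; rw [← hS x]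
    rw [inner_sub_left, inner_sub_right, inner_smul_left, inner_smul_right,
      Complex.conj_ofReal, hB.symm_apply]
  · exact (mul_nonneg (sub_nonneg.mpr ht.le) (sq_nonneg _)).trans (hlow x)
  · change _ ↔ v = B (S f)
    constructor
    · rintro ⟨hv, rfl⟩
      have h1 := (hT v (T ⟨v, hv⟩)).mp ⟨hv, rfl⟩
      rw [subConst_apply]
      change v = B (S (T ⟨v, hv⟩ - (t : ℂ) • v))
      have h2 : T ⟨v, hv⟩ - (t : ℂ) • v = G (T ⟨v, hv⟩) := by rw [hGa, ← h1]
      rw [h2, hl]; exact h1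
    · intro hv
      obtain ⟨hd, he⟩ := (hT v (S f)).mpr hv
      refine ⟨hd, ?_⟩
      rw [subConst_apply]
      change T ⟨v, hd⟩ - (t : ℂ) • v = f
      rw [he, hv, hS]

/-- An operator with positive inverse `B` has spectrum starting at `1 / ‖B‖`. -/
lemma isLeast_infSpectrum {T : H →ₗ.[ℂ] H} {B : H →L[ℂ] H} (hB : B.IsPositive)
    (hT : IsInverseOf T B) (h0 : 0 < ‖B‖) :
    IsLeast {t : ℝ | ¬ InResolventSet T (t : ℂ)} ‖B‖⁻¹ := by
  have hnt : Nontrivial H := by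
    by_contra hn
    rw [not_nontrivial_iff_subsingleton] at hn
    have : B = 0 := ContinuousLinearMap.ext fun x => Subsingleton.elim _ _
    simp [this] at h0
  refine ⟨?_, fun t ht => ?_⟩
  · rintro ⟨R, hR1, hR2⟩
    -- ‖B‖ belongs to the spectrum of the positive operator B, while a resolvent of T at ‖B‖⁻¹ would
    -- invert ‖B‖ - B.
    have hmem := CStarAlgebra.norm_mem_spectrum_of_nonneg (a := B)
      ((nonneg_iff_isPositive B).mpr hB)
    rw [spectrum.mem_iff] at hmem
    apply hmem
    have hval : ∀ x, (algebraMap ℝ (H →L[ℂ] H) ‖B‖ - B) x = (‖B‖ : ℂ) • x - B x := fun x => by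
      simp [Algebra.algebraMap_eq_smul_one]
    have hne : (‖B‖ : ℂ) ≠ 0 := by exact_mod_cast h0.ne'
    rw [isUnit_iff_bijective]
    constructor
    · rw [injective_iff_map_eq_zero]
      intro a ha
      rw [hval, sub_eq_zero] at ha
      obtain ⟨hd, he⟩ := (hT (B a) a).mpr rfl
      have h1 := hR2 ⟨B a, hd⟩
      rw [he] at h1
      have h2 : a - ((‖B‖⁻¹ : ℝ) : ℂ) • B a = 0 := by
        rw [← ha, smul_smul, Complex.ofReal_inv, inv_mul_cancel₀ hne, one_smul, sub_self]
      simp only [h2, map_zero] at h1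
      rw [← h1] at ha
      exact (smul_eq_zero.mp ha).resolve_left hne
    · intro f
      obtain ⟨hd, he⟩ := hR1 ((‖B‖ : ℂ)⁻¹ • f)
      have h1 := (hT _ _).mp ⟨hd, rfl⟩
      refine ⟨T ⟨_, hd⟩, ?_⟩
      rw [hval, ← h1]
      have h2 := congrArg (fun z => (‖B‖ : ℂ) • z) he
      simp only [smul_sub, smul_smul, Complex.ofReal_inv, mul_inv_cancel₀ hne, one_smul] at h2
      exact h2
  · by_contra hlt
    rw [not_le] at hlt
    apply ht
    obtain ⟨B', -, hB', -⟩ := exists_inverse_subConst hB hT h0 hlt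
    refine ⟨B', fun f => ?_, fun u => ?_⟩
    · obtain ⟨hd, he⟩ := (hB' (B' f) f).mpr rfl
      rw [subConst_apply] at he
      exact ⟨hd, he⟩
    · exact ((hB' u (T u - (t : ℂ) • (u : H))).mp ⟨u.2, subConst_apply T t u⟩).symm

lemma infSpectrum_eq {T : H →ₗ.[ℂ] H} {B : H →L[ℂ] H} (hB : B.IsPositive)
    (hT : IsInverseOf T B) (h0 : 0 < ‖B‖) : infSpectrum T = ‖B‖⁻¹ :=
  (isLeast_infSpectrum hB hT h0).csInf_eq

end HilbertSpace

/-! ### The identification L²(X × Y) = L²(X; L²(Y)) -/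

section Curry

/-- Open sets are countable unions of balls of radius 1/(n+1) centred in a countable dense set. It
is used to see that taking sections is a measurable L²-valued map. -/
lemma measurable_of_measurable_edist {α β : Type*} [MeasurableSpace α] [PseudoEMetricSpace β]
    [SecondCountableTopology β] [MeasurableSpace β] [BorelSpace β] {f : α → β}
    (h : ∀ b, Measurable fun a => edist (f a) b) : Measurable f := by
  refine measurable_of_isOpen fun U hU => ?_
  obtain ⟨s, hsc, hsd⟩ := TopologicalSpace.exists_countable_dense β
  have hset : f ⁻¹' U = ⋃ b ∈ s, ⋃ n : ℕ, ⋃ _ : Metric.eball b ((n : ℝ≥0∞) + 1)⁻¹ ⊆ U,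
      {a | edist (f a) b < ((n : ℝ≥0∞) + 1)⁻¹} := by
    ext a
    simp only [Set.mem_preimage, Set.mem_iUnion, Set.mem_ofPred_eq, exists_prop]
    constructor
    · intro ha
      obtain ⟨r, hr, hrU⟩ := EMetric.isOpen_iff.mp hU (f a) ha
      obtain ⟨n, hn⟩ := ENNReal.exists_inv_nat_lt (ENNReal.half_pos hr.ne').ne'
      have hn' : ((n : ℝ≥0∞) + 1)⁻¹ < r / 2 :=
        lt_of_le_of_lt (ENNReal.inv_le_inv.mpr le_self_add) hn
      obtain ⟨b, hb, hbs⟩ := EMetric.mem_closure_iff.mp (hsd (f a)) ((n : ℝ≥0∞) + 1)⁻¹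
        (by simp [ENNReal.add_eq_top])
      refine ⟨b, hb, n, fun c hc => hrU ?_, hbs⟩
      calc edist c (f a) ≤ edist c b + edist b (f a) := edist_triangle _ _ _
        _ < r / 2 + r / 2 := by
          rw [edist_comm b]
          exact ENNReal.add_lt_add (lt_trans hc hn') (lt_trans hbs hn')
        _ = r := ENNReal.add_halves r
    · rintro ⟨b, -, n, hsub, hlt⟩
      exact hsub hlt
  rw [hset]
  refine MeasurableSet.biUnion hsc fun b _ => MeasurableSet.iUnion fun n =>
    MeasurableSet.iUnion fun _ => measurableSet_lt (h b) measurable_const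

variable {X Y : Type*} [MeasurableSpace X] [MeasurableSpace Y] {μ : Measure X} {ν : Measure Y}
  [SFinite ν]

open Classical in
/-- The section `F(x, ·)` of a square integrable function on a product. -/
def fiber (F : Lp ℂ 2 (μ.prod ν)) (x : X) : Lp ℂ 2 ν :=
  if h : MemLp (fun y => F (x, y)) 2 ν then h.toLp else 0

lemma eLpNorm_two_sq {α E : Type*} [MeasurableSpace α] {μ : Measure α} [NormedAddCommGroup E]
    (f : α → E) : eLpNorm f 2 μ ^ 2 = ∫⁻ x, ‖f x‖ₑ ^ 2 ∂μ := by
  rw [eLpNorm_eq_lintegral_rpow_enorm_toReal (by norm_num) (by norm_num)]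
  simp only [ENNReal.toReal_ofNat, ENNReal.rpow_ofNat, one_div]
  rw [← ENNReal.rpow_natCast, ← ENNReal.rpow_mul]
  norm_num

lemma ae_memLp_section (F : Lp ℂ 2 (μ.prod ν)) : ∀ᵐ x ∂μ, MemLp (fun y => F (x, y)) 2 ν := by
  have hm := Lp.stronglyMeasurable F
  have h1 : ∫⁻ x, ∫⁻ y, ‖F (x, y)‖ₑ ^ 2 ∂ν ∂μ < (⊤ : ℝ≥0∞) := by
    rw [← lintegral_prod (μ := μ) (ν := ν) (fun z : X × Y => ‖F z‖ₑ ^ 2) (by fun_prop), ← eLpNorm_two_sq]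
    exact ENNReal.pow_lt_top (Lp.memLp F).2
  have h2 : Measurable fun x => ∫⁻ y, ‖F (x, y)‖ₑ ^ 2 ∂ν :=
    Measurable.lintegral_prod_right' (f := fun z : X × Y => ‖F z‖ₑ ^ 2) (by fun_prop)
  filter_upwards [ae_lt_top h2 h1.ne] with x hx
  refine ⟨(hm.comp_measurable measurable_prodMk_left).aestronglyMeasurable, ?_⟩
  rw [← eLpNorm_two_sq] at hx
  by_contra hcon
  rw [not_lt_top_iff] at hcon
  simp [hcon] at hx

lemma fiber_ae_eq (F : Lp ℂ 2 (μ.prod ν)) : ∀ᵐ x ∂μ, ∀ᵐ y ∂ν, fiber F x y = F (x, y) := by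
  filter_upwards [ae_memLp_section F] with x hx
  rw [fiber, dif_pos hx]
  exact hx.coeFn_toLp

/-- The distance from the section at x to a fixed g is the square root of an integral depending on
the parameter x, hence measurable in x. -/
lemma measurable_fiber [SecondCountableTopology (Lp ℂ 2 ν)] (F : Lp ℂ 2 (μ.prod ν)) :
    StronglyMeasurable (fiber F) := by
  borelize ↥(Lp ℂ 2 ν)
  refine Measurable.stronglyMeasurable (measurable_of_measurable_edist fun g => ?_)
  have hm := Lp.stronglyMeasurable F
  have hg := Lp.stronglyMeasurable g
  have hmem : ∀ x, MemLp (fun y => F (x, y)) 2 ν ↔ ∫⁻ y, ‖F (x, y)‖ₑ ^ 2 ∂ν < (⊤ : ℝ≥0∞) := fun x => by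
    rw [← eLpNorm_two_sq]
    constructor
    · exact fun h => ENNReal.pow_lt_top h.2
    · refine fun h => ⟨(hm.comp_measurable measurable_prodMk_left).aestronglyMeasurable, ?_⟩
      by_contra hcon
      rw [not_lt_top_iff] at hcon
      simp [hcon] at h
  have h2 : Measurable fun x => ∫⁻ y, ‖F (x, y)‖ₑ ^ 2 ∂ν :=
    Measurable.lintegral_prod_right' (f := fun z : X × Y => ‖F z‖ₑ ^ 2) (by fun_prop)
  have h3 : Measurable fun x => (∫⁻ y, ‖F (x, y) - g y‖ₑ ^ 2 ∂ν) ^ (1 / 2 : ℝ) := by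
    refine (Measurable.lintegral_prod_right' (f := fun z : X × Y => ‖F z - g z.2‖ₑ ^ 2) ?_).pow_const _
    exact ((hm.sub (hg.comp_measurable measurable_snd)).enorm).pow_const 2
  have e : (fun x => edist (fiber F x) g) = fun x =>
      if ∫⁻ y, ‖F (x, y)‖ₑ ^ 2 ∂ν < (⊤ : ℝ≥0∞) then (∫⁻ y, ‖F (x, y) - g y‖ₑ ^ 2 ∂ν) ^ (1 / 2 : ℝ)
      else edist 0 g := by
    funext x
    by_cases hx : MemLp (fun y => F (x, y)) 2 ν
    · rw [fiber, dif_pos hx, if_pos ((hmem x).mp hx), Lp.edist_def, ← eLpNorm_two_sq,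
        ← ENNReal.rpow_natCast, ← ENNReal.rpow_mul]
      norm_num
      refine eLpNorm_congr_ae ?_
      filter_upwards [hx.coeFn_toLp] with y hy
      simp [hy]
    · rw [fiber, dif_neg hx, if_neg (fun h => hx ((hmem x).mpr h))]
  rw [e]
  exact Measurable.ite (measurableSet_lt h2 measurable_const) h3 measurable_const

lemma lintegral_fiber (F : Lp ℂ 2 (μ.prod ν)) :
    ∫⁻ x, ‖fiber F x‖ₑ ^ 2 ∂μ = ∫⁻ z, ‖F z‖ₑ ^ 2 ∂(μ.prod ν) := by
  have hm := Lp.stronglyMeasurable F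
  rw [lintegral_prod _ (by fun_prop)]
  refine lintegral_congr_ae ?_
  filter_upwards [ae_memLp_section F] with x hx
  rw [fiber, dif_pos hx, ← eLpNorm_two_sq, Lp.enorm_toLp]

variable [SecondCountableTopology (Lp ℂ 2 ν)]

lemma memLp_fiber (F : Lp ℂ 2 (μ.prod ν)) : MemLp (fiber F) 2 μ := by
  refine ⟨(measurable_fiber F).aestronglyMeasurable, ?_⟩
  have h := lintegral_fiber F
  rw [← eLpNorm_two_sq, ← eLpNorm_two_sq] at h
  have h1 := ENNReal.pow_lt_top (n := 2) (Lp.memLp F).2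
  rw [← h] at h1
  by_contra hcon
  rw [not_lt_top_iff] at hcon
  simp [hcon] at h1

variable (μ ν) in
/-- The isometry `L²(X × Y) → L²(X; L²(Y))`. -/
def curryIsometry : Lp ℂ 2 (μ.prod ν) →ₗᵢ[ℂ] Lp (Lp ℂ 2 ν) 2 μ where
  toFun F := (memLp_fiber F).toLp
  map_add' F G := by
    ext1
    have h := Measure.ae_ae_of_ae_prod (Lp.coeFn_add F G)
    filter_upwards [(memLp_fiber (F + G)).coeFn_toLp, (memLp_fiber F).coeFn_toLp,
      (memLp_fiber G).coeFn_toLp, Lp.coeFn_add (memLp_fiber F).toLp (memLp_fiber G).toLp,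
      fiber_ae_eq F, fiber_ae_eq G, fiber_ae_eq (F + G), h] with x h1 h2 h3 h4 h5 h6 h7 h8
    rw [h1, h4, Pi.add_apply, h2, h3]
    ext1
    filter_upwards [h5, h6, h7, h8, Lp.coeFn_add (fiber F x) (fiber G x)] with y h5 h6 h7 h8 h9
    rw [h9, h7, h8, Pi.add_apply, Pi.add_apply, h5, h6]
  map_smul' c F := by
    ext1
    have h := Measure.ae_ae_of_ae_prod (Lp.coeFn_smul c F)
    filter_upwards [(memLp_fiber (c • F)).coeFn_toLp, (memLp_fiber F).coeFn_toLp,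
      Lp.coeFn_smul c (memLp_fiber F).toLp,
      fiber_ae_eq F, fiber_ae_eq (c • F), h] with x h1 h2 h4 h5 h7 h8
    rw [h1, RingHom.id_apply, h4, Pi.smul_apply, h2]
    ext1
    filter_upwards [h5, h7, h8, Lp.coeFn_smul c (fiber F x)] with y h5 h7 h8 h9
    rw [h9, h7, h8, Pi.smul_apply, Pi.smul_apply, h5]
  norm_map' F := by
    change ‖(memLp_fiber F).toLp‖ = ‖F‖
    have h := lintegral_fiber F
    rw [← eLpNorm_two_sq, ← eLpNorm_two_sq] at h
    rw [Lp.norm_toLp, Lp.norm_def, (ENNReal.pow_right_strictMono two_ne_zero).injective h]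

lemma curryIsometry_ae (F : Lp ℂ 2 (μ.prod ν)) :
    ∀ᵐ x ∂μ, ∀ᵐ y ∂ν, curryIsometry μ ν F x y = F (x, y) := by
  filter_upwards [(memLp_fiber F).coeFn_toLp, fiber_ae_eq F] with x h1 h2
  have : curryIsometry μ ν F x = fiber F x := h1
  rw [this]; exact h2

/-- An isometry from a complete space has closed range, so it suffices to reach the functions 1_s ⊗
c and their sums. -/
lemma curryIsometry_surjective : Function.Surjective (curryIsometry μ ν) := by
  intro G
  have hclosed : IsClosed (Set.range (curryIsometry μ ν)) :=
    (curryIsometry μ ν).isometry.isClosedEmbedding.isClosed_range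
  refine Lp.induction (by norm_num) (motive := fun G => G ∈ Set.range (curryIsometry μ ν))
    ?_ ?_ hclosed G
  · intro c s hs hμs
    have hmem : MemLp (fun z : X × Y => s.indicator (fun _ => (1 : ℂ)) z.1 * c z.2) 2
        (μ.prod ν) := by
      have hs' : AEStronglyMeasurable (s.indicator fun _ => (1 : ℂ)) μ :=
        (stronglyMeasurable_const.indicator hs).aestronglyMeasurable
      refine (memLp_two_iff_integrable_sq_norm (hs'.comp_fst.mul
        (Lp.aestronglyMeasurable c).comp_snd)).mpr ?_
      have h1 : Integrable (fun x => ‖s.indicator (fun _ => (1 : ℂ)) x‖ ^ 2) μ := by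
        rw [← memLp_two_iff_integrable_sq_norm hs']
        exact memLp_indicator_const 2 hs 1 (Or.inr hμs.ne)
      have h2 : Integrable (fun y => ‖c y‖ ^ 2) ν :=
        (memLp_two_iff_integrable_sq_norm (Lp.aestronglyMeasurable c)).mp (Lp.memLp c)
      refine (h1.mul_prod h2).congr (Eventually.of_forall fun z => ?_)
      simp only [Pi.mul_apply, norm_mul, mul_pow]
    refine ⟨hmem.toLp, ?_⟩
    rw [Lp.simpleFunc.coe_indicatorConst]
    ext1
    have h := Measure.ae_ae_of_ae_prod hmem.coeFn_toLp
    filter_upwards [curryIsometry_ae hmem.toLp, h,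
      indicatorConstLp_coeFn (p := 2) (hs := hs) (hμs := hμs.ne) (c := c)] with x h1 h2 h3
    rw [h3]
    by_cases hx : x ∈ s
    · rw [Set.indicator_of_mem hx]
      ext1
      filter_upwards [h1, h2] with y h1 h2
      rw [h1, h2, Set.indicator_of_mem hx, one_mul]
    · rw [Set.indicator_of_notMem hx]
      ext1
      filter_upwards [h1, h2, Lp.coeFn_zero ℂ 2 ν] with y h1 h2 h3
      rw [h1, h2, Set.indicator_of_notMem hx, zero_mul, h3, Pi.zero_apply]
  · rintro f g hf hg - ⟨a, ha⟩ ⟨b, hb⟩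
    exact ⟨a + b, by rw [map_add, ha, hb]⟩

variable (μ ν) in
/-- The identification `L²(X × Y) = L²(X; L²(Y))`. -/
def curryEquiv : Lp ℂ 2 (μ.prod ν) ≃ₗᵢ[ℂ] Lp (Lp ℂ 2 ν) 2 μ :=
  LinearIsometryEquiv.ofSurjective (curryIsometry μ ν) curryIsometry_surjective

end Curry

/-! ### One-particle operators acting on one variable -/

section Slots

instance secondCountable_L2 : SecondCountableTopology L2 :=
  haveI : Fact ((2 : ℝ≥0∞) ≠ ⊤) := ⟨by norm_num⟩
  inferInstance

variable {n : ℕ}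

/-- Insert a particle at the `j`-th position. -/
def slot (j : Fin (n + 1)) (z : Config n × E3) : Config (n + 1) :=
  Fin.insertNth (α := fun _ => E3) j z.2 z.1

/-- Single out the `j`-th particle. -/
def unslot (j : Fin (n + 1)) (x : Config (n + 1)) : Config n × E3 :=
  (Fin.removeNth (α := fun _ => E3) j x, x j)

lemma slot_unslot (j : Fin (n + 1)) (x : Config (n + 1)) : slot j (unslot j x) = x := by
  simp [slot, unslot]

lemma unslot_slot (j : Fin (n + 1)) (z : Config n × E3) : unslot j (slot j z) = z := by
  simp [slot, unslot]

lemma slot_apply_self (j : Fin (n + 1)) (z : Config n × E3) : slot j z j = z.2 := by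
  simp [slot]

lemma slot_apply_succAbove (j : Fin (n + 1)) (z : Config n × E3) (k : Fin n) :
    slot j z (j.succAbove k) = z.1 k := by
  simp [slot]

lemma update_slot (j : Fin (n + 1)) (z : Config n × E3) (y : E3) :
    Function.update (slot j z) j y = slot j (z.1, y) := by
  simp [slot]

lemma measurePreserving_unslot (j : Fin (n + 1)) :
    MeasurePreserving (unslot j) volume ((volume : Measure (Config n)).prod volume) :=
  Measure.measurePreserving_swap.comp (volume_preserving_piFinSuccAbove (fun _ => E3) j)

lemma measurePreserving_slot (j : Fin (n + 1)) :
    MeasurePreserving (slot j) ((volume : Measure (Config n)).prod volume) volume :=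
  ((volume_preserving_piFinSuccAbove (fun _ => E3) j).symm).comp Measure.measurePreserving_swap

lemma ae_slot {j : Fin (n + 1)} {P : Config (n + 1) → Prop} (h : ∀ᵐ x, P x) :
    ∀ᵐ x' : Config n, ∀ᵐ y : E3, P (slot j (x', y)) :=
  Measure.ae_ae_of_ae_prod ((measurePreserving_slot j).quasiMeasurePreserving.ae h)

/-- The isometry `L²((ℝ³)^{n+1}) ≃ L²((ℝ³)^n × ℝ³)`. -/
def slotEquiv (j : Fin (n + 1)) :
    L2N (n + 1) ≃ₗᵢ[ℂ] Lp ℂ 2 ((volume : Measure (Config n)).prod (volume : Measure E3)) :=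
  LinearIsometryEquiv.ofSurjective
    (Lp.compMeasurePreservingₗᵢ ℂ (slot j) (measurePreserving_slot j)) fun F => by
      refine ⟨Lp.compMeasurePreserving (unslot j) (measurePreserving_unslot j) F, ?_⟩
      change Lp.compMeasurePreserving (slot j) (measurePreserving_slot j)
        (Lp.compMeasurePreserving (unslot j) (measurePreserving_unslot j) F) = F
      rw [← Lp.compMeasurePreserving_comp_apply]
      have : unslot j ∘ slot j = id := funext (unslot_slot j)
      simp only [this, Lp.compMeasurePreserving_id_apply]

/-- The identification `L²((ℝ³)^{n+1}) = L²((ℝ³)^n; L²(ℝ³))` singling out the `j`-th variable. -/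
def curryAt (j : Fin (n + 1)) : L2N (n + 1) ≃ₗᵢ[ℂ] Lp L2 2 (volume : Measure (Config n)) :=
  (slotEquiv j).trans (curryEquiv volume volume)

lemma curryAt_ae (j : Fin (n + 1)) (F : L2N (n + 1)) :
    ∀ᵐ x' : Config n, ∀ᵐ y : E3, curryAt j F x' y = F (slot j (x', y)) := by
  have h1 := curryIsometry_ae (slotEquiv j F)
  have h2 : ∀ᵐ z : Config n × E3 ∂(volume.prod volume), slotEquiv j F z = F (slot j z) :=
    Lp.coeFn_compMeasurePreserving F (measurePreserving_slot j)
  filter_upwards [h1, Measure.ae_ae_of_ae_prod h2] with x' h1 h2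
  filter_upwards [h1, h2] with y h1 h2
  rw [← h2, ← h1]; rfl

/-- A function determined by its sections. -/
lemma curryAt_eq_of_ae {j : Fin (n + 1)} {F : L2N (n + 1)} {x' : Config n} {u : L2}
    (h1 : ∀ᵐ y : E3, curryAt j F x' y = F (slot j (x', y)))
    (h2 : ∀ᵐ y : E3, u y = F (slot j (x', y))) : curryAt j F x' = u := by
  ext1
  filter_upwards [h1, h2] with y h1 h2
  rw [h1, h2]

/-- The operator `A` acting on the `j`-th variable. -/
def lift (j : Fin (n + 1)) (A : L2 →L[ℂ] L2) : L2N (n + 1) →L[ℂ] L2N (n + 1) :=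
  (curryAt j).symm.toContinuousLinearEquiv.toContinuousLinearMap.comp
    ((A.compLpL 2 volume).comp (curryAt j).toContinuousLinearEquiv.toContinuousLinearMap)

lemma curryAt_lift (j : Fin (n + 1)) (A : L2 →L[ℂ] L2) (F : L2N (n + 1)) :
    ∀ᵐ x' : Config n, curryAt j (lift j A F) x' = A (curryAt j F x') := by
  have : curryAt j (lift j A F) = A.compLpL 2 volume (curryAt j F) := by
    simp [lift]
  rw [this]
  exact A.coeFn_compLpL _

lemma eq_lift_iff {j : Fin (n + 1)} {A : L2 →L[ℂ] L2} {F G : L2N (n + 1)} :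
    F = lift j A G ↔ ∀ᵐ x' : Config n, curryAt j F x' = A (curryAt j G x') := by
  constructor
  · rintro rfl
    exact curryAt_lift j A G
  · intro h
    apply (curryAt j).injective
    ext1
    filter_upwards [h, curryAt_lift j A G] with x' h1 h2
    rw [h1, h2]

lemma inner_curryAt (j : Fin (n + 1)) (F G : L2N (n + 1)) :
    inner ℂ F G = ∫ x' : Config n, inner ℂ (curryAt j F x') (curryAt j G x') := by
  rw [← (curryAt j).inner_map_map, L2.inner_def]

lemma inner_lift (j : Fin (n + 1)) (A : L2 →L[ℂ] L2) (F G : L2N (n + 1)) :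
    inner ℂ F (lift j A G) = ∫ x' : Config n, inner ℂ (curryAt j F x') (A (curryAt j G x')) := by
  rw [inner_curryAt j]
  refine integral_congr_ae ?_
  filter_upwards [curryAt_lift j A G] with x' h
  rw [h]

lemma lift_isPositive (j : Fin (n + 1)) {A : L2 →L[ℂ] L2} (hA : A.IsPositive) :
    (lift j A).IsPositive := by
  refine isPositive_of_forall (fun F G => ?_) (fun F => ?_)
  · rw [inner_lift, ← inner_conj_symm, inner_lift, ← integral_conj]
    refine integral_congr_ae (Eventually.of_forall fun x' => ?_)
    simp only [inner_conj_symm]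
    exact hA.symm_apply _ _
  · rw [inner_lift]
    have hint : Integrable fun x' : Config n =>
        inner ℂ (curryAt j F x') (A (curryAt j F x')) := by
      refine (L2.integrable_inner (𝕜 := ℂ) (curryAt j F) (curryAt j (lift j A F))).congr ?_
      filter_upwards [curryAt_lift j A F] with x' h
      rw [h]
    have := integral_re hint
    simp only [RCLike.re_to_complex] at this
    rw [← this]
    exact integral_nonneg fun x' => hA.re_nonneg _

lemma lift_injective (j : Fin (n + 1)) {A : L2 →L[ℂ] L2} (hA : Function.Injective A) :
    Function.Injective (lift j A) := by
  rw [injective_iff_map_eq_zero]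
  intro F hF
  apply (curryAt j).injective
  rw [map_zero]
  ext1
  have h0 : ∀ᵐ x' : Config n, curryAt j (lift j A F) x' = 0 := by
    rw [hF, map_zero]; exact Lp.coeFn_zero _ _ _
  filter_upwards [curryAt_lift j A F, h0, Lp.coeFn_zero L2 2 (volume : Measure (Config n))]
    with x' h1 h2 h3
  rw [h3, Pi.zero_apply]
  apply hA
  rw [map_zero, ← h1, h2]

lemma ae_of_ae_removeNth {j : Fin (n + 1)} {P : Config n → Prop}
    (h : ∀ᵐ x : Config (n + 1), P (unslot j x).1) : ∀ᵐ x' : Config n, P x' := by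
  filter_upwards [ae_slot (j := j) h] with x' hx
  obtain ⟨y, hy⟩ := hx.exists
  rwa [unslot_slot] at hy

lemma ae_removeNth {j : Fin (n + 1)} {P : Config n → Prop}
    (h : ∀ᵐ x' : Config n, P x') : ∀ᵐ x : Config (n + 1), P (unslot j x).1 :=
  (Measure.quasiMeasurePreserving_fst.comp
    (measurePreserving_unslot j).quasiMeasurePreserving).ae h

/-- The condition defining `actGraph` depends on a configuration only through the other particles,
so it can be read fibre by fibre, where it says u = Bf. -/
lemma mem_actGraph_iff {T : L2 →ₗ.[ℂ] L2} {B : L2 →L[ℂ] L2} (hT : IsInverseOf T B)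
    (j : Fin (n + 1)) (Ψ Φ : L2N (n + 1)) :
    (Ψ, Φ) ∈ actGraph (n + 1) T j ↔ Ψ = lift j B Φ := by
  have hup : ∀ (x : Config (n + 1)) (y : E3), Function.update x j y = slot j ((unslot j x).1, y) :=
    fun x y => by rw [← update_slot j (unslot j x), slot_unslot]
  rw [eq_lift_iff]
  change (∀ᵐ x : Config (n + 1), ∃ u : T.domain,
    (∀ᵐ y, (u : L2) y = Ψ (Function.update x j y)) ∧
    (∀ᵐ y, (T u) y = Φ (Function.update x j y))) ↔ _
  simp only [hup]
  constructor
  · intro h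
    filter_upwards [ae_of_ae_removeNth (P := fun x' => ∃ u : T.domain,
      (∀ᵐ y, (u : L2) y = Ψ (slot j (x', y))) ∧ ∀ᵐ y, (T u) y = Φ (slot j (x', y))) h,
      curryAt_ae j Ψ, curryAt_ae j Φ] with x' ⟨u, h1, h2⟩ h3 h4
    rw [curryAt_eq_of_ae h3 h1, curryAt_eq_of_ae h4 h2]
    exact (hT u (T u)).mp ⟨u.2, rfl⟩
  · intro h
    refine ae_removeNth (P := fun x' => ∃ u : T.domain,
      (∀ᵐ y, (u : L2) y = Ψ (slot j (x', y))) ∧ ∀ᵐ y, (T u) y = Φ (slot j (x', y))) ?_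
    filter_upwards [h, curryAt_ae j Ψ, curryAt_ae j Φ] with x' h1 h2 h3
    obtain ⟨hd, he⟩ := (hT _ _).mpr h1
    exact ⟨⟨_, hd⟩, h2, by rw [he]; exact h3⟩

/-- If `B` is the inverse of `T`, then `lift j B` is the inverse of `T` acting on the `j`-th
variable. -/
lemma isInverseOf_actOn {T : L2 →ₗ.[ℂ] L2} {B : L2 →L[ℂ] L2} (hT : IsInverseOf T B)
    (j : Fin (n + 1)) : IsInverseOf (actOn (n + 1) T j) (lift j B) := by
  have hBi : Function.Injective B := by
    rw [injective_iff_map_eq_zero]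
    intro f hf
    obtain ⟨hd, he⟩ := (hT 0 f).mpr hf.symm
    rw [← he]; exact T.map_zero
  -- `toLinearPMap` represents a relation faithfully only when it is single-valued; injectivity of
  -- the lifted inverse ensures this.
  have hsv : ∀ x ∈ actGraph (n + 1) T j, x.1 = 0 → x.2 = 0 := by
    rintro ⟨Ψ, Φ⟩ h (rfl : Ψ = 0)
    rw [mem_actGraph_iff hT] at h
    exact lift_injective j hBi (by rw [← h, map_zero])
  intro Ψ Φ
  rw [← mem_actGraph_iff hT]
  constructor
  · rintro ⟨hu, rfl⟩
    exact Submodule.mem_graph_toLinearPMap hsv ⟨Ψ, hu⟩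
  · intro h
    have h' : (Ψ, Φ) ∈ (actOn (n + 1) T j).graph := by
      rw [actOn, Submodule.toLinearPMap_graph_eq _ hsv]; exact h
    rw [LinearPMap.mem_graph_iff] at h'
    obtain ⟨y, h1, h2⟩ := h'
    obtain rfl : (y : L2N (n + 1)) = Ψ := h1
    exact ⟨y.2, h2⟩

end Slots

/-! ### Bounded multiplication operators -/

section Multiplication

variable {α : Type*} [MeasurableSpace α] {μ : Measure α}

lemma memLp_bdd_mul {f : α → ℝ} (hf : AEStronglyMeasurable f μ) {C : ℝ}
    (hC : ∀ x, |f x| ≤ C) (ψ : Lp ℂ 2 μ) : MemLp (fun x => (f x : ℂ) * ψ x) 2 μ := by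
  refine MemLp.of_le_mul (c := C) (Lp.memLp ψ)
    ((Complex.continuous_ofReal.comp_aestronglyMeasurable hf).mul (Lp.aestronglyMeasurable ψ))
    (Eventually.of_forall fun x => ?_)
  rw [norm_mul, Complex.norm_real]
  gcongr
  exact hC x

/-- Multiplication by a bounded real function, as a bounded operator on `L²`. -/
def mulL (f : α → ℝ) (hf : AEStronglyMeasurable f μ) {C : ℝ} (hC : ∀ x, |f x| ≤ C) :
    Lp ℂ 2 μ →L[ℂ] Lp ℂ 2 μ :=
  LinearMap.mkContinuous
    { toFun := fun ψ => (memLp_bdd_mul hf hC ψ).toLp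
      map_add' := fun ψ φ => by
        ext1
        filter_upwards [(memLp_bdd_mul hf hC (ψ + φ)).coeFn_toLp,
          (memLp_bdd_mul hf hC ψ).coeFn_toLp, (memLp_bdd_mul hf hC φ).coeFn_toLp,
          Lp.coeFn_add ψ φ,
          Lp.coeFn_add (memLp_bdd_mul hf hC ψ).toLp (memLp_bdd_mul hf hC φ).toLp]
          with x h1 h2 h3 h4 h5
        rw [h1, h5, Pi.add_apply, h2, h3, h4, Pi.add_apply, mul_add]
      map_smul' := fun c ψ => by
        ext1
        filter_upwards [(memLp_bdd_mul hf hC (c • ψ)).coeFn_toLp,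
          (memLp_bdd_mul hf hC ψ).coeFn_toLp, Lp.coeFn_smul c ψ,
          Lp.coeFn_smul c (memLp_bdd_mul hf hC ψ).toLp] with x h1 h2 h3 h4
        rw [h1, RingHom.id_apply, h4, Pi.smul_apply, h2, h3, Pi.smul_apply, smul_eq_mul,
          smul_eq_mul, mul_left_comm] } C fun ψ => by
    refine Lp.norm_le_mul_norm_of_ae_le_mul ?_
    filter_upwards [(memLp_bdd_mul hf hC ψ).coeFn_toLp] with x h
    change ‖(MemLp.toLp _ (memLp_bdd_mul hf hC ψ) : Lp ℂ 2 μ) x‖ ≤ _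
    rw [h, norm_mul, Complex.norm_real]
    gcongr
    exact hC x

lemma mulL_ae {f : α → ℝ} (hf : AEStronglyMeasurable f μ) {C : ℝ} (hC : ∀ x, |f x| ≤ C)
    (ψ : Lp ℂ 2 μ) : ∀ᵐ x ∂μ, mulL f hf hC ψ x = (f x : ℂ) * ψ x :=
  (memLp_bdd_mul hf hC ψ).coeFn_toLp

lemma mulL_isSymmetric {f : α → ℝ} (hf : AEStronglyMeasurable f μ) {C : ℝ} (hC : ∀ x, |f x| ≤ C)
    (ψ φ : Lp ℂ 2 μ) : inner ℂ (mulL f hf hC ψ) φ = inner ℂ ψ (mulL f hf hC φ) := by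
  rw [L2.inner_def, L2.inner_def]
  refine integral_congr_ae ?_
  filter_upwards [mulL_ae hf hC ψ, mulL_ae hf hC φ] with x h1 h2
  rw [h1, h2, ← smul_eq_mul, ← smul_eq_mul, inner_smul_left, inner_smul_right, Complex.conj_ofReal]

lemma re_inner_mulL {f : α → ℝ} (hf : AEStronglyMeasurable f μ) {C : ℝ} (hC : ∀ x, |f x| ≤ C)
    (ψ : Lp ℂ 2 μ) : (inner ℂ ψ (mulL f hf hC ψ)).re = ∫ x, f x * ‖ψ x‖ ^ 2 ∂μ := by
  have h := integral_re (L2.integrable_inner (𝕜 := ℂ) ψ (mulL f hf hC ψ))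
  simp only [RCLike.re_to_complex] at h
  rw [L2.inner_def, ← h]
  refine integral_congr_ae ?_
  filter_upwards [mulL_ae hf hC ψ] with x h1
  rw [h1, ← smul_eq_mul, inner_smul_right, Complex.re_ofReal_mul, re_inner_self]

lemma norm_sq_eq_integral (ψ : Lp ℂ 2 μ) : ‖ψ‖ ^ 2 = ∫ x, ‖ψ x‖ ^ 2 ∂μ := by
  have h := integral_re (L2.integrable_inner (𝕜 := ℂ) ψ ψ)
  simp only [RCLike.re_to_complex] at h
  rw [← re_inner_self, L2.inner_def, ← h]
  simp only [re_inner_self]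

lemma integrable_norm_sq (ψ : Lp ℂ 2 μ) : Integrable (fun x => ‖ψ x‖ ^ 2) μ :=
  (memLp_two_iff_integrable_sq_norm (Lp.aestronglyMeasurable ψ)).mp (Lp.memLp ψ)

lemma norm_sq_mulL {f : α → ℝ} (hf : AEStronglyMeasurable f μ) {C : ℝ} (hC : ∀ x, |f x| ≤ C)
    (ψ : Lp ℂ 2 μ) : ‖mulL f hf hC ψ‖ ^ 2 = ∫ x, f x ^ 2 * ‖ψ x‖ ^ 2 ∂μ := by
  rw [norm_sq_eq_integral]
  refine integral_congr_ae ?_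
  filter_upwards [mulL_ae hf hC ψ] with x h1
  rw [h1, norm_mul, mul_pow, Complex.norm_real, Real.norm_eq_abs, sq_abs]

lemma mulL_isPositive {f : α → ℝ} (hf : AEStronglyMeasurable f μ) {C : ℝ} (hC : ∀ x, |f x| ≤ C)
    (h0 : ∀ x, 0 ≤ f x) : (mulL f hf hC).IsPositive := by
  refine isPositive_of_forall (mulL_isSymmetric hf hC) fun ψ => ?_
  rw [re_inner_mulL]
  exact integral_nonneg fun x => mul_nonneg (h0 x) (sq_nonneg _)

end Multiplication

/-! ### Translations on L² -/

section Translation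

variable {G : Type*} [AddCommGroup G] [MeasurableSpace G] [TopologicalSpace G]
  [IsTopologicalAddGroup G] [BorelSpace G] {μ : Measure G} [μ.IsAddRightInvariant]

/-- Translation by `a`: `(translate a F)(x) = F(x + a)`. -/
def translate (a : G) : Lp ℂ 2 μ →ₗᵢ[ℂ] Lp ℂ 2 μ :=
  Lp.compMeasurePreservingₗᵢ ℂ (fun x => x + a) (measurePreserving_add_right μ a)

lemma translate_ae (a : G) (F : Lp ℂ 2 μ) : ∀ᵐ x ∂μ, translate a F x = F (x + a) :=
  Lp.coeFn_compMeasurePreserving F (measurePreserving_add_right μ a)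

/-- Strong continuity is what allows averages of translations to be defined as Bochner integrals. -/
lemma continuous_translate [R1Space G] [IsLocallyFiniteMeasure μ] [μ.InnerRegularCompactLTTop]
    (F : Lp ℂ 2 μ) : Continuous fun a : G => translate a F := by
  have hc : Continuous fun a : G => (⟨⟨fun x => x + a, by fun_prop⟩,
      measurePreserving_add_right μ a⟩ : {f : C(G, G) // MeasurePreserving f μ μ}) := by
    refine Continuous.subtype_mk (ContinuousMap.continuous_of_continuous_uncurry _ ?_) _
    simp only [Function.uncurry_def, ContinuousMap.coe_mk]
    fun_prop
  exact (Lp.compMeasurePreserving_continuous (E := ℂ) (p := 2) μ μ (by norm_num)).comp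
    (continuous_const.prodMk hc)

lemma translate_translate (a b : G) (F : Lp ℂ 2 μ) :
    translate a (translate b F) = translate (a + b) F := by
  ext1
  filter_upwards [translate_ae a (translate b F), translate_ae (a + b) F,
    (measurePreserving_add_right μ a).quasiMeasurePreserving.ae (translate_ae b F)] with x h1 h2 h3
  rw [h1, h2, h3, add_assoc]

lemma translate_zero (F : Lp ℂ 2 μ) : translate 0 F = F := by
  ext1
  filter_upwards [translate_ae 0 F] with x h
  rw [h, add_zero]

lemma inner_translate (a : G) (F F' : Lp ℂ 2 μ) :
    inner ℂ (translate a F) F' = inner ℂ F (translate (-a) F') := by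
  rw [← (translate (-a)).inner_map_map, translate_translate, neg_add_cancel, translate_zero]

end Translation

/-! ### Product functions, permutations and commutation relations -/

section Tensor

variable {N : ℕ}

lemma memLp_tensor (g : Fin N → L2) :
    MemLp (fun x : Config N => ∏ k, g k (x k)) 2 volume := by
  have hm : AEStronglyMeasurable (fun x : Config N => ∏ k, g k (x k)) volume := by
    refine Finset.aestronglyMeasurable_fun_prod _ fun k _ => ?_
    exact (Lp.stronglyMeasurable (g k)).aestronglyMeasurable.comp_quasiMeasurePreserving
      (Measure.quasiMeasurePreserving_eval (fun _ : Fin N => (volume : Measure E3)) k)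
  rw [memLp_two_iff_integrable_sq_norm hm]
  have h : Integrable (fun x : Config N => ∏ k, ‖g k (x k)‖ ^ 2) volume :=
    Integrable.fintype_prod (f := fun k y => ‖g k y‖ ^ 2) fun k => integrable_norm_sq (g k)
  refine h.congr (Eventually.of_forall fun x => ?_)
  simp only [norm_prod, Finset.prod_pow]

/-- The product function `x ↦ ∏ k, g_k(x_k)`. -/
def tensor (g : Fin N → L2) : L2N N := (memLp_tensor g).toLp

lemma tensor_ae (g : Fin N → L2) : ∀ᵐ x : Config N, tensor g x = ∏ k, g k (x k) :=
  (memLp_tensor g).coeFn_toLp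

lemma inner_tensor (f g : Fin N → L2) :
    inner ℂ (tensor f) (tensor g) = ∏ k, inner ℂ (f k) (g k) := by
  simp only [L2.inner_def]
  rw [← integral_fintype_prod_volume_eq_prod (fun k y => inner ℂ (f k y) (g k y))]
  refine integral_congr_ae ?_
  filter_upwards [tensor_ae f, tensor_ae g] with x h1 h2
  rw [h1, h2]
  simp only [RCLike.inner_apply, map_prod, Finset.prod_mul_distrib]

/-- Product functions are total in `L²((ℝ³)^N)`. -/
lemma eq_zero_of_inner_tensor {F : L2N N} (h : ∀ g : Fin N → L2, inner ℂ (tensor g) F = 0) :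
    F = 0 := by
  -- integrals over boxes vanish
  have hbox : ∀ s : Fin N → Set E3, (∀ k, MeasurableSet (s k)) → (∀ k, volume (s k) ≠ ⊤) →
      ∫ x in Set.univ.pi s, F x = 0 := by
    intro s hs hfin
    rw [← h fun k => indicatorConstLp 2 (hs k) (hfin k) 1, L2.inner_def,
      ← integral_indicator (MeasurableSet.univ_pi hs)]
    refine integral_congr_ae ?_
    have h1 : ∀ᵐ x : Config N, ∀ k,
        indicatorConstLp 2 (hs k) (hfin k) (1 : ℂ) (x k) = (s k).indicator (fun _ => 1) (x k) := by
      rw [ae_all_iff]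
      exact fun k => (Measure.quasiMeasurePreserving_eval
        (fun _ : Fin N => (volume : Measure E3)) k).ae indicatorConstLp_coeFn
    filter_upwards [h1, tensor_ae fun k => indicatorConstLp 2 (hs k) (hfin k) (1 : ℂ)] with x h1 h2
    rw [h2]
    simp only [h1]
    by_cases hx : x ∈ Set.univ.pi s
    · rw [Set.indicator_of_mem hx]
      have : ∀ k, (s k).indicator (fun _ => (1 : ℂ)) (x k) = 1 := fun k =>
        Set.indicator_of_mem (hx k trivial) _
      simp [this]
    · rw [Set.indicator_of_notMem hx]
      simp only [Set.mem_pi, Set.mem_univ, forall_const, not_forall] at hx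
      obtain ⟨k, hk⟩ := hx
      have : ∏ k, (s k).indicator (fun _ => (1 : ℂ)) (x k) = 0 :=
        Finset.prod_eq_zero (Finset.mem_univ k) (Set.indicator_of_notMem hk _)
      rw [this, inner_zero_left]
  have hball : ∀ m : ℕ, ∀ᵐ x : Config N,
      x ∈ Set.univ.pi (fun _ : Fin N => Metric.ball (0 : E3) m) → F x = 0 := by
    intro m
    set Q : Set (Config N) := Set.univ.pi fun _ => Metric.ball 0 m with hQ
    have hQm : MeasurableSet Q := MeasurableSet.univ_pi fun _ => measurableSet_ball
    have hQf : volume Q ≠ ⊤ := by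
      rw [hQ, volume_pi_pi]
      exact ENNReal.prod_ne_top fun _ _ => measure_ball_lt_top.ne
    have hint : IntegrableOn F Q := by
      have : IsFiniteMeasure (volume.restrict Q) := ⟨by simpa using hQf.lt_top⟩
      exact ((Lp.memLp F).restrict Q).integrable (by norm_num)
    have hQ0 : ∫ x in Q, F x = 0 :=
      hbox _ (fun _ => measurableSet_ball) fun _ => measure_ball_lt_top.ne
    -- A π-λ argument: boxes are a generating π-system, and restriction to Q makes F integrable.
    have key : ∀ t : Set (Config N), MeasurableSet t → ∫ x in t, F x ∂(volume.restrict Q) = 0 := by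
      refine MeasurableSpace.induction_on_inter generateFrom_pi.symm isPiSystem_pi ?_ ?_ ?_ ?_
      · simp
      · rintro _ ⟨s, hs, rfl⟩
        replace hs : ∀ k, MeasurableSet (s k) := by simpa using hs
        rw [Measure.restrict_restrict (MeasurableSet.univ_pi hs), hQ,
          ← Set.pi_inter_distrib]
        refine hbox _ (fun k => (hs k).inter measurableSet_ball) fun k => ?_
        exact ((measure_mono Set.inter_subset_right).trans_lt measure_ball_lt_top).ne
      · intro t ht h0
        have := integral_add_compl ht hint
        rw [h0, zero_add] at this
        rw [this, hQ0]
      · intro f hd hm h0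
        rw [integral_iUnion hm hd hint.integrableOn]
        simp [h0]
    have := Integrable.ae_eq_zero_of_forall_setIntegral_eq_zero hint fun t ht _ => key t ht
    rwa [EventuallyEq, ae_restrict_iff' hQm] at this
  have hall : ∀ᵐ x : Config N, F x = 0 := by
    filter_upwards [ae_all_iff.mpr hball] with x hx
    obtain ⟨m, hm⟩ := exists_nat_gt (∑ k, ‖x k‖)
    refine hx m fun k _ => ?_
    rw [mem_ball_zero_iff]
    exact (Finset.single_le_sum (f := fun k => ‖x k‖) (fun _ _ => norm_nonneg _)
      (Finset.mem_univ k)).trans_lt hm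
  ext1
  filter_upwards [hall, Lp.coeFn_zero ℂ 2 (volume : Measure (Config N))] with x h1 h2
  rw [h1, h2, Pi.zero_apply]

/-- Agreement on product functions makes every vector (S-T)*F orthogonal to all of them, hence zero.
Operator identities such as commutation thereby reduce to computations in single factors. -/
lemma ext_tensor {S T : L2N N →L[ℂ] L2N N} (h : ∀ g, S (tensor g) = T (tensor g)) : S = T := by
  have hadj : ∀ F, ContinuousLinearMap.adjoint (S - T) F = 0 := fun F =>
    eq_zero_of_inner_tensor fun g => by
      rw [ContinuousLinearMap.adjoint_inner_right, sub_apply, h, sub_self,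
        inner_zero_left]
  have h1 : ContinuousLinearMap.adjoint (S - T) = 0 := ContinuousLinearMap.ext hadj
  have h2 : S - T = 0 := by
    rw [← ContinuousLinearMap.adjoint_adjoint (S - T), h1, map_zero]
  exact sub_eq_zero.mp h2

lemma lift_tensor {n : ℕ} (j : Fin (n + 1)) (A : L2 →L[ℂ] L2) (g : Fin (n + 1) → L2) :
    lift j A (tensor g) = tensor (Function.update g j (A (g j))) := by
  have hcur : ∀ g : Fin (n + 1) → L2, ∀ᵐ x' : Config n,
      curryAt j (tensor g) x' = (∏ k, g (j.succAbove k) (x' k)) • g j := by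
    intro g
    filter_upwards [curryAt_ae j (tensor g), ae_slot (j := j) (tensor_ae g)] with x' h1 h2
    refine curryAt_eq_of_ae h1 ?_
    filter_upwards [h2, Lp.coeFn_smul (∏ k, g (j.succAbove k) (x' k)) (g j)] with y h2 h3
    rw [h3, h2, Fin.prod_univ_succAbove _ j, slot_apply_self]
    simp only [slot_apply_succAbove, Pi.smul_apply, smul_eq_mul]
    ring
  symm
  rw [eq_lift_iff]
  filter_upwards [hcur g, hcur (Function.update g j (A (g j)))] with x' h1 h2
  rw [h1, h2, map_smul]
  simp

lemma lift_commute {n : ℕ} {i j : Fin (n + 1)} (hij : i ≠ j) (A B : L2 →L[ℂ] L2) :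
    Commute (lift i A) (lift j B) := by
  refine ext_tensor fun g => ?_
  change lift i A (lift j B (tensor g)) = lift j B (lift i A (tensor g))
  rw [lift_tensor, lift_tensor, lift_tensor, lift_tensor, Function.update_of_ne hij,
    Function.update_of_ne hij.symm, Function.update_comm hij]

lemma measurePreserving_perm (σ : Equiv.Perm (Fin N)) :
    MeasurePreserving (fun (x : Config N) i => x (σ i)) volume volume :=
  volume_preserving_arrowCongr' σ.symm (MeasurableEquiv.refl E3) (MeasurePreserving.id _)

/-- Relabelling of the particles. -/
def permute (σ : Equiv.Perm (Fin N)) : L2N N →ₗᵢ[ℂ] L2N N :=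
  Lp.compMeasurePreservingₗᵢ ℂ (fun x i => x (σ i)) (measurePreserving_perm σ)

lemma permute_ae (σ : Equiv.Perm (Fin N)) (F : L2N N) :
    ∀ᵐ x : Config N, permute σ F x = F fun i => x (σ i) :=
  Lp.coeFn_compMeasurePreserving F (measurePreserving_perm σ)

lemma isBosonic_iff {Ψ : L2N N} : IsBosonic N Ψ ↔ ∀ σ, permute σ Ψ = Ψ := by
  refine forall_congr' fun σ => ⟨fun h => ?_, fun h => ?_⟩
  · ext1
    filter_upwards [h, permute_ae σ Ψ] with x h1 h2
    rw [h2, h1]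
  · have := permute_ae σ Ψ
    rw [h] at this
    filter_upwards [this] with x hx
    exact hx.symm

lemma permute_tensor (σ : Equiv.Perm (Fin N)) (g : Fin N → L2) :
    permute σ (tensor g) = tensor (g ∘ σ.symm) := by
  ext1
  filter_upwards [permute_ae σ (tensor g), tensor_ae (g ∘ σ.symm),
    (measurePreserving_perm σ).quasiMeasurePreserving.ae (tensor_ae g)] with x h1 h2 h3
  rw [h1, h2, h3, ← Equiv.prod_comp σ fun k => (g ∘ σ.symm) k (x k)]
  simp

lemma permute_lift {n : ℕ} (σ : Equiv.Perm (Fin (n + 1))) (j : Fin (n + 1)) (A : L2 →L[ℂ] L2)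
    (F : L2N (n + 1)) : permute σ (lift j A F) = lift (σ j) A (permute σ F) := by
  have : (permute σ).toContinuousLinearMap.comp (lift j A)
      = (lift (σ j) A).comp (permute σ).toContinuousLinearMap := by
    refine ext_tensor fun g => ?_
    change permute σ (lift j A (tensor g)) = lift (σ j) A (permute σ (tensor g))
    rw [lift_tensor, permute_tensor, permute_tensor, lift_tensor]
    congr 1
    ext1 k
    by_cases hk : k = σ j
    · subst hk; simp
    · rw [Function.comp_apply, Function.update_of_ne hk, Function.update_of_ne,
        Function.comp_apply]
      exact fun h => hk (by rw [← h, Equiv.apply_symm_apply])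
  exact congrArg (fun T : L2N (n + 1) →L[ℂ] L2N (n + 1) => T F) this

lemma permute_mul (σ τ : Equiv.Perm (Fin N)) (F : L2N N) :
    permute σ (permute τ F) = permute (σ * τ) F := by
  have : (permute σ).toContinuousLinearMap.comp (permute τ).toContinuousLinearMap
      = (permute (σ * τ)).toContinuousLinearMap := by
    refine ext_tensor fun g => ?_
    change permute σ (permute τ (tensor g)) = permute (σ * τ) (tensor g)
    rw [permute_tensor, permute_tensor, permute_tensor]
    rfl
  exact congrArg (fun T : L2N N →L[ℂ] L2N N => T F) this

/-- A function of the other variables commutes with operators acting on the `j`-th one. -/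
lemma lift_commute_mulL {n : ℕ} {j : Fin (n + 1)} (A : L2 →L[ℂ] L2) {f : Config (n + 1) → ℝ}
    (hf : AEStronglyMeasurable f volume) {C : ℝ} (hC : ∀ x, |f x| ≤ C)
    (hind : ∀ x y, f (Function.update x j y) = f x) : Commute (lift j A) (mulL f hf hC) := by
  refine ContinuousLinearMap.ext fun F => ?_
  change lift j A (mulL f hf hC F) = mulL f hf hC (lift j A F)
  have hcur : ∀ F : L2N (n + 1), ∀ᵐ x' : Config n,
      curryAt j (mulL f hf hC F) x' = ((f (slot j (x', 0)) : ℝ) : ℂ) • curryAt j F x' := by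
    intro F
    filter_upwards [curryAt_ae j (mulL f hf hC F), curryAt_ae j F,
      ae_slot (j := j) (mulL_ae hf hC F)] with x' h1 h2 h3
    refine curryAt_eq_of_ae h1 ?_
    filter_upwards [h2, h3, Lp.coeFn_smul ((f (slot j (x', 0)) : ℝ) : ℂ) (curryAt j F x')]
      with y h2 h3 h4
    rw [h4, h3, Pi.smul_apply, h2, smul_eq_mul]
    have : f (slot j (x', y)) = f (slot j (x', 0)) := by
      rw [← hind (slot j (x', 0)) y, update_slot]
    rw [this]
  symm
  rw [eq_lift_iff]
  filter_upwards [hcur F, hcur (lift j A F), curryAt_lift j A F] with x' h1 h2 h3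
  rw [h1, h2, h3, map_smul]

lemma curryAt_translate {n : ℕ} (j : Fin (n + 1)) (y : E3) (F : L2N (n + 1)) :
    ∀ᵐ x' : Config n, curryAt j (translate (Pi.single j y) F) x' = translate y (curryAt j F x') := by
  filter_upwards [curryAt_ae j (translate (Pi.single j y) F), curryAt_ae j F,
    ae_slot (j := j) (translate_ae (Pi.single j y) F)] with x' h1 h2 h3
  refine curryAt_eq_of_ae h1 ?_
  filter_upwards [h3, translate_ae y (curryAt j F x'),
    (measurePreserving_add_right volume y).quasiMeasurePreserving.ae h2] with z h3 h4 h5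
  rw [h4, h5, h3]
  congr 1
  ext1 k
  rcases Fin.eq_self_or_eq_succAbove j k with rfl | ⟨k, rfl⟩
  · simp [slot_apply_self]
  · rw [Pi.add_apply, slot_apply_succAbove, slot_apply_succAbove,
      Pi.single_eq_of_ne (Fin.succAbove_ne j k), add_zero]

/-- Moving one particle is itself a one-particle operator, so it commutes with operators acting on
the other particles. -/
lemma translate_eq_lift {n : ℕ} (j : Fin (n + 1)) (y : E3) (F : L2N (n + 1)) :
    translate (Pi.single j y) F
      = lift j (LinearIsometry.toContinuousLinearMap (translate y)) F := by
  rw [eq_lift_iff]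
  exact curryAt_translate j y F

lemma lift_translate_comm {n : ℕ} {i j : Fin (n + 1)} (hij : i ≠ j) (A : L2 →L[ℂ] L2) (y : E3)
    (F : L2N (n + 1)) : lift i A (translate (Pi.single j y) F)
      = translate (Pi.single j y) (lift i A F) := by
  rw [translate_eq_lift, translate_eq_lift, ← mul_apply_eq_comp,
    (lift_commute hij A _).eq, mul_apply_eq_comp]

end Tensor

/-! ### Averages of translations and the two-body bound -/

section Average

variable {n : ℕ} (ν : Measure E3) [IsFiniteMeasure ν]

lemma integrable_translate (j : Fin (n + 1)) (F : L2N (n + 1)) :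
    Integrable (fun y => translate (Pi.single j y) F) ν := by
  have hc : Continuous fun y : E3 => translate (Pi.single j y) F :=
    (continuous_translate F).comp (continuous_single (A := fun _ : Fin (n + 1) => E3) j)
  refine Integrable.of_bound hc.aestronglyMeasurable ‖F‖ (Eventually.of_forall fun y => ?_)
  rw [LinearIsometry.norm_map]

/-- The average of the translations of the `j`-th variable, with weight `ν`. -/
def average (j : Fin (n + 1)) : L2N (n + 1) →L[ℂ] L2N (n + 1) :=
  LinearMap.mkContinuous
    { toFun := fun F => ∫ y, translate (Pi.single j y) F ∂ν
      map_add' := fun F G => by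
        simp only [map_add]
        exact integral_add (integrable_translate ν j F) (integrable_translate ν j G)
      map_smul' := fun c F => by
        simp only [map_smul, RingHom.id_apply]
        exact integral_smul c _ } (ν.real Set.univ) fun F => by
    refine (norm_integral_le_of_norm_le_const (C := ‖F‖) (Eventually.of_forall fun y => ?_)).trans
      (le_of_eq (mul_comm _ _))
    rw [LinearIsometry.norm_map]

lemma average_apply (j : Fin (n + 1)) (F : L2N (n + 1)) :
    average ν j F = ∫ y, translate (Pi.single j y) F ∂ν := rfl

lemma inner_average (j : Fin (n + 1)) (F G : L2N (n + 1)) :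
    inner ℂ F (average ν j G) = ∫ y, inner ℂ F (translate (Pi.single j y) G) ∂ν := by
  rw [average_apply, integral_inner (integrable_translate ν j G)]

lemma integrable_inner_translate (j : Fin (n + 1)) (F G : L2N (n + 1)) :
    Integrable (fun y => inner ℂ F (translate (Pi.single j y) G)) ν :=
  (integrable_translate ν j G).const_inner F

lemma re_inner_average (j : Fin (n + 1)) (F G : L2N (n + 1)) :
    (inner ℂ F (average ν j G)).re
      = ∫ y, (inner ℂ F (translate (Pi.single j y) G)).re ∂ν := by
  have := integral_re (integrable_inner_translate ν j F G)
  simp only [RCLike.re_to_complex] at this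
  rw [inner_average, this]

/-- The adjoint of the translation by y is the translation by -y, and ν does not distinguish them.
-/
lemma average_isSymmetric [ν.IsNegInvariant] (j : Fin (n + 1)) (F G : L2N (n + 1)) :
    inner ℂ (average ν j F) G = inner ℂ F (average ν j G) := by
  rw [← inner_conj_symm, inner_average, inner_average, ← integral_conj,
    ← integral_neg_eq_self (fun y => inner ℂ F (translate (Pi.single j y) G))]
  refine integral_congr_ae (Eventually.of_forall fun y => ?_)
  simp only [inner_conj_symm]
  rw [inner_translate, Pi.single_neg]

lemma average_translate (j : Fin (n + 1)) (a : Config (n + 1)) (F : L2N (n + 1)) :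
    average ν j (translate a F) = translate a (average ν j F) := by
  have h := (LinearIsometry.toContinuousLinearMap (translate a)).integral_comp_comm
    (integrable_translate ν j F)
  rw [LinearIsometry.coe_toContinuousLinearMap] at h
  rw [average_apply, average_apply, ← h]
  refine integral_congr_ae (Eventually.of_forall fun z => ?_)
  simp only
  rw [translate_translate, translate_translate, add_comm a]

lemma average_commute (i j : Fin (n + 1)) : Commute (average ν i) (average ν j) := by
  refine ContinuousLinearMap.ext fun F => ?_
  rw [mul_apply_eq_comp, mul_apply_eq_comp, average_apply ν j (average ν i F), average_apply ν j F,
    ← ContinuousLinearMap.integral_comp_comm _ (integrable_translate ν j F)]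
  simp only [average_translate]

lemma lift_commute_average {i j : Fin (n + 1)} (hij : i ≠ j) (A : L2 →L[ℂ] L2) :
    Commute (lift i A) (average ν j) := by
  refine ContinuousLinearMap.ext fun F => ?_
  change lift i A (average ν j F) = average ν j (lift i A F)
  rw [average_apply, average_apply,
    ← ContinuousLinearMap.integral_comp_comm _ (integrable_translate ν j F)]
  simp only [lift_translate_comm hij]

/-- The one-particle inequality is applied to the sections in the j-th variable and integrated over
the other particles; Fubini exchanges this integral with the average over translations. -/
lemma re_inner_lift_le {B : L2 →L[ℂ] L2} {C : ℝ}
    (hB : ∀ g : L2, (inner ℂ g (B g)).re ≤ C * ∫ y, (inner ℂ g (translate y g)).re ∂ν)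
    (j : Fin (n + 1)) (F : L2N (n + 1)) :
    (inner ℂ F (lift j B F)).re ≤ C * (inner ℂ F (average ν j F)).re := by
  set c := curryAt j F with hc
  have hint : Integrable fun x' : Config n => inner ℂ (c x') (B (c x')) := by
    refine (L2.integrable_inner (𝕜 := ℂ) (curryAt j F) (curryAt j (lift j B F))).congr ?_
    filter_upwards [curryAt_lift j B F] with x' h
    rw [h]
  have h1 : (inner ℂ F (lift j B F)).re = ∫ x' : Config n, (inner ℂ (c x') (B (c x'))).re := by
    have := integral_re hint
    simp only [RCLike.re_to_complex] at this
    rw [inner_lift, this]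
  have hmeas : StronglyMeasurable (Function.uncurry fun (y : E3) (x' : Config n) =>
      (inner ℂ (c x') (translate y (c x'))).re) := by
    refine stronglyMeasurable_uncurry_of_continuous_of_stronglyMeasurable (fun x' => ?_) fun y => ?_
    · exact Complex.continuous_re.comp (continuous_const.inner (continuous_translate _))
    · refine Complex.continuous_re.comp_stronglyMeasurable ?_
      have hcm := Lp.stronglyMeasurable c
      exact hcm.inner ((translate y).continuous.comp_stronglyMeasurable hcm)
  have hbd : ∀ (y : E3) (x' : Config n),
      ‖(inner ℂ (c x') (translate y (c x'))).re‖ ≤ ‖c x'‖ ^ 2 := fun y x' => by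
    refine (Complex.abs_re_le_norm _).trans ((norm_inner_le_norm _ _).trans ?_)
    rw [LinearIsometry.norm_map, sq]
  have hcsq : Integrable fun x' : Config n => ‖c x'‖ ^ 2 :=
    (memLp_two_iff_integrable_sq_norm (Lp.aestronglyMeasurable c)).mp (Lp.memLp c)
  have hprod : Integrable (Function.uncurry fun (y : E3) (x' : Config n) =>
      (inner ℂ (c x') (translate y (c x'))).re) (ν.prod volume) := by
    refine Integrable.mono' (g := fun z : E3 × Config n => (1 : ℝ) * ‖c z.2‖ ^ 2)
      ((integrable_const (1 : ℝ)).mul_prod hcsq) hmeas.aestronglyMeasurable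
      (Eventually.of_forall fun z => ?_)
    rw [one_mul]
    exact hbd z.1 z.2
  have h2 : (inner ℂ F (average ν j F)).re
      = ∫ x' : Config n, ∫ y, (inner ℂ (c x') (translate y (c x'))).re ∂ν := by
    rw [re_inner_average, ← integral_integral_swap hprod]
    refine integral_congr_ae (Eventually.of_forall fun y => ?_)
    simp only
    rw [inner_curryAt j]
    have := integral_re (L2.integrable_inner (𝕜 := ℂ) (curryAt j F)
      (curryAt j (translate (Pi.single j y) F)))
    simp only [RCLike.re_to_complex] at this
    rw [← this]
    refine integral_congr_ae ?_
    filter_upwards [curryAt_translate j y F] with x' h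
    rw [h]
  rw [h1, h2, ← integral_const_mul]
  refine integral_mono (by simpa using hint.re) (hprod.swap.integral_prod_left.const_mul C) fun x' => ?_
  exact hB (c x')

/-- The indicator function of `|x_i - x_j| ≤ r`. -/
def nearInd (i j : Fin (n + 1)) (r : ℝ) : Config (n + 1) → ℝ :=
  {x : Config (n + 1) | ‖x i - x j‖ ≤ r}.indicator 1

lemma abs_nearInd_le (i j : Fin (n + 1)) (r : ℝ) (x : Config (n + 1)) :
    |nearInd i j r x| ≤ 1 := by
  by_cases h : x ∈ {x : Config (n + 1) | ‖x i - x j‖ ≤ r}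
  · simp [nearInd, Set.indicator_of_mem h]
  · simp [nearInd, Set.indicator_of_notMem h]

lemma aestronglyMeasurable_nearInd (i j : Fin (n + 1)) (r : ℝ) :
    AEStronglyMeasurable (nearInd i j r) volume := by
  refine (stronglyMeasurable_one.indicator ?_).aestronglyMeasurable
  exact measurableSet_le (by fun_prop) measurable_const

/-- The projection onto `|x_i - x_j| ≤ r`. -/
def nearProj (i j : Fin (n + 1)) (r : ℝ) : L2N (n + 1) →L[ℂ] L2N (n + 1) :=
  mulL (nearInd i j r) (aestronglyMeasurable_nearInd i j r) (abs_nearInd_le i j r)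

lemma nearInd_sq (i j : Fin (n + 1)) (r : ℝ) (x : Config (n + 1)) :
    nearInd i j r x ^ 2 = nearInd i j r x := by
  by_cases h : x ∈ {x : Config (n + 1) | ‖x i - x j‖ ≤ r}
  · simp [nearInd, Set.indicator_of_mem h]
  · simp [nearInd, Set.indicator_of_notMem h]

lemma nearProj_ae (i j : Fin (n + 1)) (r : ℝ) (F : L2N (n + 1)) :
    ∀ᵐ x : Config (n + 1), r < ‖x i - x j‖ → nearProj i j r F x = 0 := by
  filter_upwards [mulL_ae (aestronglyMeasurable_nearInd i j r) (abs_nearInd_le i j r) F] with x h hx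
  have : x ∉ {x : Config (n + 1) | ‖x i - x j‖ ≤ r} := by simpa using hx
  rw [nearProj, h, nearInd, Set.indicator_of_notMem this]
  simp

lemma norm_sq_nearProj (i j : Fin (n + 1)) (r : ℝ) (F : L2N (n + 1)) :
    ‖nearProj i j r F‖ ^ 2 = ∫ x, nearInd i j r x * ‖F x‖ ^ 2 := by
  rw [nearProj, norm_sq_mulL]
  simp only [nearInd_sq]

lemma re_inner_nearProj (i j : Fin (n + 1)) (r : ℝ) (F : L2N (n + 1)) :
    (inner ℂ F (nearProj i j r F)).re = ‖nearProj i j r F‖ ^ 2 := by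
  rw [norm_sq_nearProj, nearProj, re_inner_mulL]

variable {ν}

/-- Two independent translations of the `i`-th and `j`-th variables overlap on
`|x_i - x_j| ≤ r` only if they differ by at most `2 r`. -/
lemma re_inner_average_average_le {i j : Fin (n + 1)} (hij : i ≠ j) {r C : ℝ}
    (hν : ∫⁻ y, ν (Metric.closedBall y (2 * r)) ∂ν ≤ ENNReal.ofReal C) (hC : 0 ≤ C)
    (F : L2N (n + 1)) :
    (inner ℂ (nearProj i j r F) (average ν i (average ν j (nearProj i j r F)))).re
      ≤ C * ‖nearProj i j r F‖ ^ 2 := by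
  set φ := nearProj i j r F with hφ
  -- One function lives on |x_i - y - x_j| ≤ r and the other on |x_i - x_j - z| ≤ r; a common point
  -- forces |z - y| ≤ 2r.
  have hz : ∀ y z : E3, z ∉ Metric.closedBall y (2 * r) →
      inner ℂ (translate (Pi.single i (-y)) φ) (translate (Pi.single j z) φ) = 0 := by
    intro y z hyz
    rw [Metric.mem_closedBall, not_le, dist_eq_norm] at hyz
    rw [L2.inner_def]
    refine (integral_congr_ae ?_).trans (integral_zero _ _)
    have hs := nearProj_ae i j r F
    filter_upwards [translate_ae (Pi.single i (-y)) φ, translate_ae (Pi.single j z) φ,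
      (measurePreserving_add_right volume (Pi.single i (-y) : Config (n + 1))).quasiMeasurePreserving.ae hs,
      (measurePreserving_add_right volume (Pi.single j z : Config (n + 1))).quasiMeasurePreserving.ae hs]
      with x h1 h2 h3 h4
    rw [h1, h2]
    simp only [Pi.add_apply, Pi.single_eq_same, Pi.single_eq_of_ne hij,
      Pi.single_eq_of_ne hij.symm, add_zero] at h3 h4
    by_cases h5 : r < ‖x i + -y - x j‖
    · rw [hφ, h3 h5, inner_zero_left]
    by_cases h6 : r < ‖x i - (x j + z)‖
    · rw [hφ, h4 h6, inner_zero_right]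
    exfalso
    rw [not_lt] at h5 h6
    have : z - y = (x i + -y - x j) - (x i - (x j + z)) := by abel
    rw [this] at hyz
    have := norm_sub_le (x i + -y - x j) (x i - (x j + z))
    linarith
  have hle : ∀ y z : E3,
      (inner ℂ (translate (Pi.single i (-y)) φ) (translate (Pi.single j z) φ)).re
        ≤ (Metric.closedBall y (2 * r)).indicator (fun _ => ‖φ‖ ^ 2) z := by
    intro y z
    by_cases h : z ∈ Metric.closedBall y (2 * r)
    · rw [Set.indicator_of_mem h]
      refine (Complex.re_le_norm _).trans ((norm_inner_le_norm _ _).trans (le_of_eq ?_))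
      rw [LinearIsometry.norm_map, LinearIsometry.norm_map, sq]
    · rw [Set.indicator_of_notMem h, hz y z h, Complex.zero_re]
  have hmeasball : Measurable fun y : E3 => ν (Metric.closedBall y (2 * r)) := by
    have hset : MeasurableSet {p : E3 × E3 | dist p.2 p.1 ≤ 2 * r} :=
      measurableSet_le (by fun_prop) measurable_const
    exact measurable_measure_prodMk_left hset
  have hinner : ∀ y, (inner ℂ φ (translate (Pi.single i y) (average ν j φ))).re
      ≤ ν.real (Metric.closedBall y (2 * r)) * ‖φ‖ ^ 2 := by
    intro y
    have e : inner ℂ φ (translate (Pi.single i y) (average ν j φ))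
        = inner ℂ (translate (Pi.single i (-y)) φ) (average ν j φ) := by
      rw [inner_translate, Pi.single_neg, neg_neg]
    rw [e, re_inner_average]
    refine (integral_mono (integrable_inner_translate ν j _ _).re
      ((integrable_const _).indicator Metric.isClosed_closedBall.measurableSet) (hle y)).trans
      (le_of_eq ?_)
    rw [integral_indicator Metric.isClosed_closedBall.measurableSet, setIntegral_const, smul_eq_mul]
  have hbint : Integrable (fun y => ν.real (Metric.closedBall y (2 * r))) ν := by
    refine Integrable.of_bound hmeasball.ennreal_toReal.aestronglyMeasurable (ν.real Set.univ)
      (Eventually.of_forall fun y => ?_)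
    rw [Real.norm_of_nonneg measureReal_nonneg]
    exact measureReal_mono (Set.subset_univ _)
  rw [re_inner_average]
  calc ∫ y, (inner ℂ φ (translate (Pi.single i y) (average ν j φ))).re ∂ν
      ≤ ∫ y, ν.real (Metric.closedBall y (2 * r)) * ‖φ‖ ^ 2 ∂ν :=
        integral_mono (integrable_inner_translate ν i _ _).re (hbint.mul_const _) hinner
    _ = (∫ y, ν.real (Metric.closedBall y (2 * r)) ∂ν) * ‖φ‖ ^ 2 := integral_mul_const _ _
    _ ≤ C * ‖φ‖ ^ 2 := by
        gcongr
        have h7 := integral_toReal (μ := ν) hmeasball.aemeasurable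
          (Eventually.of_forall fun y => measure_lt_top ν (Metric.closedBall y (2 * r)))
        simp only [measureReal_def]
        rw [h7]
        exact ENNReal.toReal_le_of_le_ofReal hC hν

/-- The two-body bound: if `B ≤ C₁ K` with `K` the average of translations, then
`1(|x_i - x_j| ≤ r) ≤ C h_i h_j` where `h = B⁻¹`. -/
lemma two_body_bound [ν.IsNegInvariant] {B : L2 →L[ℂ] L2} (hBp : B.IsPositive)
    (hBi : Function.Injective B) {C₁ : ℝ} (hC₁ : 0 < C₁)
    (hB : ∀ g : L2, (inner ℂ g (B g)).re ≤ C₁ * ∫ y, (inner ℂ g (translate y g)).re ∂ν)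
    {i j : Fin (n + 1)} (hij : i ≠ j) {r C : ℝ} (hC : 0 < C)
    (hν : ∫⁻ y, ν (Metric.closedBall y (2 * r)) ∂ν ≤ ENNReal.ofReal C)
    {f g ψ : L2N (n + 1)} (hf : lift i B f = ψ) (hg : lift j B g = ψ) :
    ‖nearProj i j r ψ‖ ^ 2 ≤ C₁ ^ 2 * C * (inner ℂ f g).re := by
  have hP : ∀ k, (lift k B : L2N (n + 1) →L[ℂ] _).IsPositive := fun k => lift_isPositive k hBp
  have hK : ∀ k : Fin (n + 1), ((C₁ : ℂ) • average ν k - lift k B).IsPositive := fun k => by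
    refine isPositive_of_forall (fun F G => ?_) fun F => ?_
    · simp only [sub_apply, smul_apply, inner_sub_left, inner_sub_right, inner_smul_left,
        inner_smul_right, Complex.conj_ofReal, average_isSymmetric, (hP k).symm_apply]
    · simp only [sub_apply, smul_apply, inner_sub_right, inner_smul_right, Complex.sub_re,
        Complex.re_ofReal_mul]
      linarith [re_inner_lift_le ν hB k F]
  have hcBB : Commute (lift i B) (lift j B) := lift_commute hij B B
  -- Operator inequalities can be multiplied here because everything attached to i commutes with
  -- everything attached to j.
  have hle : ∀ φ : L2N (n + 1), (inner ℂ φ (lift i B (lift j B φ))).re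
      ≤ C₁ ^ 2 * (inner ℂ φ (average ν i (average ν j φ))).re := fun φ => by
    have h := re_inner_comp_le_of_commute (hP i) (hP j) (hK i) (hK j)
      (((average_commute ν i j).smul_left _).smul_right _)
      ((lift_commute_average ν hij B).smul_right _) hcBB φ
    simp only [smul_apply, map_smul, inner_smul_right, Complex.re_ofReal_mul] at h
    linarith
  refine norm_sq_proj_le_of_commute (hP i) (hP j) hcBB (lift_injective j hBi) (by positivity)
    (re_inner_nearProj i j r) (fun F => ?_) hf hg
  refine (hle _).trans ?_
  rw [mul_assoc]
  gcongr
  exact re_inner_average_average_le hij hν hC.le F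

end Average

/-! ### The Yukawa law as an exponential mixture of Gaussians -/

section YukawaMeasure

/-- The exponential distribution on `(0, ∞)`. -/
def expLaw : Measure ℝ :=
  (volume.restrict (Set.Ioi 0)).withDensity fun t => ENNReal.ofReal (Real.exp (-t))

/-- The Gaussian probability measure with density `exp(-π |z|²)`. -/
def gaussLaw : Measure E3 :=
  volume.withDensity fun z => ENNReal.ofReal (Real.exp (-(Real.pi * ‖z‖ ^ 2)))

lemma integral_expLaw {E : Type*} [NormedAddCommGroup E] [NormedSpace ℝ E] (f : ℝ → E) :
    ∫ t, f t ∂expLaw = ∫ t in Set.Ioi (0 : ℝ), Real.exp (-t) • f t := by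
  rw [expLaw, integral_withDensity_eq_integral_toReal_smul (by fun_prop)
    (Eventually.of_forall fun _ => ENNReal.ofReal_lt_top)]
  simp only [ENNReal.toReal_ofReal (Real.exp_pos _).le]

lemma integral_gaussLaw {E : Type*} [NormedAddCommGroup E] [NormedSpace ℝ E] (f : E3 → E) :
    ∫ z, f z ∂gaussLaw = ∫ z, Real.exp (-(Real.pi * ‖z‖ ^ 2)) • f z := by
  rw [gaussLaw, integral_withDensity_eq_integral_toReal_smul (by fun_prop)
    (Eventually.of_forall fun _ => ENNReal.ofReal_lt_top)]
  simp only [ENNReal.toReal_ofReal (Real.exp_pos _).le]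

instance isFiniteMeasure_expLaw : IsFiniteMeasure expLaw := by
  refine isFiniteMeasure_withDensity_ofReal ?_
  have := integrableOn_exp_neg_Ioi 0
  exact this.2

instance isFiniteMeasure_gaussLaw : IsFiniteMeasure gaussLaw := by
  refine isFiniteMeasure_withDensity_ofReal ?_
  have h := GaussianFourier.integrable_cexp_neg_mul_sq_norm_add (V := E3) (b := Real.pi)
    (by simpa using Real.pi_pos) 0 0
  have h2 := h.norm
  refine Integrable.hasFiniteIntegral (h2.congr (Eventually.of_forall fun z => ?_))
  simp only [Complex.norm_exp]
  congr 1
  simp [← Complex.ofReal_pow]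

/-- Rescaling of a vector by `√t`. -/
def sqrtSmul (p : ℝ × E3) : E3 := √p.1 • p.2

lemma measurable_sqrtSmul : Measurable sqrtSmul := by
  unfold sqrtSmul
  fun_prop

/-- The probability measure on `ℝ³` with characteristic function `1 / (1 + π |ξ|²)`. -/
def yukawa : Measure E3 := (expLaw.prod gaussLaw).map sqrtSmul

instance isFiniteMeasure_yukawa : IsFiniteMeasure yukawa :=
  Measure.isFiniteMeasure_map _ _

instance isNegInvariant_gaussLaw : gaussLaw.IsNegInvariant := by
  refine ⟨?_⟩
  ext s hs
  rw [Measure.neg, Measure.map_apply measurable_neg hs, gaussLaw,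
    withDensity_apply _ (measurable_neg hs), withDensity_apply _ hs]
  rw [← lintegral_indicator (measurable_neg hs), ← lintegral_indicator hs,
    ← lintegral_neg_eq_self]
  refine lintegral_congr fun z => ?_
  by_cases h : z ∈ s
  · rw [Set.indicator_of_mem h, Set.indicator_of_mem (by simpa using h), norm_neg]
  · rw [Set.indicator_of_notMem h, Set.indicator_of_notMem (by simpa using h)]

instance isNegInvariant_yukawa : yukawa.IsNegInvariant := by
  refine ⟨?_⟩
  rw [Measure.neg, yukawa, Measure.map_map measurable_neg measurable_sqrtSmul]
  have e : Neg.neg ∘ sqrtSmul = sqrtSmul ∘ Prod.map id Neg.neg := by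
    funext p; simp [sqrtSmul]
  rw [e, ← Measure.map_map measurable_sqrtSmul (measurable_id.prodMap measurable_neg),
    ← Measure.map_prod_map _ _ measurable_id measurable_neg, Measure.map_id,
    Measure.map_neg_eq_self]

lemma integral_cexp_gaussLaw (ξ : E3) (c : ℝ) :
    ∫ z, Complex.exp (2 * Real.pi * Complex.I * c * (inner ℝ ξ z : ℝ)) ∂gaussLaw
      = Complex.exp (-(Real.pi * c ^ 2 * ‖ξ‖ ^ 2)) := by
  have h := GaussianFourier.integral_cexp_neg_mul_sq_norm_add (V := E3) (b := Real.pi)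
    (by simpa using Real.pi_pos) (2 * Real.pi * Complex.I * c) ξ
  have hpi : (Real.pi : ℂ) ≠ 0 := by exact_mod_cast Real.pi_ne_zero
  rw [div_self hpi, Complex.one_cpow, one_mul] at h
  rw [integral_gaussLaw]
  convert h using 2
  · funext z
    rw [Complex.real_smul, Complex.exp_add, Complex.ofReal_exp]
    push_cast
    ring_nf
  · rw [mul_pow, mul_pow, mul_pow, Complex.I_sq]
    field_simp
    ring

/-- For fixed t the vector √t z is Gaussian with characteristic function exp(-πt|ξ|²); the
exponential law of t then yields ∫₀^∞ exp(-(1+π|ξ|²)t) dt. -/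
lemma integral_cexp_yukawa (ξ : E3) :
    ∫ y, Complex.exp (2 * Real.pi * Complex.I * (inner ℝ ξ y : ℝ)) ∂yukawa
      = ((1 + Real.pi * ‖ξ‖ ^ 2)⁻¹ : ℝ) := by
  have hc : Continuous fun y : E3 => Complex.exp (2 * Real.pi * Complex.I * (inner ℝ ξ y : ℝ)) := by
    fun_prop
  have hint : Integrable (fun p : ℝ × E3 =>
      Complex.exp (2 * Real.pi * Complex.I * (inner ℝ ξ (sqrtSmul p) : ℝ)))
      (expLaw.prod gaussLaw) := by
    refine Integrable.of_bound (hc.measurable.comp measurable_sqrtSmul).aestronglyMeasurable 1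
      (Eventually.of_forall fun p => ?_)
    rw [Complex.norm_exp]
    simp
  rw [yukawa, integral_map measurable_sqrtSmul.aemeasurable hc.aestronglyMeasurable,
    integral_prod _ hint]
  have e : ∀ t, ∫ z, Complex.exp (2 * Real.pi * Complex.I * (inner ℝ ξ (sqrtSmul (t, z)) : ℝ))
      ∂gaussLaw = Complex.exp (-(Real.pi * (√t : ℝ) ^ 2 * ‖ξ‖ ^ 2)) := fun t => by
    rw [← integral_cexp_gaussLaw]
    refine integral_congr_ae (Eventually.of_forall fun z => ?_)
    simp only [sqrtSmul, inner_smul_right]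
    push_cast
    ring_nf
  simp only [e]
  rw [integral_expLaw]
  have e2 : ∀ t ∈ Set.Ioi (0 : ℝ), Real.exp (-t) • Complex.exp (-(Real.pi * (√t : ℝ) ^ 2 * ‖ξ‖ ^ 2))
      = ((Real.exp (-((1 + Real.pi * ‖ξ‖ ^ 2) * t)) : ℝ) : ℂ) := fun t ht => by
    have : ((√t : ℝ) : ℂ) ^ 2 = t := by
      rw [← Complex.ofReal_pow, Real.sq_sqrt (le_of_lt ht)]
    rw [this, Complex.real_smul, Complex.ofReal_exp, Complex.ofReal_exp, ← Complex.exp_add]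
    push_cast
    ring_nf
  rw [setIntegral_congr_fun measurableSet_Ioi e2, integral_complex_ofReal]
  congr 1
  have h := integral_exp_mul_Ioi (a := -(1 + Real.pi * ‖ξ‖ ^ 2))
    (by have := Real.pi_pos; have := sq_nonneg ‖ξ‖; nlinarith) 0
  simp only [neg_mul, mul_zero, Real.exp_zero, neg_div_neg_eq, one_div] at h
  exact h

/-- The volume of the unit ball. -/
def ballVol : ℝ≥0∞ := volume (Metric.closedBall (0 : E3) 1)

lemma gaussLaw_closedBall_le (x : E3) {r : ℝ} (hr : 0 ≤ r) :
    gaussLaw (Metric.closedBall x r) ≤ ENNReal.ofReal (r ^ 3) * ballVol := by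
  have h1 : gaussLaw (Metric.closedBall x r) ≤ volume (Metric.closedBall x r) := by
    rw [gaussLaw, withDensity_apply _ Metric.isClosed_closedBall.measurableSet]
    refine (setLIntegral_mono (g := fun _ => 1) measurable_const fun z _ => ?_).trans (by simp)
    rw [ENNReal.ofReal_le_one, Real.exp_le_one_iff, neg_nonpos]
    have := Real.pi_pos
    positivity
  refine h1.trans (le_of_eq ?_)
  rw [Measure.addHaar_closedBall' _ _ hr, ballVol]
  simp

/-- The Gaussian density is at most one, and undoing the dilation by √s turns radius r into r/√s. -/
lemma gaussLaw_scaled_le (x : E3) {r s : ℝ} (hr : 0 ≤ r) (hs : 0 < s) :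
    gaussLaw {w | dist (√s • w) x ≤ r} ≤ ENNReal.ofReal (r ^ 3 * s ^ (-(3 / 2) : ℝ)) * ballVol := by
  have hs' : 0 < √s := Real.sqrt_pos.mpr hs
  have e : {w : E3 | dist (√s • w) x ≤ r} = Metric.closedBall ((√s)⁻¹ • x) (r / √s) := by
    ext w
    have : √s • w - x = √s • (w - (√s)⁻¹ • x) := by
      rw [smul_sub, smul_smul, mul_inv_cancel₀ hs'.ne', one_smul]
    simp only [Set.mem_ofPred_eq, Metric.mem_closedBall, dist_eq_norm]
    rw [this, norm_smul, Real.norm_of_nonneg hs'.le, le_div_iff₀ hs', mul_comm]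
  rw [e]
  refine (gaussLaw_closedBall_le _ (by positivity)).trans (le_of_eq ?_)
  congr 2
  rw [div_pow, div_eq_mul_inv]
  congr 1
  rw [Real.sqrt_eq_rpow, ← Real.rpow_natCast, ← Real.rpow_mul hs.le, ← Real.rpow_neg hs.le]
  norm_num

/-- The integral is the probability that two independent Yukawa vectors are at distance at most r.
Given their times s and t it is at most a constant times r³ max(s,t)^(-3/2) ≤ r³ (st)^(-3/4).
Sharing the exponent is essential: t^(-3/4) is integrable against the exponential law, t^(-3/2) is
not. -/
lemma lintegral_yukawa_closedBall : ∃ C : ℝ, 0 < C ∧ ∀ r : ℝ, 0 ≤ r →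
    ∫⁻ y, yukawa (Metric.closedBall y r) ∂yukawa ≤ ENNReal.ofReal (C * r ^ 3) := by
  have hballtop : ballVol ≠ ⊤ := measure_closedBall_lt_top.ne
  have hgtop : gaussLaw Set.univ ≠ ⊤ := measure_ne_top _ _
  set J : ℝ≥0∞ := ∫⁻ t, ENNReal.ofReal (t ^ (-(3 / 4) : ℝ)) ∂expLaw with hJ
  have hJtop : J ≠ ⊤ := by
    rw [hJ, expLaw, lintegral_withDensity_eq_lintegral_mul _ (by fun_prop) (by fun_prop)]
    -- J is the Gamma integral at 1/4, as -3/4 = 1/4 - 1.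
    have h := Real.GammaIntegral_convergent (s := 1 / 4) (by norm_num)
    have h2 := h.lintegral_lt_top
    refine ne_of_lt (lt_of_le_of_lt (lintegral_mono fun t => ?_) h2)
    rw [Pi.mul_apply, ← ENNReal.ofReal_mul (Real.exp_pos _).le]
    norm_num
  set D : ℝ≥0∞ := ballVol * gaussLaw Set.univ * J * J with hD
  have hDtop : D ≠ ⊤ := ENNReal.mul_ne_top (ENNReal.mul_ne_top
    (ENNReal.mul_ne_top hballtop hgtop) hJtop) hJtop
  refine ⟨D.toReal + 1, by positivity, fun r hr => ?_⟩
  have hset : MeasurableSet {p : E3 × E3 | dist p.2 p.1 ≤ r} :=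
    measurableSet_le (by fun_prop) measurable_const
  -- the overlap at fixed times
  let Φ : ℝ → ℝ → ℝ≥0∞ := fun t s =>
    ∫⁻ z, gaussLaw {w | dist (√s • w) (√t • z) ≤ r} ∂gaussLaw
  have hΦ1 : ∀ t s, 0 < s → Φ t s
      ≤ ENNReal.ofReal (r ^ 3 * s ^ (-(3 / 2) : ℝ)) * (ballVol * gaussLaw Set.univ) := by
    intro t s hs
    refine (lintegral_mono fun z => gaussLaw_scaled_le (√t • z) hr hs).trans ?_
    rw [lintegral_const, mul_assoc]
  have hΦsymm : ∀ t s, Φ t s = Φ s t := by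
    intro t s
    have hm : ∀ t s : ℝ, MeasurableSet {p : E3 × E3 | dist (√s • p.2) (√t • p.1) ≤ r} :=
      fun t s => measurableSet_le (by fun_prop) measurable_const
    have h1 : Φ t s = (gaussLaw.prod gaussLaw) {p : E3 × E3 | dist (√s • p.2) (√t • p.1) ≤ r} := by
      rw [Measure.prod_apply (hm t s)]; rfl
    have h2 : Φ s t = (gaussLaw.prod gaussLaw) {p : E3 × E3 | dist (√s • p.2) (√t • p.1) ≤ r} := by
      rw [Measure.prod_apply_symm (hm t s)]
      refine lintegral_congr fun z => ?_
      congr 1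
      ext w
      simp [dist_comm]
    rw [h1, h2]
  have hΦ2 : ∀ t s, 0 < t → 0 < s → Φ t s
      ≤ ENNReal.ofReal (r ^ 3) * (ballVol * gaussLaw Set.univ) *
        (ENNReal.ofReal (t ^ (-(3 / 4) : ℝ)) * ENNReal.ofReal (s ^ (-(3 / 4) : ℝ))) := by
    have key : ∀ t s, 0 < t → t ≤ s → Φ t s
      ≤ ENNReal.ofReal (r ^ 3) * (ballVol * gaussLaw Set.univ) *
        (ENNReal.ofReal (t ^ (-(3 / 4) : ℝ)) * ENNReal.ofReal (s ^ (-(3 / 4) : ℝ))) := by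
      intro t s ht hts
      have hs := ht.trans_le hts
      refine (hΦ1 t s hs).trans ?_
      have e : s ^ (-(3 / 2) : ℝ) ≤ t ^ (-(3 / 4) : ℝ) * s ^ (-(3 / 4) : ℝ) := by
        have : (-(3 / 2) : ℝ) = -(3 / 4) + -(3 / 4) := by norm_num
        rw [this, Real.rpow_add hs]
        exact mul_le_mul_of_nonneg_right (Real.rpow_le_rpow_of_nonpos ht hts (by norm_num))
          (Real.rpow_nonneg hs.le _)
      rw [← ENNReal.ofReal_mul (by positivity)]
      calc ENNReal.ofReal (r ^ 3 * s ^ (-(3 / 2) : ℝ)) * (ballVol * gaussLaw Set.univ)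
          ≤ ENNReal.ofReal (r ^ 3 * (t ^ (-(3 / 4) : ℝ) * s ^ (-(3 / 4) : ℝ)))
            * (ballVol * gaussLaw Set.univ) := by gcongr
        _ = _ := by rw [ENNReal.ofReal_mul (by positivity)]; ring
    intro t s ht hs
    rcases le_total t s with h | h
    · exact key t s ht h
    · rw [hΦsymm, mul_comm (ENNReal.ofReal (t ^ (-(3 / 4) : ℝ)))]
      exact key s t hs h
  have hpos : ∀ᵐ t ∂expLaw, 0 < t := by
    rw [expLaw]
    exact (withDensity_absolutelyContinuous _ _).ae_le (ae_restrict_mem measurableSet_Ioi)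
  have hmain : ∫⁻ y, yukawa (Metric.closedBall y r) ∂yukawa
      = ∫⁻ t, ∫⁻ s, Φ t s ∂expLaw ∂expLaw := by
    have hm1 : Measurable fun y : E3 => yukawa (Metric.closedBall y r) :=
      measurable_measure_prodMk_left hset
    have e0 : ∫⁻ y, yukawa (Metric.closedBall y r) ∂yukawa
        = ∫⁻ p, yukawa (Metric.closedBall (sqrtSmul p) r) ∂(expLaw.prod gaussLaw) :=
      lintegral_map hm1 measurable_sqrtSmul
    refine (e0.trans (lintegral_prod (fun p => yukawa (Metric.closedBall (sqrtSmul p) r))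
      (hm1.comp measurable_sqrtSmul).aemeasurable)).trans (lintegral_congr fun t => ?_)
    have e1 : ∀ z, yukawa (Metric.closedBall (sqrtSmul (t, z)) r)
        = ∫⁻ s, gaussLaw {w | dist (√s • w) (√t • z) ≤ r} ∂expLaw := fun z => by
      rw [yukawa, Measure.map_apply measurable_sqrtSmul Metric.isClosed_closedBall.measurableSet,
        Measure.prod_apply (measurable_sqrtSmul Metric.isClosed_closedBall.measurableSet)]
      rfl
    simp only [e1]
    refine lintegral_lintegral_swap ?_
    have h3 : MeasurableSet {p : (E3 × ℝ) × E3 | dist (√p.1.2 • p.2) (√t • p.1.1) ≤ r} :=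
      measurableSet_le (by fun_prop) measurable_const
    exact (measurable_measure_prodMk_left h3).aemeasurable
  rw [hmain]
  calc ∫⁻ t, ∫⁻ s, Φ t s ∂expLaw ∂expLaw
      ≤ ∫⁻ t, ∫⁻ s, ENNReal.ofReal (r ^ 3) * (ballVol * gaussLaw Set.univ) *
        (ENNReal.ofReal (t ^ (-(3 / 4) : ℝ)) * ENNReal.ofReal (s ^ (-(3 / 4) : ℝ)))
          ∂expLaw ∂expLaw := by
        refine lintegral_mono_ae ?_
        filter_upwards [hpos] with t ht
        refine lintegral_mono_ae ?_
        filter_upwards [hpos] with s hs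
        exact hΦ2 t s ht hs
    _ = ENNReal.ofReal (r ^ 3) * D := by
        have hm : Measurable fun t : ℝ => ENNReal.ofReal (t ^ (-(3 / 4) : ℝ)) := by fun_prop
        simp only [lintegral_const_mul _ (hm.const_mul _), lintegral_const_mul _ hm]
        simp only [← hJ]
        rw [lintegral_const_mul _ (hm.mul_const _), lintegral_mul_const _ hm, ← hJ, hD]
        ring
    _ ≤ ENNReal.ofReal ((D.toReal + 1) * r ^ 3) := by
        rw [mul_comm (D.toReal + 1), ENNReal.ofReal_mul (by positivity)]
        gcongr
        rw [ENNReal.le_ofReal_iff_toReal_le hDtop (by positivity)]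
        linarith

end YukawaMeasure

/-! ### Translations on the Fourier side -/

section FourierTranslation

open SchwartzMap

lemma continuous_re_inner_self_apply {H : Type*} [NormedAddCommGroup H] [InnerProductSpace ℂ H]
    {T : H → H} (hT : Continuous T) : Continuous fun x => (inner ℂ x (T x)).re :=
  Complex.continuous_re.comp (continuous_id.inner hT)

lemma continuous_fourierL2 : Continuous fun g : L2 => (𝓕 g : L2) :=
  (Lp.fourierTransformₗᵢ E3 ℂ).continuous

/-- Any property of `L²` functions which is closed and holds for Schwartz functions holds. -/
lemma L2_induction {p : L2 → Prop} (hc : IsClosed {g | p g})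
    (h : ∀ f : 𝓢(E3, ℂ), p (f.toLp 2)) (g : L2) : p g :=
  DenseRange.induction_on (p := p)
    (SchwartzMap.denseRange_toLpCLM (p := 2) ENNReal.ofNat_ne_top) g hc fun f => h f

lemma aestronglyMeasurable_cos (y : E3) :
    AEStronglyMeasurable (fun ξ : E3 => Real.cos (2 * Real.pi * inner ℝ ξ y)) volume :=
  (by fun_prop : Continuous fun ξ : E3 =>
    Real.cos (2 * Real.pi * inner ℝ ξ y)).aestronglyMeasurable

lemma fourier_compSubConst (f : 𝓢(E3, ℂ)) (y ξ : E3) :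
    𝓕 (compSubConstCLM ℂ (-y) f) ξ = Complex.exp (2 * Real.pi * Complex.I * (inner ℝ ξ y : ℝ)) * 𝓕 f ξ := by
  have h := VectorFourier.fourierIntegral_comp_add_right Real.fourierChar volume (innerₗ E3) (f : E3 → ℂ) y
  have h1 := congrFun h ξ
  rw [SchwartzMap.fourier_coe, SchwartzMap.fourier_coe]
  have h2 : (⇑(compSubConstCLM ℂ (-y) f) : E3 → ℂ) = (f : E3 → ℂ) ∘ fun x => x + y := by
    ext x; simp [compSubConstCLM_apply]
  rw [h2]
  refine h1.trans ?_
  simp only [innerₗ_apply_apply, Circle.smul_def, smul_eq_mul, Real.fourierChar_apply]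
  rw [real_inner_comm]
  congr 2
  push_cast; ring

/-- Plancherel: translation by y multiplies the Fourier transform by exp(2πi ξ·y), whose real part
is the cosine. Both sides are continuous in g, so Schwartz functions suffice. -/
lemma re_inner_translate (g : L2) (y : E3) :
    (inner ℂ g (translate y g)).re =
      ∫ ξ, Real.cos (2 * Real.pi * inner ℝ ξ y) * ‖(𝓕 g : L2) ξ‖ ^ 2 := by
  have hC : ∀ ξ : E3, |Real.cos (2 * Real.pi * inner ℝ ξ y)| ≤ 1 := fun ξ => Real.abs_cos_le_one _
  rw [← re_inner_mulL (aestronglyMeasurable_cos y) hC]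
  refine L2_induction (p := fun g => (inner ℂ g (translate y g)).re =
    (inner ℂ (𝓕 g : L2) (mulL _ (aestronglyMeasurable_cos y) hC (𝓕 g : L2))).re) ?_ ?_ g
  · refine isClosed_eq (continuous_re_inner_self_apply (translate y).continuous) ?_
    exact (continuous_re_inner_self_apply (mulL _ (aestronglyMeasurable_cos y) hC).continuous).comp
      continuous_fourierL2
  · intro f
    have e1 : translate y (f.toLp 2 : L2) = (compSubConstCLM ℂ (-y) f).toLp 2 := by
      have h0 : ∀ᵐ x : E3, (f.toLp 2 : L2) x = f x := coeFn_toLp f 2 volume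
      ext1
      filter_upwards [translate_ae y (f.toLp 2 : L2), coeFn_toLp (compSubConstCLM ℂ (-y) f) 2,
        (measurePreserving_add_right volume y).quasiMeasurePreserving.ae h0] with x h1 h2 h3
      rw [h1, h2, h3]
      simp [compSubConstCLM_apply]
    rw [e1, re_inner_mulL, ← Lp.inner_fourier_eq, toLp_fourier_eq, toLp_fourier_eq, L2.inner_def]
    rw [← RCLike.re_eq_complex_re, ← integral_re (L2.integrable_inner _ _)]
    refine integral_congr_ae ?_
    filter_upwards [coeFn_toLp (𝓕 f) 2, coeFn_toLp (𝓕 (compSubConstCLM ℂ (-y) f)) 2] with ξ h1 h2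
    rw [h1, h2, fourier_compSubConst, RCLike.inner_apply, mul_assoc, RCLike.mul_conj]
    have : Complex.exp (2 * Real.pi * Complex.I * (inner ℝ ξ y : ℝ)) =
      Complex.exp ((2 * Real.pi * inner ℝ ξ y : ℝ) * Complex.I) := by
      congr 1; push_cast; ring
    rw [this]
    have h3 : (RCLike.ofReal ‖𝓕 f ξ‖ : ℂ) ^ 2 = ((‖𝓕 f ξ‖ ^ 2 : ℝ) : ℂ) := by
      rw [Complex.ofReal_pow]; rfl
    rw [h3, RCLike.re_eq_complex_re, Complex.re_mul_ofReal, Complex.exp_ofReal_mul_I_re]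

lemma integral_cos_yukawa (ξ : E3) :
    ∫ y, Real.cos (2 * Real.pi * inner ℝ ξ y) ∂yukawa = (1 + Real.pi * ‖ξ‖ ^ 2)⁻¹ := by
  have h := congrArg Complex.re (integral_cexp_yukawa ξ)
  rw [Complex.ofReal_re, ← RCLike.re_eq_complex_re, ← integral_re] at h
  · rw [← h]
    refine integral_congr_ae (Eventually.of_forall fun y => ?_)
    have : Complex.exp (2 * Real.pi * Complex.I * (inner ℝ ξ y : ℝ)) =
      Complex.exp ((2 * Real.pi * inner ℝ ξ y : ℝ) * Complex.I) := by
      congr 1; push_cast; ring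
    simp only [this, RCLike.re_eq_complex_re, Complex.exp_ofReal_mul_I_re]
  · refine Integrable.of_bound (C := 1) (by fun_prop) (Eventually.of_forall fun y => ?_)
    have : Complex.exp (2 * Real.pi * Complex.I * (inner ℝ ξ y : ℝ)) =
      Complex.exp ((2 * Real.pi * inner ℝ ξ y : ℝ) * Complex.I) := by
      congr 1; push_cast; ring
    rw [this, Complex.norm_exp_ofReal_mul_I]

/-- The average of translations is thus the Fourier multiplier given by the characteristic function
of the law, comparable to the resolvent of the Laplacian. -/
lemma integral_re_inner_translate_yukawa (g : L2) :
    ∫ y, (inner ℂ g (translate y g)).re ∂yukawa =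
      ∫ ξ, (1 + Real.pi * ‖ξ‖ ^ 2)⁻¹ * ‖(𝓕 g : L2) ξ‖ ^ 2 := by
  simp only [re_inner_translate]
  rw [integral_integral_swap]
  · simp only [integral_mul_const, integral_cos_yukawa]
  · have hi : Integrable (fun z : E3 × E3 => ‖(𝓕 g : L2) z.2‖ ^ 2) (yukawa.prod volume) := by
      simpa using (integrable_const (μ := yukawa) (1 : ℝ)).mul_prod (integrable_norm_sq (𝓕 g : L2))
    refine hi.mono' ?_ (Eventually.of_forall fun z => ?_)
    · refine AEStronglyMeasurable.mul ?_ hi.1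
      exact (by fun_prop : Continuous fun z : E3 × E3 =>
        Real.cos (2 * Real.pi * inner ℝ z.2 z.1)).aestronglyMeasurable
    · simp only [Function.uncurry_def, norm_mul, norm_pow, norm_norm]
      exact mul_le_of_le_one_left (by positivity) (Real.abs_cos_le_one _)

end FourierTranslation

/-! ### Bessel potentials and the Sobolev inequality -/

section Sobolev

open SchwartzMap

lemma norm_clm_le_sum (T : E3 →L[ℝ] ℂ) : ‖T‖ ≤ ∑ k, ‖T (EuclideanSpace.single k 1)‖ := by
  refine T.opNorm_le_bound (by positivity) fun x => ?_
  have hx : x = ∑ k, x k • EuclideanSpace.single k (1 : ℝ) := by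
    ext i
    simp [Finset.sum_apply, Pi.single_apply]
  conv_lhs => rw [hx]
  rw [map_sum, Finset.sum_mul]
  refine (norm_sum_le _ _).trans (Finset.sum_le_sum fun k _ => ?_)
  rw [map_smul, norm_smul, mul_comm]
  gcongr
  exact EuclideanSpace.norm_eq x ▸ Real.le_sqrt_of_sq_le
    (Finset.single_le_sum (f := fun i => ‖x i‖ ^ 2) (fun i _ => by positivity) (Finset.mem_univ k))

/-- Smooth functions `χ n`, compactly supported, bounded by `1`, with uniformly bounded
derivatives and converging to `1` pointwise. -/
lemma exists_cutoff_sequence : ∃ (χ : ℕ → E3 → ℝ) (M : ℝ), 0 ≤ M ∧ (∀ n, ContDiff ℝ ∞ (χ n)) ∧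
    (∀ n, HasCompactSupport (χ n)) ∧ (∀ n x, |χ n x| ≤ 1) ∧ (∀ n x, ‖fderiv ℝ (χ n) x‖ ≤ M) ∧
    ∀ x, ∀ᶠ n in atTop, χ n x = 1 := by
  let f : ContDiffBump (0 : E3) := ⟨1, 2, one_pos, one_lt_two⟩
  obtain ⟨M, hM⟩ := ((f.contDiff (n := 1)).continuous_fderiv (by simp)).bounded_above_of_compact_support
    (f.hasCompactSupport.fderiv (𝕜 := ℝ))
  have hpos : ∀ n : ℕ, (0 : ℝ) < (n + 1 : ℝ)⁻¹ := fun n => by positivity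
  refine ⟨fun n x => f ((n + 1 : ℝ)⁻¹ • x), M, (norm_nonneg _).trans (hM 0), fun n => ?_,
    fun n => ?_, fun n x => ?_, fun n x => ?_, fun x => ?_⟩
  · exact f.contDiff.comp (contDiff_const_smul _)
  · exact f.hasCompactSupport.comp_smul (hpos n).ne'
  · rw [abs_of_nonneg f.nonneg]; exact f.le_one
  · have h1 : HasFDerivAt (fun y : E3 => (n + 1 : ℝ)⁻¹ • y)
      ((n + 1 : ℝ)⁻¹ • ContinuousLinearMap.id ℝ E3) x :=
      ((n + 1 : ℝ)⁻¹ • ContinuousLinearMap.id ℝ E3).hasFDerivAt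
    have h2 : HasFDerivAt f (fderiv ℝ f ((n + 1 : ℝ)⁻¹ • x)) ((n + 1 : ℝ)⁻¹ • x) :=
      ((f.contDiff (n := 1)).differentiable (by simp) _).hasFDerivAt
    have h3 : HasFDerivAt (fun y : E3 => f ((n + 1 : ℝ)⁻¹ • y)) _ x := h2.comp x h1
    rw [h3.fderiv, ContinuousLinearMap.comp_smul, ContinuousLinearMap.comp_id, norm_smul]
    refine (mul_le_of_le_one_left (norm_nonneg _) ?_).trans (hM _)
    rw [Real.norm_of_nonneg (hpos n).le]
    exact inv_le_one_of_one_le₀ (by linarith [n.cast_nonneg (α := ℝ)])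
  · obtain ⟨m, hm⟩ := exists_nat_gt ‖x‖
    filter_upwards [eventually_ge_atTop m] with n hn
    refine f.one_of_mem_closedBall ?_
    rw [mem_closedBall_zero_iff, norm_smul, Real.norm_of_nonneg (hpos n).le]
    change _ ≤ (1 : ℝ)
    rw [inv_mul_le_iff₀ (by positivity)]
    have : (m : ℝ) ≤ n := by exact_mod_cast hn
    linarith

/-- Gagliardo–Nirenberg–Sobolev is applied to the truncations χ_n v. Their gradients cost at most an
additional M‖v‖₂, uniformly in n, and Fatou removes the truncation. -/
lemma eLpNorm_six_le_of_schwartz : ∃ C : ℝ, 0 ≤ C ∧ ∀ v : 𝓢(E3, ℂ), eLpNorm v 6 volume ≤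
    ENNReal.ofReal C * (∑ k : Fin 3,
      eLpNorm (LineDeriv.lineDerivOp (EuclideanSpace.single k (1 : ℝ)) v : 𝓢(E3, ℂ)) 2 volume +
        eLpNorm v 2 volume) := by
  obtain ⟨χ, M, hM, h1, h2, h3, h4, h5⟩ := exists_cutoff_sequence
  set K : ℝ := NNReal.toReal <| SNormLESNormFDerivOfEqConst ℂ (volume : Measure E3) (2 : ℝ) with hK
  have hK0 : 0 ≤ K := NNReal.coe_nonneg _
  refine ⟨K * (1 + M), by positivity, fun v => ?_⟩
  set D : Fin 3 → 𝓢(E3, ℂ) := fun k => LineDeriv.lineDerivOp (EuclideanSpace.single k (1 : ℝ)) v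
  have hlim : ∀ᵐ x : E3, Tendsto (fun n => (χ n x : ℂ) * v x) atTop (𝓝 (v x)) := by
    refine Eventually.of_forall fun x => tendsto_const_nhds.congr' ?_
    filter_upwards [h5 x] with n hn
    rw [hn]; simp
  have hcd : ∀ n, ContDiff ℝ ∞ fun x => (χ n x : ℂ) * v x := fun n =>
    (Complex.ofRealCLM.contDiff.comp (h1 n)).mul (v.smooth _)
  refine (Lp.eLpNorm_lim_le_liminf_eLpNorm (fun n => (hcd n).continuous.aestronglyMeasurable)
    _ hlim).trans ?_
  refine liminf_le_of_le (by isBoundedDefault) fun b hb => ?_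
  obtain ⟨n, hn⟩ := hb.exists
  refine hn.trans ?_
  have hgns := eLpNorm_le_eLpNorm_fderiv_of_eq (μ := (volume : Measure E3)) (F := ℂ) (p := 2)
    (p' := 6) ((hcd n).of_le (by simp)) ((h2 n).comp_left (g := fun t : ℝ => (t : ℂ))
      (by simp) |>.mul_right) (by norm_num) (by simp) (by norm_num)
  refine (by exact_mod_cast hgns : eLpNorm (fun x => (χ n x : ℂ) * v x) 6 volume ≤ _).trans ?_
  have hpt : ∀ x, ‖fderiv ℝ (fun x => (χ n x : ℂ) * v x) x‖ ≤ (∑ k, ‖D k x‖) + M * ‖v x‖ := by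
    intro x
    have e1 : HasFDerivAt (fun x => (χ n x : ℂ)) (Complex.ofRealCLM.comp (fderiv ℝ (χ n) x)) x :=
      Complex.ofRealCLM.hasFDerivAt.comp x
        (((h1 n).differentiable (by simp) x).hasFDerivAt)
    have e2 : HasFDerivAt (fun x => (χ n x : ℂ) * v x) _ x := e1.mul (v.hasFDerivAt x)
    rw [e2.fderiv]
    refine (norm_add_le _ _).trans (add_le_add ?_ ?_)
    · rw [norm_smul, Complex.norm_real]
      refine (mul_le_of_le_one_left (norm_nonneg _) (h3 n x)).trans ((norm_clm_le_sum _).trans ?_)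
      refine Finset.sum_le_sum fun k _ => le_of_eq ?_
      simp only [D, lineDerivOp_apply_eq_fderiv]
    · rw [norm_smul, mul_comm]
      gcongr
      refine (ContinuousLinearMap.opNorm_comp_le _ _).trans ?_
      simpa using h4 n x
  have hsum : eLpNorm (fderiv ℝ (fun x => (χ n x : ℂ) * v x)) 2 volume ≤
      ∑ k, eLpNorm (D k) 2 volume + ENNReal.ofReal M * eLpNorm v 2 volume := by
    have hm : ∀ k, AEStronglyMeasurable (fun x => ‖D k x‖) volume := fun k =>
      (D k).continuous.norm.aestronglyMeasurable
    calc eLpNorm (fderiv ℝ (fun x => (χ n x : ℂ) * v x)) 2 volume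
        ≤ eLpNorm ((∑ k, fun x => ‖D k x‖) + fun x => M * ‖v x‖) 2 volume :=
          eLpNorm_mono_real fun x => by simpa using hpt x
      _ ≤ eLpNorm (∑ k, fun x => ‖D k x‖) 2 volume + eLpNorm (fun x => M * ‖v x‖) 2 volume :=
          eLpNorm_add_le (Finset.aestronglyMeasurable_sum _ fun k _ => hm k)
            (v.continuous.norm.aestronglyMeasurable.const_mul M) (by norm_num)
      _ ≤ _ := by
          refine add_le_add ((eLpNorm_sum_le (fun k _ => hm k) (by norm_num)).trans ?_) ?_
          · refine Finset.sum_le_sum fun k _ => ?_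
            rw [eLpNorm_norm]
          · have := eLpNorm_const_smul_le (c := M) (f := fun x => ‖v x‖) (p := 2) (μ := volume)
            rw [eLpNorm_norm, Real.enorm_of_nonneg hM] at this
            exact this
  rw [ENNReal.ofReal_mul hK0, mul_assoc]
  have e3 : ((SNormLESNormFDerivOfEqConst ℂ (volume : Measure E3) (2 : ℝ) : NNReal) : ℝ≥0∞) =
      ENNReal.ofReal K := by rw [hK, ENNReal.ofReal_coe_nnreal]
  rw [e3]
  gcongr
  refine hsum.trans ?_
  rw [mul_add]
  have e4 : ENNReal.ofReal M ≤ ENNReal.ofReal (1 + M) := ENNReal.ofReal_le_ofReal (by linarith)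
  have e5 : 1 ≤ ENNReal.ofReal (1 + M) := by
    rw [ENNReal.one_le_ofReal]; linarith
  gcongr
  exact le_mul_of_one_le_left (by positivity) e5

/-- The Bessel weight `(1 + |ξ|²)^{-1/2}`. -/
def besselWeight (ξ : E3) : ℝ := (1 + ‖ξ‖ ^ 2) ^ (-(1 / 2) : ℝ)

lemma besselWeight_pos (ξ : E3) : 0 < besselWeight ξ := Real.rpow_pos_of_pos (by positivity) _

lemma besselWeight_sq (ξ : E3) : besselWeight ξ ^ 2 = (1 + ‖ξ‖ ^ 2)⁻¹ := by
  rw [besselWeight, ← Real.rpow_natCast, ← Real.rpow_mul (by positivity)]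
  norm_num
  rw [Real.rpow_neg_one]

lemma continuous_besselWeight : Continuous besselWeight := by
  unfold besselWeight
  refine Continuous.rpow_const (by fun_prop) fun x => Or.inl (by positivity)

lemma besselWeight_le_one (ξ : E3) : besselWeight ξ ≤ 1 := by
  have h := besselWeight_sq ξ
  have : (1 + ‖ξ‖ ^ 2)⁻¹ ≤ 1 := inv_le_one_of_one_le₀ (by nlinarith [sq_nonneg ‖ξ‖])
  nlinarith [besselWeight_pos ξ]

lemma norm_mul_besselWeight_le (ξ : E3) : ‖ξ‖ * besselWeight ξ ≤ 1 := by
  have h := besselWeight_sq ξ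
  have h1 : (‖ξ‖ * besselWeight ξ) ^ 2 ≤ 1 := by
    rw [mul_pow, h, ← div_eq_mul_inv, div_le_one (by positivity)]
    linarith
  nlinarith [mul_nonneg (norm_nonneg ξ) (besselWeight_pos ξ).le]

lemma abs_besselWeight_le (ξ : E3) : |besselWeight ξ| ≤ 1 := by
  rw [abs_of_pos (besselWeight_pos ξ)]; exact besselWeight_le_one ξ

/-- Multiplication by the Bessel weight. -/
def besselMul : L2 →L[ℂ] L2 :=
  mulL besselWeight continuous_besselWeight.aestronglyMeasurable abs_besselWeight_le

/-- The Bessel potential `(1 + |ξ|²)^{-1/2}` on the Fourier side. -/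
def bessel (F : L2) : L2 := 𝓕⁻ (besselMul F)

lemma continuous_bessel : Continuous bessel :=
  (Lp.fourierTransformₗᵢ E3 ℂ).symm.continuous.comp besselMul.continuous

lemma eLpNorm_two_toLp (f : 𝓢(E3, ℂ)) : eLpNorm f 2 volume = ENNReal.ofReal ‖f.toLp 2‖ := by
  rw [norm_toLp, ENNReal.ofReal_toReal (f.eLpNorm_lt_top 2 volume).ne]

lemma hasTemperateGrowth_besselWeight : besselWeight.HasTemperateGrowth :=
  Function.hasTemperateGrowth_one_add_norm_sq_rpow E3 _

lemma bessel_toLp (F : 𝓢(E3, ℂ)) :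
    bessel (F.toLp 2) = (𝓕⁻ (smulLeftCLM ℂ besselWeight F)).toLp 2 := by
  rw [bessel, ← toLp_fourierInv_eq]
  congr 1
  ext1
  filter_upwards [mulL_ae continuous_besselWeight.aestronglyMeasurable abs_besselWeight_le
    (F.toLp 2 : L2), coeFn_toLp F 2, coeFn_toLp (smulLeftCLM ℂ besselWeight F) 2] with ξ h1 h2 h3
  rw [h3, smulLeftCLM_apply_apply hasTemperateGrowth_besselWeight]
  refine h1.trans ?_
  rw [h2]; simp

lemma norm_lineDeriv_bessel_le (F : 𝓢(E3, ℂ)) (k : Fin 3) :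
    ‖(LineDeriv.lineDerivOp (EuclideanSpace.single k (1 : ℝ))
      (𝓕⁻ (smulLeftCLM ℂ besselWeight F)) : 𝓢(E3, ℂ)).toLp 2 volume‖ ≤
      2 * Real.pi * ‖F.toLp 2 volume‖ := by
  rw [lineDerivOp_fourierInv_eq, ← toLp_fourierInv_eq]
  refine ((Lp.fourierTransformₗᵢ E3 ℂ).symm.norm_map _).le.trans ?_
  have hg : (fun ξ : E3 => (inner ℝ ξ (EuclideanSpace.single k (1 : ℝ)) : ℝ)).HasTemperateGrowth :=
    ((innerSL ℝ).flip (EuclideanSpace.single k (1 : ℝ))).hasTemperateGrowth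
  refine Lp.norm_le_mul_norm_of_ae_le_mul ?_
  filter_upwards [coeFn_toLp F 2, coeFn_toLp ((2 * Real.pi * Complex.I) •
    smulLeftCLM ℂ (fun ξ : E3 => (inner ℝ ξ (EuclideanSpace.single k (1 : ℝ)) : ℝ))
      (smulLeftCLM ℂ besselWeight F)) 2] with ξ h1 h2
  rw [h1, h2]
  simp only [smul_apply, smulLeftCLM_apply_apply hg,
    smulLeftCLM_apply_apply hasTemperateGrowth_besselWeight, norm_smul, norm_mul, Complex.norm_I,
    mul_one, Complex.norm_real, Complex.norm_ofNat, Real.norm_of_nonneg Real.pi_pos.le]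
  gcongr
  rw [← mul_assoc]
  refine mul_le_of_le_one_left (norm_nonneg _) ?_
  rw [Real.norm_of_nonneg (besselWeight_pos ξ).le]
  refine le_trans ?_ (norm_mul_besselWeight_le ξ)
  gcongr
  · exact (besselWeight_pos ξ).le
  · refine (norm_inner_le_norm _ _).trans ?_
    simp

lemma norm_besselMul_le (F : L2) : ‖besselMul F‖ ≤ ‖F‖ := by
  have := Lp.norm_le_mul_norm_of_ae_le_mul (c := 1) (f := besselMul F) (g := F) ?_
  · simpa using this
  · filter_upwards [mulL_ae continuous_besselWeight.aestronglyMeasurable abs_besselWeight_le F]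
      with ξ h1
    rw [besselMul, h1, norm_mul, Complex.norm_real]
    gcongr
    exact abs_besselWeight_le ξ

lemma norm_bessel_le (F : L2) : ‖bessel F‖ ≤ ‖F‖ :=
  ((Lp.fourierTransformₗᵢ E3 ℂ).symm.norm_map _).le.trans (norm_besselMul_le F)

lemma eLpNorm_six_bessel_toLp_le {C : ℝ} (hC : 0 ≤ C)
    (hS : ∀ v : 𝓢(E3, ℂ), eLpNorm v 6 volume ≤ ENNReal.ofReal C * (∑ k : Fin 3,
      eLpNorm (LineDeriv.lineDerivOp (EuclideanSpace.single k (1 : ℝ)) v : 𝓢(E3, ℂ)) 2 volume +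
        eLpNorm v 2 volume)) (F : 𝓢(E3, ℂ)) :
    eLpNorm (bessel (F.toLp 2)) 6 volume ≤
      ENNReal.ofReal (C * (3 * (2 * Real.pi) + 1) * ‖F.toLp 2 volume‖) := by
  have e0 := norm_bessel_le (F.toLp 2)
  rw [bessel_toLp] at e0 ⊢
  rw [eLpNorm_congr_ae (coeFn_toLp _ 2 volume)]
  refine (hS _).trans ?_
  simp only [eLpNorm_two_toLp]
  rw [← ENNReal.ofReal_sum_of_nonneg (fun _ _ => norm_nonneg _),
    ← ENNReal.ofReal_add (Finset.sum_nonneg fun _ _ => norm_nonneg _) (norm_nonneg _),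
    ← ENNReal.ofReal_mul hC]
  refine ENNReal.ofReal_le_ofReal ?_
  rw [mul_assoc]
  refine mul_le_mul_of_nonneg_left ?_ hC
  have e1 := Finset.sum_le_sum fun k (_ : k ∈ Finset.univ) => norm_lineDeriv_bessel_le F k
  rw [Finset.sum_const, Finset.card_univ, Fintype.card_fin, nsmul_eq_mul] at e1
  refine (add_le_add e1 e0).trans (le_of_eq ?_)
  push_cast
  ring

/-- The Sobolev embedding `H¹ ⊂ L⁶` in dimension three. -/
theorem eLpNorm_six_bessel_le : ∃ C : ℝ, 0 ≤ C ∧ ∀ F : L2,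
    eLpNorm (bessel F) 6 volume ≤ ENNReal.ofReal (C * ‖F‖) := by
  obtain ⟨C, hC, hS⟩ := eLpNorm_six_le_of_schwartz
  set K : ℝ := C * (3 * (2 * Real.pi) + 1) with hK
  have hK0 : 0 ≤ K := by positivity
  -- The strict bound ‖F‖ < c persists along approximating sequences, so the property is closed: a
  -- subsequence converges almost everywhere and the L⁶ bound passes to its limit.
  have key : ∀ F : L2, ∀ c : ℝ, ‖F‖ < c → eLpNorm (bessel F) 6 volume ≤ ENNReal.ofReal (K * c) := by
    refine fun F => L2_induction (p := fun F => ∀ c : ℝ, ‖F‖ < c →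
      eLpNorm (bessel F) 6 volume ≤ ENNReal.ofReal (K * c)) ?_ ?_ F
    · refine IsSeqClosed.isClosed fun f g hf hg c hc => ?_
      have h1 : ∀ᶠ n in atTop, ‖f n‖ < c := hg.norm.eventually_lt_const hc
      have h2 := (tendstoInMeasure_of_tendsto_Lp
        ((continuous_bessel.tendsto g).comp hg)).exists_seq_tendsto_ae
      obtain ⟨ns, hns, hae⟩ := h2
      refine Lp.eLpNorm_le_of_ae_tendsto (u := atTop) ?_ (fun n => Lp.aestronglyMeasurable _) hae
      filter_upwards [hns.tendsto_atTop.eventually h1] with n hn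
      exact hf (ns n) c hn
    · intro F c hc
      refine (eLpNorm_six_bessel_toLp_le hC hS F).trans (ENNReal.ofReal_le_ofReal ?_)
      exact mul_le_mul_of_nonneg_left hc.le hK0
  refine ⟨K * 2, by positivity, fun F => ?_⟩
  rcases eq_or_ne F 0 with rfl | hF
  · have h0 : bessel 0 = 0 := by
      rw [bessel, map_zero]
      exact (Lp.fourierTransformₗᵢ E3 ℂ).symm.map_zero
    rw [h0, eLpNorm_congr_ae (Lp.coeFn_zero ℂ 2 volume)]
    simp
  · have h := key F (2 * ‖F‖) (by linarith [norm_pos_iff.mpr hF])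
    rwa [mul_assoc]

end Sobolev

/-! ### Relative bound on the magnetic potential -/

section MagneticField

open SchwartzMap

variable {A : E3 → E3} {V : E3 → ℝ}

lemma FieldAssumptions.aestronglyMeasurable_A (h : FieldAssumptions A V) :
    AEStronglyMeasurable A volume := by
  have h1 : LocallyIntegrable A volume := by
    rw [locallyIntegrable_iff]
    intro K hK
    have : IsFiniteMeasure (volume.restrict K) := ⟨by simpa using hK.measure_lt_top⟩
    exact (h.A_loc K hK).integrable (by norm_num)
  exact h1.aestronglyMeasurable

lemma FieldAssumptions.aestronglyMeasurable_V (h : FieldAssumptions A V) :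
    AEStronglyMeasurable V volume := h.V_loc.aestronglyMeasurable

/-- Near infinity |A|²/V < δ² and V ≥ 1; the latter allows the denominator to be cleared. -/
lemma FieldAssumptions.exists_compact (h : FieldAssumptions A V) {δ : ℝ} (hδ : 0 < δ) :
    ∃ K : Set E3, IsCompact K ∧ ∀ x ∉ K, ‖A x‖ ≤ δ * √(V x) := by
  have h1 := (h.A_V.eventually_lt_const (pow_pos hδ 2)).and (h.V_trap.eventually_ge_atTop 1)
  obtain ⟨K, hK, hsub⟩ := mem_cocompact.mp h1
  refine ⟨K, hK, fun x hx => ?_⟩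
  obtain ⟨h2, h3⟩ := hsub (Set.mem_compl hx)
  rw [div_lt_iff₀ (by linarith)] at h2
  refine abs_le_of_sq_le_sq' ?_ (by positivity) |>.2
  rw [mul_pow, Real.sq_sqrt (by linarith)]
  exact h2.le

/-- The magnetic field is infinitesimally bounded relative to the kinetic energy and the
trapping potential. -/
theorem FieldAssumptions.eLpNorm_A_mul_le (h : FieldAssumptions A V) {δ : ℝ} (hδ : 0 < δ) :
    ∃ C : ℝ, 0 ≤ C ∧ ∀ F w : L2, (∀ᵐ x, w x = (√(V x) : ℂ) * bessel F x) →
      eLpNorm (fun x => ‖A x‖ • bessel F x) 2 volume ≤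
        ENNReal.ofReal (δ * ‖F‖ + δ * ‖w‖ + C * ‖bessel F‖) := by
  obtain ⟨K, hK, hKb⟩ := h.exists_compact hδ
  obtain ⟨S, hS0, hS⟩ := eLpNorm_six_bessel_le
  have hα : MemLp (fun x => ‖A x‖) 3 (volume.restrict K) := (h.A_loc K hK).norm
  have hη : ENNReal.ofReal (δ / (S + 1)) ≠ 0 := by
    rw [Ne, ENNReal.ofReal_eq_zero, not_le]; positivity
  -- On K, |A| is a bounded function g plus a part small in L³. Hölder with 1/2 = 1/3 + 1/6 and H¹ ⊂
  -- L⁶ bound the small part by δ‖F‖, and g costs M‖u‖. Outside K the trap takes over.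
  obtain ⟨g, hg, -⟩ := hα.exists_simpleFunc_eLpNorm_sub_lt (by norm_num) hη
  obtain ⟨M, hM⟩ := g.exists_forall_norm_le
  have hM0 : 0 ≤ M := (norm_nonneg _).trans (hM 0)
  refine ⟨M, hM0, fun F w hw => ?_⟩
  set u := bessel F with hu
  have hum : AEStronglyMeasurable u volume := Lp.aestronglyMeasurable u
  have hAm := h.aestronglyMeasurable_A.norm
  have hfm : AEStronglyMeasurable (fun x => ‖A x‖ • u x) volume := hAm.smul hum
  have hu2 : eLpNorm u 2 volume = ENNReal.ofReal ‖u‖ := by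
    rw [Lp.norm_def, ENNReal.ofReal_toReal (Lp.eLpNorm_ne_top u)]
  have hw2 : eLpNorm w 2 volume = ENNReal.ofReal ‖w‖ := by
    rw [Lp.norm_def, ENNReal.ofReal_toReal (Lp.eLpNorm_ne_top w)]
  have hin : eLpNorm (fun x => ‖A x‖ • u x) 2 (volume.restrict K) ≤
      ENNReal.ofReal (δ * ‖F‖) + ENNReal.ofReal (M * ‖u‖) := by
    have hgm : AEStronglyMeasurable g (volume.restrict K) := g.aestronglyMeasurable
    have e1 : (fun x => ‖A x‖ • u x) = ((fun x => ‖A x‖) - ⇑g) • (u : E3 → ℂ) + (⇑g) • (u : E3 → ℂ) := by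
      ext x; simp [sub_mul]
    rw [e1]
    refine (eLpNorm_add_le ((hAm.restrict.sub hgm).smul hum.restrict)
      (hgm.smul hum.restrict) (by norm_num)).trans (add_le_add ?_ ?_)
    · have : ENNReal.HolderTriple 3 6 2 := ⟨by
        rw [← ENNReal.toReal_eq_toReal_iff' (by simp) (by simp),
          ENNReal.toReal_add (by simp) (by simp)]
        simp; norm_num⟩
      refine (eLpNorm_smul_le_mul_eLpNorm (p := 3) (q := 6) (r := 2) hum.restrict
        (hAm.restrict.sub hgm)).trans ?_
      have e2 : eLpNorm u 6 (volume.restrict K) ≤ ENNReal.ofReal (S * ‖F‖) :=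
        (eLpNorm_mono_measure _ Measure.restrict_le_self).trans (hS F)
      refine (mul_le_mul' hg.le e2).trans ?_
      rw [← ENNReal.ofReal_mul (by positivity)]
      refine ENNReal.ofReal_le_ofReal ?_
      rw [← mul_assoc]
      gcongr
      rw [div_mul_eq_mul_div, div_le_iff₀ (by positivity)]
      nlinarith
    · have e3 : eLpNorm (⇑g • (u : E3 → ℂ)) 2 (volume.restrict K) ≤ ENNReal.ofReal M * eLpNorm u 2 (volume.restrict K) := by
        refine eLpNorm_le_mul_eLpNorm_of_ae_le_mul (Eventually.of_forall fun x => ?_) 2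
        simp only [Pi.smul_apply', norm_smul]
        gcongr
        exact hM x
      refine e3.trans ?_
      rw [ENNReal.ofReal_mul hM0, ← hu2]
      gcongr
      exact Measure.restrict_le_self
  have hout : eLpNorm (fun x => ‖A x‖ • u x) 2 (volume.restrict Kᶜ) ≤ ENNReal.ofReal (δ * ‖w‖) := by
    rw [ENNReal.ofReal_mul hδ.le, ← hw2]
    refine (eLpNorm_le_mul_eLpNorm_of_ae_le_mul (g := w) ?_ 2).trans
      (mul_le_mul_right (eLpNorm_mono_measure _ Measure.restrict_le_self) _)
    rw [ae_restrict_iff' hK.measurableSet.compl]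
    filter_upwards [hw] with x hx hxK
    rw [hx, norm_smul, norm_norm, norm_mul, Complex.norm_real,
      Real.norm_of_nonneg (Real.sqrt_nonneg _), ← mul_assoc]
    gcongr
    exact hKb x hxK
  have e0 : (fun x => ‖A x‖ • u x) = K.indicator (fun x => ‖A x‖ • u x) +
      Kᶜ.indicator (fun x => ‖A x‖ • u x) := (Set.indicator_self_add_compl K _).symm
  rw [e0]
  refine (eLpNorm_add_le (hfm.indicator hK.measurableSet) (hfm.indicator hK.measurableSet.compl)
    (by norm_num)).trans ?_
  rw [eLpNorm_indicator_eq_eLpNorm_restrict hK.measurableSet,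
    eLpNorm_indicator_eq_eLpNorm_restrict hK.measurableSet.compl]
  refine (add_le_add hin hout).trans ?_
  rw [← ENNReal.ofReal_add (by positivity) (by positivity),
    ← ENNReal.ofReal_add (by positivity) (by positivity)]
  exact ENNReal.ofReal_le_ofReal (by linarith)

lemma FieldAssumptions.locallyIntegrable_A_mul (h : FieldAssumptions A V) (k : Fin 3) (u : L2) :
    LocallyIntegrable (fun x => (A x k : ℂ) * u x) volume := by
  rw [locallyIntegrable_iff]
  intro K hK
  have : IsFiniteMeasure (volume.restrict K) := ⟨by simpa using hK.measure_lt_top⟩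
  have h1 : MemLp A 2 (volume.restrict K) := (h.A_loc K hK).mono_exponent (by norm_num)
  have h2 : MemLp (fun x => (A x k : ℂ)) 2 (volume.restrict K) := by
    refine h1.of_le ?_ (Eventually.of_forall fun x => ?_)
    · exact Complex.continuous_ofReal.comp_aestronglyMeasurable
        ((EuclideanSpace.proj k).continuous.comp_aestronglyMeasurable h1.1)
    · rw [Complex.norm_real]
      exact PiLp.norm_apply_le _ _
  exact h2.integrable_mul ((Lp.memLp u).restrict K)

end MagneticField

/-! ### The momentum operator on H¹ -/

section Momentum

open SchwartzMap

/-- The Fourier multiplier of `-i ∂_k (1 - Δ)^{-1/2}` (up to the normalisation of `Δ`). -/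
def momentumWeight (k : Fin 3) (ξ : E3) : ℝ := 2 * Real.pi * ξ k * besselWeight ξ

lemma continuous_momentumWeight (k : Fin 3) : Continuous (momentumWeight k) := by
  have := continuous_besselWeight
  unfold momentumWeight
  fun_prop

lemma abs_momentumWeight_le (k : Fin 3) (ξ : E3) : |momentumWeight k ξ| ≤ 2 * Real.pi := by
  rw [momentumWeight, mul_assoc, abs_mul, abs_of_nonneg (by positivity : 0 ≤ 2 * Real.pi)]
  refine mul_le_of_le_one_right (by positivity) ?_
  rw [abs_mul, abs_of_pos (besselWeight_pos ξ)]
  refine le_trans ?_ (norm_mul_besselWeight_le ξ)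
  gcongr
  · exact (besselWeight_pos ξ).le
  · exact PiLp.norm_apply_le ξ k

/-- Multiplication by the momentum weight. -/
def momentumMul (k : Fin 3) : L2 →L[ℂ] L2 :=
  mulL (momentumWeight k) (continuous_momentumWeight k).aestronglyMeasurable
    (abs_momentumWeight_le k)

/-- The inverse Fourier transform on `L²`, as a continuous linear map. -/
def fourierInvL2 : L2 →L[ℂ] L2 :=
  ((Lp.fourierTransformₗᵢ E3 ℂ).symm.toContinuousLinearEquiv : L2 →L[ℂ] L2)

/-- `-i ∂_k u` for `u = bessel F`. -/
def momentum (k : Fin 3) : L2 →L[ℂ] L2 := fourierInvL2 ∘L momentumMul k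

lemma memLp_star {φ : E3 → ℂ} (hφ : MemLp φ 2 volume) : MemLp (fun x => star (φ x)) 2 volume :=
  hφ.star

lemma integral_mul_eq_inner {φ : E3 → ℂ} (hφ : MemLp φ 2 volume) (u : L2) :
    ∫ x, u x * φ x = inner ℂ ((memLp_star hφ).toLp _) u := by
  rw [L2.inner_def]
  refine integral_congr_ae ?_
  filter_upwards [(memLp_star hφ).coeFn_toLp] with x hx
  rw [hx, RCLike.inner_apply]
  simp

lemma continuous_integral_mul {φ : E3 → ℂ} (hφ : MemLp φ 2 volume) :
    Continuous fun u : L2 => ∫ x, u x * φ x := by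
  simp only [integral_mul_eq_inner hφ]
  fun_prop

lemma momentum_toLp (k : Fin 3) (F : 𝓢(E3, ℂ)) :
    momentum k (F.toLp 2) = ((-Complex.I) • LineDeriv.lineDerivOp (EuclideanSpace.single k (1 : ℝ))
      (𝓕⁻ (smulLeftCLM ℂ besselWeight F)) : 𝓢(E3, ℂ)).toLp 2 := by
  have hg : (fun ξ : E3 => (inner ℝ ξ (EuclideanSpace.single k (1 : ℝ)) : ℝ)).HasTemperateGrowth :=
    ((innerSL ℝ).flip (EuclideanSpace.single k (1 : ℝ))).hasTemperateGrowth
  rw [lineDerivOp_fourierInv_eq, ← FourierTransform.fourierInv_smul, ← toLp_fourierInv_eq]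
  change 𝓕⁻ (momentumMul k (F.toLp 2)) = _
  congr 1
  ext1
  filter_upwards [mulL_ae (continuous_momentumWeight k).aestronglyMeasurable
    (abs_momentumWeight_le k) (F.toLp 2 : L2), coeFn_toLp F 2,
    coeFn_toLp ((-Complex.I) • (2 * Real.pi * Complex.I) •
    smulLeftCLM ℂ (fun ξ : E3 => (inner ℝ ξ (EuclideanSpace.single k (1 : ℝ)) : ℝ))
      (smulLeftCLM ℂ besselWeight F)) 2] with ξ h1 h2 h3
  rw [h3]
  refine h1.trans ?_
  rw [h2]
  simp only [smul_apply, smulLeftCLM_apply_apply hg,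
    smulLeftCLM_apply_apply hasTemperateGrowth_besselWeight]
  simp only [momentumWeight, EuclideanSpace.inner_single_right, Complex.real_smul, smul_eq_mul]
  push_cast
  simp only [one_mul, conj_trivial]
  linear_combination (2 * Real.pi * (ξ k : ℂ) * besselWeight ξ * F ξ) * Complex.I_sq

/-- `momentum k F` is the weak derivative `-i ∂_k` of `bessel F`. -/
lemma integral_momentum_mul (k : Fin 3) (F : L2) {φ : E3 → ℂ} (hφ : ContDiff ℝ ∞ φ)
    (hs : HasCompactSupport φ) :
    ∫ x, momentum k F x * φ x =
      Complex.I * ∫ x, bessel F x * fderiv ℝ φ x (EuclideanSpace.single k 1) := by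
  have m1 : MemLp φ 2 volume := hφ.continuous.memLp_of_hasCompactSupport hs
  have m2 : MemLp (fun x => fderiv ℝ φ x (EuclideanSpace.single k 1)) 2 volume :=
    ((hφ.continuous_fderiv (by simp)).clm_apply continuous_const).memLp_of_hasCompactSupport
      (hs.fderiv_apply (𝕜 := ℝ) _)
  refine L2_induction (p := fun F => ∫ x, momentum k F x * φ x =
      Complex.I * ∫ x, bessel F x * fderiv ℝ φ x (EuclideanSpace.single k 1)) ?_ ?_ F
  · refine isClosed_eq ((continuous_integral_mul m1).comp (momentum k).continuous)
      (((continuous_integral_mul m2).comp continuous_bessel).const_mul _)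
  · intro F
    set v : 𝓢(E3, ℂ) := 𝓕⁻ (smulLeftCLM ℂ besselWeight F) with hv
    set ψ : 𝓢(E3, ℂ) := hs.toSchwartzMap hφ
    have hψ : ∀ x, ψ x = φ x := fun x => rfl
    rw [momentum_toLp, bessel_toLp, ← hv]
    have e1 : ∫ x, (((-Complex.I) • LineDeriv.lineDerivOp (EuclideanSpace.single k (1 : ℝ)) v :
        𝓢(E3, ℂ)).toLp 2 volume) x * φ x = -Complex.I *
        ∫ x, (LineDeriv.lineDerivOp (EuclideanSpace.single k (1 : ℝ)) v : 𝓢(E3, ℂ)) x * ψ x := by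
      rw [← integral_const_mul]
      refine integral_congr_ae ?_
      filter_upwards [coeFn_toLp ((-Complex.I) • LineDeriv.lineDerivOp
        (EuclideanSpace.single k (1 : ℝ)) v : 𝓢(E3, ℂ)) 2] with x hx
      rw [hx, smul_apply, smul_eq_mul, mul_assoc, hψ]
    have e2 : ∫ x, (v.toLp 2 volume) x * fderiv ℝ φ x (EuclideanSpace.single k 1) =
        ∫ x, v x * (LineDeriv.lineDerivOp (EuclideanSpace.single k (1 : ℝ)) ψ : 𝓢(E3, ℂ)) x := by
      refine integral_congr_ae ?_
      filter_upwards [coeFn_toLp v 2] with x hx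
      rw [hx, lineDerivOp_apply_eq_fderiv]
      rfl
    rw [e1, e2, integral_mul_lineDerivOp_right_eq_neg_left]
    ring

end Momentum

/-! ### Regularity in the form domain -/

section FormDomain

variable {A : E3 → E3} {V θ : E3 → ℝ} {s : ℝ}

lemma ae_eq_of_integral_mul_eq {f g : E3 → ℂ} (hf : LocallyIntegrable f volume)
    (hg : LocallyIntegrable g volume)
    (h : ∀ φ : E3 → ℂ, ContDiff ℝ ∞ φ → HasCompactSupport φ →
      ∫ x, f x * φ x = ∫ x, g x * φ x) : ∀ᵐ x, f x = g x := by
  refine ae_eq_of_integral_contDiff_smul_eq hf hg fun φ hφ hs => ?_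
  have hφ' : ContDiff ℝ ∞ fun x => (φ x : ℂ) := Complex.ofRealCLM.contDiff.comp hφ
  have hs' : HasCompactSupport fun x => (φ x : ℂ) :=
    hs.comp_left (g := fun t : ℝ => (t : ℂ)) (by simp)
  have e := h _ hφ' hs'
  simpa only [Complex.real_smul, mul_comm] using e

lemma L2_locallyIntegrable (u : L2) : LocallyIntegrable u volume :=
  (Lp.memLp u).locallyIntegrable (by norm_num)

/-- For u in H¹ the distribution -i∂_k u is an L² function and A_k u is locally integrable, so
testing against all smooth compactly supported functions amounts to a pointwise identity. -/
lemma isMagneticDeriv_bessel_iff (h : FieldAssumptions A V) (k : Fin 3) (F g : L2) :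
    IsMagneticDeriv A k (bessel F) g ↔
      ∀ᵐ x, g x = momentum k F x + (A x k : ℂ) * bessel F x := by
  have hloc := h.locallyIntegrable_A_mul k (bessel F)
  have key : ∀ φ : E3 → ℂ, ContDiff ℝ ∞ φ → HasCompactSupport φ →
      ∫ x, (Complex.I * (bessel F x * fderiv ℝ φ x (EuclideanSpace.single k 1))
        + ((A x k : ℂ) * bessel F x) * φ x) =
      ∫ x, (momentum k F x + (A x k : ℂ) * bessel F x) * φ x := by
    intro φ hφ hs
    rw [integral_add (integrable_L2_mul_deriv _ hφ hs _) (integrable_loc_mul hloc hφ.continuous hs),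
      integral_const_mul, ← integral_momentum_mul k F hφ hs,
      ← integral_add (integrable_L2_mul _ hφ.continuous hs)
        (integrable_loc_mul hloc hφ.continuous hs)]
    simp only [add_mul]
  constructor
  · rintro ⟨-, hg⟩
    refine ae_eq_of_integral_mul_eq (L2_locallyIntegrable g)
      ((L2_locallyIntegrable _).add hloc) fun φ hφ hs => ?_
    exact (hg φ hφ hs).trans (key φ hφ hs)
  · intro hg
    refine ⟨hloc, fun φ hφ hs => ?_⟩
    rw [key φ hφ hs]
    refine integral_congr_ae ?_
    filter_upwards [hg] with x hx
    rw [hx]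

lemma momentumSymbol_nonneg (θ : E3 → ℝ) (s : ℝ) (ξ : E3) : 0 ≤ momentumSymbol θ s ξ := by
  unfold momentumSymbol; positivity

lemma momentumSymbol_le (hθ : IsCutoff θ) (s : ℝ) (ξ : E3) :
    momentumSymbol θ s ξ ≤ 2 * Real.pi * ‖ξ‖ := by
  rw [momentumSymbol, norm_smul, Real.norm_of_nonneg (by positivity)]
  refine mul_le_of_le_one_right (by positivity) ?_
  exact Real.sqrt_le_one.mpr (hθ.le_one _)

/-- The cutoff equals one when |2πξ| ≥ 2s. Hence square integrability of |p|√θ_s(p)u already places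
u in H¹, with no diamagnetic argument. -/
lemma norm_le_momentumSymbol (hθ : IsCutoff θ) (hs : 0 < s) (ξ : E3) :
    ‖ξ‖ ≤ momentumSymbol θ s ξ + 2 * s := by
  have h0 := momentumSymbol_nonneg θ s ξ
  have hpi : (1 : ℝ) ≤ 2 * Real.pi := by linarith [Real.pi_gt_three]
  have h1 : ‖ξ‖ ≤ ‖(2 * Real.pi) • ξ‖ := by
    rw [norm_smul, Real.norm_of_nonneg (by positivity)]
    nlinarith [norm_nonneg ξ]
  by_cases h : 2 * s ≤ ‖(2 * Real.pi) • ξ‖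
  · have : momentumSymbol θ s ξ = ‖(2 * Real.pi) • ξ‖ := by
      rw [momentumSymbol, scaleCutoff, hθ.eq_one, Real.sqrt_one, mul_one]
      rw [norm_smul s⁻¹, Real.norm_of_nonneg (by positivity), le_inv_mul_iff₀ hs]
      linarith
    linarith
  · linarith

lemma continuous_momentumSymbol (hθ : IsCutoff θ) (s : ℝ) : Continuous (momentumSymbol θ s) := by
  have := hθ.smooth.continuous
  unfold momentumSymbol scaleCutoff
  fun_prop

lemma fourier_bessel (F : L2) : (𝓕 (bessel F) : L2) = besselMul F :=
  FourierTransform.fourier_fourierInv_eq _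

lemma one_add_le_besselWeight_inv (ξ : E3) : (besselWeight ξ)⁻¹ ≤ 1 + ‖ξ‖ := by
  rw [inv_le_comm₀ (besselWeight_pos ξ) (by positivity)]
  refine abs_le_of_sq_le_sq' ?_ (besselWeight_pos ξ).le |>.2
  rw [besselWeight_sq, inv_pow]
  gcongr
  nlinarith [norm_nonneg ξ]

/-- Elements of the form domain belong to `H¹`. -/
lemma FormData.exists_bessel (hθ : IsCutoff θ) (hs : 0 < s) {u : L2} {g : Fin 3 → L2} {w m : L2}
    (h : FormData A V θ s u g w m) : ∃ F : L2, u = bessel F := by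
  set uh : L2 := 𝓕 u with huh
  have hm : MemLp (fun ξ => (((besselWeight ξ)⁻¹ : ℝ) : ℂ) * uh ξ) 2 volume := by
    have hd : MemLp (fun ξ => ‖m ξ‖ + (1 + 2 * s) * ‖uh ξ‖) 2 volume :=
      (Lp.memLp m).norm.add ((Lp.memLp uh).norm.const_mul _)
    refine hd.mono' ?_ ?_
    · exact (Complex.continuous_ofReal.comp (continuous_besselWeight.inv₀ fun ξ =>
        (besselWeight_pos ξ).ne')).aestronglyMeasurable.mul (Lp.aestronglyMeasurable uh)
    · filter_upwards [h.mom] with ξ hξ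
      have h1 := one_add_le_besselWeight_inv ξ
      have h2 := norm_le_momentumSymbol hθ hs ξ
      rw [hξ, norm_mul, norm_mul, Complex.norm_real, Complex.norm_real,
        Real.norm_of_nonneg (momentumSymbol_nonneg θ s ξ),
        Real.norm_of_nonneg (inv_nonneg.mpr (besselWeight_pos ξ).le), ← add_mul]
      gcongr
      linarith
  refine ⟨hm.toLp, ?_⟩
  have e : besselMul hm.toLp = uh := by
    ext1
    filter_upwards [mulL_ae continuous_besselWeight.aestronglyMeasurable abs_besselWeight_le
      hm.toLp, hm.coeFn_toLp] with ξ h1 h2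
    refine h1.trans ?_
    rw [h2, ← mul_assoc, ← Complex.ofReal_mul, mul_inv_cancel₀ (besselWeight_pos ξ).ne']
    simp
  rw [bessel, e, huh]
  exact (FourierTransform.fourierInv_fourier_eq u).symm

end FormDomain

/-! ### Shifting the spectrum: the normalisation h̃ ≥ 1 -/

section Shift

variable {H : Type*} [NormedAddCommGroup H] [InnerProductSpace ℂ H]

lemma IsInverseOf.injective {T : H →ₗ.[ℂ] H} {B : H →L[ℂ] H} (hT : IsInverseOf T B) :
    Function.Injective B := by
  rw [injective_iff_map_eq_zero]
  intro f hf
  obtain ⟨hd, he⟩ := (hT 0 f).mpr hf.symm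
  rw [← he]; exact T.map_zero

lemma subConst_subConst (T : H →ₗ.[ℂ] H) (a b : ℝ) :
    subConst (subConst T a) b = subConst T (a + b) := by
  refine LinearPMap.ext rfl fun x hx hx' => ?_
  rw [subConst_apply, subConst_apply, subConst_apply]
  push_cast
  module

lemma inResolventSet_subConst (T : H →ₗ.[ℂ] H) (c t : ℝ) :
    InResolventSet (subConst T c) (t : ℂ) ↔ InResolventSet T ((t + c : ℝ) : ℂ) := by
  have e : ∀ u : (subConst T c).domain,
      subConst T c u - (t : ℂ) • (u : H) = T ⟨u, u.2⟩ - ((t + c : ℝ) : ℂ) • (u : H) := fun u => by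
    rw [subConst_apply]; push_cast; module
  constructor
  · rintro ⟨B, h1, h2⟩
    refine ⟨B, fun f => ?_, fun u => ?_⟩
    · obtain ⟨hf, h⟩ := h1 f
      exact ⟨hf, (e ⟨_, hf⟩).symm.trans h⟩
    · exact (congrArg B (e u).symm).trans (h2 u)
  · rintro ⟨B, h1, h2⟩
    refine ⟨B, fun f => ?_, fun u => ?_⟩
    · obtain ⟨hf, h⟩ := h1 f
      exact ⟨hf, (e ⟨_, hf⟩).trans h⟩
    · exact (congrArg B (e u)).trans (h2 u)

/-- The hypotheses exclude the default values of `sInf` on empty or unbounded sets, for which the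
translation formula would fail. -/
lemma infSpectrum_subConst (T : H →ₗ.[ℂ] H) (c : ℝ)
    (hne : {t : ℝ | ¬ InResolventSet T (t : ℂ)}.Nonempty)
    (hb : BddBelow {t : ℝ | ¬ InResolventSet T (t : ℂ)}) :
    infSpectrum (subConst T c) = infSpectrum T - c := by
  have h := isGLB_csInf hne hb
  have h2 : IsGLB {t : ℝ | ¬ InResolventSet (subConst T c) (t : ℂ)}
      (sInf {t : ℝ | ¬ InResolventSet T (t : ℂ)} - c) := by
    constructor
    · intro t ht
      have : t + c ∈ {t : ℝ | ¬ InResolventSet T (t : ℂ)} := fun h' =>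
        ht ((inResolventSet_subConst T c t).mpr h')
      linarith [h.1 this]
    · intro b hb'
      have : b + c ≤ sInf {t : ℝ | ¬ InResolventSet T (t : ℂ)} := h.2 fun t ht => by
        have : t - c ∈ {t : ℝ | ¬ InResolventSet (subConst T c) (t : ℂ)} := fun h' => ht (by
          have := (inResolventSet_subConst T c (t - c)).mp h'
          rwa [sub_add_cancel] at this)
        linarith [hb' this]
      linarith
  obtain ⟨t, ht⟩ := hne
  exact h2.csInf_eq ⟨t - c, fun h' => ht (by
    have := (inResolventSet_subConst T c (t - c)).mp h'
    rwa [sub_add_cancel] at this)⟩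

/-- If `T + l` has a positive inverse, then `T - inf σ(T - 1)` has a positive inverse `B ≤ 1`. -/
lemma exists_inverse_subConst_infSpectrum [CompleteSpace H] [Nontrivial H]
    {T : H →ₗ.[ℂ] H} {B : H →L[ℂ] H} {l : ℝ}
    (hB : B.IsPositive) (hT : IsInverseOf (subConst T (-l)) B) :
    ∃ B' : H →L[ℂ] H, B'.IsPositive ∧ IsInverseOf (subConst T (infSpectrum (subConst T 1))) B' ∧
      ∀ f, ‖B' f‖ ^ 2 ≤ (inner ℂ f (B' f)).re := by
  have h0 : 0 < ‖B‖ := by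
    rw [norm_pos_iff]
    rintro rfl
    obtain ⟨x, hx⟩ := exists_ne (0 : H)
    exact hx (hT.injective (by simp))
  have hleast := isLeast_infSpectrum hB hT h0
  have h1 : subConst T 1 = subConst (subConst T (-l)) (l + 1) := by
    rw [subConst_subConst]; congr 1; ring
  have h2 : infSpectrum (subConst T 1) = ‖B‖⁻¹ - (l + 1) := by
    rw [h1, infSpectrum_subConst _ _ ⟨_, hleast.1⟩ ⟨_, hleast.2⟩, infSpectrum_eq hB hT h0]
  -- With κ = ‖B‖⁻¹ - (l+1) one has T - κ = (T+l) - (‖B‖⁻¹ - 1), so the spectral gap ‖B‖⁻¹ - t is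
  -- exactly one.
  obtain ⟨B', hp, hi, hb⟩ := exists_inverse_subConst hB hT h0 (t := ‖B‖⁻¹ - 1) (by linarith)
  refine ⟨B', hp, ?_, fun f => ?_⟩
  · rw [h2]
    rw [subConst_subConst] at hi
    convert hi using 2
    ring
  · have := hb f
    linarith

end Shift

/-! ### From a coercive form to a positive inverse -/

section LaxMilgram

variable {X H : Type*} [NormedAddCommGroup X] [InnerProductSpace ℂ X] [CompleteSpace X]
  [NormedAddCommGroup H] [InnerProductSpace ℂ H] [CompleteSpace H]

open ContinuousLinearMap in
/-- The operator associated with a coercive form `∑ₖ ‖Gₖ x‖² + ‖W x‖² - e ‖M x‖² + l ‖ι x‖²`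
has a positive inverse. -/
lemma exists_form_inverse (G : Fin 3 → X →L[ℂ] H) (W M ι : X →L[ℂ] H) {e l c : ℝ} (hc : 0 < c)
    (hco : ∀ x, c * ‖x‖ ^ 2 ≤
      ∑ k, ‖G k x‖ ^ 2 + ‖W x‖ ^ 2 - e * ‖M x‖ ^ 2 + l * ‖ι x‖ ^ 2) :
    ∃ B : H →L[ℂ] H, B.IsPositive ∧ ∀ u f, (∃ x, ι x = u ∧ ∀ y,
      ∑ k, inner ℂ (G k y) (G k x) + inner ℂ (W y) (W x) - (e : ℂ) * inner ℂ (M y) (M x)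
        + (l : ℂ) * inner ℂ (ι y) (ι x) = inner ℂ (ι y) f) ↔ u = B f := by
  -- T represents the form in the inner product of X. The equation q(y,x) = ⟨ιy,f⟩ for all y becomes
  -- Tx = ι*f, so the inverse sought is ιT⁻¹ι*.
  set T : X →L[ℂ] X := ∑ k, (adjoint (G k)).comp (G k) + (adjoint W).comp W
    - (e : ℂ) • (adjoint M).comp M + (l : ℂ) • (adjoint ι).comp ι with hT
  have hTi : ∀ y x, inner ℂ y (T x) = ∑ k, inner ℂ (G k y) (G k x) + inner ℂ (W y) (W x)
      - (e : ℂ) * inner ℂ (M y) (M x) + (l : ℂ) * inner ℂ (ι y) (ι x) := fun y x => by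
    simp only [hT, add_apply, sub_apply, smul_apply, sum_apply, comp_apply, inner_add_right,
      inner_sub_right, inner_smul_right, inner_sum, adjoint_inner_right]
  have hTre : ∀ x, c * ‖x‖ ^ 2 ≤ (inner ℂ x (T x)).re := fun x => by
    refine (hco x).trans (le_of_eq ?_)
    rw [hTi]
    simp only [Complex.add_re, Complex.sub_re, Complex.re_ofReal_mul, re_inner_self,
      Complex.re_sum]
  have hTs : ∀ y x, inner ℂ (T y) x = inner ℂ y (T x) := fun y x => by
    rw [← inner_conj_symm, hTi, hTi]
    simp only [map_add, map_sub, map_mul, map_sum, inner_conj_symm, Complex.conj_ofReal]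
  obtain ⟨v, hv⟩ := isUnit_of_coercive_re hc (f := T) fun x => by rw [hTs]; exact hTre x
  obtain ⟨S, hr, hl⟩ : ∃ S : X →L[ℂ] X, (∀ x, T (S x) = x) ∧ ∀ x, S (T x) = x := by
    rw [← hv]
    exact ⟨↑(v⁻¹), fun x => congrArg (fun T : X →L[ℂ] X => T x) (Units.mul_inv v),
      fun x => congrArg (fun T : X →L[ℂ] X => T x) (Units.inv_mul v)⟩
  refine ⟨(ι.comp S).comp (adjoint ι), isPositive_of_forall (fun f g => ?_) (fun f => ?_),
    fun u f => ⟨?_, ?_⟩⟩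
  · change inner ℂ (ι (S (adjoint ι f))) g = inner ℂ f (ι (S (adjoint ι g)))
    have h1 := hTs (S (adjoint ι f)) (S (adjoint ι g))
    rwa [hr, hr, adjoint_inner_left, adjoint_inner_right, eq_comm] at h1
  · change 0 ≤ (inner ℂ f (ι (S (adjoint ι f)))).re
    have h1 := hTre (S (adjoint ι f))
    rw [← hTs, hr, adjoint_inner_left] at h1
    exact le_trans (mul_nonneg hc.le (sq_nonneg _)) h1
  · rintro ⟨x, rfl, hx⟩
    change ι x = ι (S (adjoint ι f))
    have : T x = adjoint ι f := ext_inner_left ℂ fun y => by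
      rw [hTi, hx, adjoint_inner_right]
    rw [← this, hl]
  · rintro rfl
    refine ⟨S (adjoint ι f), rfl, fun y => ?_⟩
    rw [← hTi, hr, adjoint_inner_right]

end LaxMilgram

/-! ### The form domain as a Hilbert space -/

section FormSpace

open SchwartzMap

variable {A : E3 → E3} {V θ : E3 → ℝ} {ε s : ℝ}

/-- A bounded weight making `√V` bounded. -/
def trapWeight (V : E3 → ℝ) (x : E3) : ℝ := (1 + √(V x))⁻¹

lemma trapWeight_pos (V : E3 → ℝ) (x : E3) : 0 < trapWeight V x := by
  unfold trapWeight; positivity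

lemma abs_trapWeight_le (V : E3 → ℝ) (x : E3) : |trapWeight V x| ≤ 1 := by
  rw [abs_of_pos (trapWeight_pos V x), trapWeight]
  exact inv_le_one_of_one_le₀ (by linarith [Real.sqrt_nonneg (V x)])

lemma abs_trapWeight_mul_le (V : E3 → ℝ) (x : E3) : |trapWeight V x * √(V x)| ≤ 1 := by
  rw [abs_of_nonneg (mul_nonneg (trapWeight_pos V x).le (Real.sqrt_nonneg _)), trapWeight,
    inv_mul_le_one₀ (by positivity)]
  linarith

lemma aestronglyMeasurable_sqrt (hV : AEStronglyMeasurable V volume) :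
    AEStronglyMeasurable (fun x => √(V x)) volume :=
  Real.continuous_sqrt.comp_aestronglyMeasurable hV

lemma aestronglyMeasurable_trapWeight (hV : AEStronglyMeasurable V volume) :
    AEStronglyMeasurable (trapWeight V) volume :=
  ((aestronglyMeasurable_sqrt hV).aemeasurable.const_add 1).inv.aestronglyMeasurable

/-- The Bessel potential as a continuous linear map. -/
def besselL : L2 →L[ℂ] L2 := fourierInvL2 ∘L besselMul

lemma besselL_apply (F : L2) : besselL F = bessel F := rfl

/-- The pairs `(F, w)` with `w = √V u`, where `u = bessel F`. -/
def formSpace (V : E3 → ℝ) (hV : AEStronglyMeasurable V volume) :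
    Submodule ℂ (WithLp 2 (L2 × L2)) :=
  LinearMap.ker (mulL (trapWeight V) (aestronglyMeasurable_trapWeight hV) (abs_trapWeight_le V) ∘L
      WithLp.sndL 2 ℂ L2 L2 -
    mulL (fun x => trapWeight V x * √(V x))
      ((aestronglyMeasurable_trapWeight hV).mul (aestronglyMeasurable_sqrt hV))
      (abs_trapWeight_mul_le V) ∘L besselL ∘L WithLp.fstL 2 ℂ L2 L2 :
        WithLp 2 (L2 × L2) →L[ℂ] L2).toLinearMap

instance completeSpace_formSpace (hV : AEStronglyMeasurable V volume) :
    CompleteSpace (formSpace V hV) :=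
  ContinuousLinearMap.completeSpace_ker _

/-- The weight (1+√V)⁻¹ is strictly positive and can be cancelled. It serves to write the unbounded
constraint w = √V u as the kernel of a bounded operator, which makes the space complete. -/
lemma mem_formSpace (hV : AEStronglyMeasurable V volume) (x : WithLp 2 (L2 × L2)) :
    x ∈ formSpace V hV ↔ ∀ᵐ y, x.snd y = (√(V y) : ℂ) * bessel x.fst y := by
  have h1 := mulL_ae (aestronglyMeasurable_trapWeight hV) (abs_trapWeight_le V) x.snd
  have h2 := mulL_ae (f := fun x => trapWeight V x * √(V x)) ((aestronglyMeasurable_trapWeight hV).mul (aestronglyMeasurable_sqrt hV))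
      (abs_trapWeight_mul_le V) (bessel x.fst)
  have e : x ∈ formSpace V hV ↔ mulL (trapWeight V) (aestronglyMeasurable_trapWeight hV)
      (abs_trapWeight_le V) x.snd = mulL (fun x => trapWeight V x * √(V x))
      ((aestronglyMeasurable_trapWeight hV).mul (aestronglyMeasurable_sqrt hV))
      (abs_trapWeight_mul_le V) (bessel x.fst) := by
    rw [← sub_eq_zero]; rfl
  rw [e, Lp.ext_iff]
  constructor
  · intro h
    filter_upwards [h, h1, h2] with y h h1 h2
    rw [h1, h2, Complex.ofReal_mul, mul_assoc] at h
    exact mul_left_cancel₀ (by exact_mod_cast (trapWeight_pos V y).ne') h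
  · intro h
    filter_upwards [h, h1, h2] with y h h1 h2
    rw [h1, h2, Complex.ofReal_mul, mul_assoc, h]

/-- The component `F`. -/
def formF (hV : AEStronglyMeasurable V volume) : formSpace V hV →L[ℂ] L2 :=
  WithLp.fstL 2 ℂ L2 L2 ∘L (formSpace V hV).subtypeL

/-- The component `√V u`. -/
def formW (hV : AEStronglyMeasurable V volume) : formSpace V hV →L[ℂ] L2 :=
  WithLp.sndL 2 ℂ L2 L2 ∘L (formSpace V hV).subtypeL

/-- The wave function `u`. -/
def formU (hV : AEStronglyMeasurable V volume) : formSpace V hV →L[ℂ] L2 := besselL ∘L formF hV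

lemma formW_ae (hV : AEStronglyMeasurable V volume) (x : formSpace V hV) :
    ∀ᵐ y, formW hV x y = (√(V y) : ℂ) * formU hV x y := (mem_formSpace hV x).mp x.2

lemma formSpace_norm_sq (hV : AEStronglyMeasurable V volume) (x : formSpace V hV) :
    ‖x‖ ^ 2 = ‖formF hV x‖ ^ 2 + ‖formW hV x‖ ^ 2 :=
  WithLp.prod_norm_sq_eq_of_L2 _

lemma exists_formSpace (hV : AEStronglyMeasurable V volume) {F w : L2}
    (h : ∀ᵐ y, w y = (√(V y) : ℂ) * bessel F y) :
    ∃ x : formSpace V hV, formF hV x = F ∧ formW hV x = w :=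
  ⟨⟨WithLp.toLp 2 (F, w), (mem_formSpace hV _).mpr h⟩, rfl, rfl⟩

lemma memLp_A_mul (h : FieldAssumptions A V) (x : formSpace V h.aestronglyMeasurable_V) (k : Fin 3) :
    MemLp (fun y => (A y k : ℂ) * formU h.aestronglyMeasurable_V x y) 2 volume := by
  obtain ⟨C, -, hC⟩ := h.eLpNorm_A_mul_le one_pos
  have h1 := hC (formF _ x) _ (formW_ae _ x)
  have hm : AEStronglyMeasurable
      (fun y => (A y k : ℂ) * formU h.aestronglyMeasurable_V x y) volume :=
    (Complex.continuous_ofReal.comp_aestronglyMeasurable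
      ((EuclideanSpace.proj k).continuous.comp_aestronglyMeasurable h.aestronglyMeasurable_A)).mul
      (Lp.aestronglyMeasurable _)
  refine MemLp.of_le (g := fun y => ‖A y‖ • formU h.aestronglyMeasurable_V x y)
    ⟨h.aestronglyMeasurable_A.norm.smul (Lp.aestronglyMeasurable _),
      h1.trans_lt ENNReal.ofReal_lt_top⟩ hm (Eventually.of_forall fun y => ?_)
  rw [norm_mul, norm_smul, Complex.norm_real, norm_norm]
  gcongr
  exact PiLp.norm_apply_le _ _

/-- `A_k u` on the form space, as a linear map. -/
def formALinear (h : FieldAssumptions A V) (k : Fin 3) :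
    formSpace V h.aestronglyMeasurable_V →ₗ[ℂ] L2 where
  toFun x := (memLp_A_mul h x k).toLp
  map_add' x y := by
    rw [← MemLp.toLp_add]
    refine MemLp.toLp_congr _ _ ?_
    filter_upwards [Lp.coeFn_add (formU _ x) (formU _ y)] with z hz
    rw [map_add, hz]
    simp [mul_add]
  map_smul' c x := by
    rw [RingHom.id_apply, ← MemLp.toLp_const_smul]
    refine MemLp.toLp_congr _ _ ?_
    filter_upwards [Lp.coeFn_smul c (formU h.aestronglyMeasurable_V x)] with z hz
    rw [map_smul, hz]
    simp [mul_left_comm]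

lemma formALinear_ae (h : FieldAssumptions A V) (k : Fin 3)
    (x : formSpace V h.aestronglyMeasurable_V) :
    ∀ᵐ y, formALinear h k x y = (A y k : ℂ) * formU h.aestronglyMeasurable_V x y :=
  (memLp_A_mul h x k).coeFn_toLp

/-- Pointwise ∑_k |A_k u|² = |A|²|u|², so the bound on |A|u handles all components together. -/
lemma sum_norm_sq_formALinear_le (h : FieldAssumptions A V) {δ : ℝ} (hδ : 0 < δ) :
    ∃ C : ℝ, 0 ≤ C ∧ ∀ x, ∑ k, ‖formALinear h k x‖ ^ 2 ≤
      (δ * ‖formF h.aestronglyMeasurable_V x‖ + δ * ‖formW h.aestronglyMeasurable_V x‖ +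
        C * ‖formU h.aestronglyMeasurable_V x‖) ^ 2 := by
  obtain ⟨C, hC0, hC⟩ := h.eLpNorm_A_mul_le hδ
  refine ⟨C, hC0, fun x => ?_⟩
  have h1 := hC (formF _ x) _ (formW_ae _ x)
  set u := formU h.aestronglyMeasurable_V x with hu
  have hfin : MemLp (fun y => ‖A y‖ • u y) 2 volume :=
    ⟨h.aestronglyMeasurable_A.norm.smul (Lp.aestronglyMeasurable _),
      h1.trans_lt ENNReal.ofReal_lt_top⟩
  have h2 : ‖hfin.toLp‖ ≤ δ * ‖formF h.aestronglyMeasurable_V x‖ +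
      δ * ‖formW h.aestronglyMeasurable_V x‖ + C * ‖u‖ := by
    rw [Lp.norm_toLp]
    exact ENNReal.toReal_le_of_le_ofReal (by positivity) h1
  refine le_trans (le_of_eq ?_) (pow_le_pow_left₀ (norm_nonneg _) h2 2)
  simp only [norm_sq_eq_integral]
  rw [← integral_finsetSum _ fun k _ => integrable_norm_sq _]
  refine integral_congr_ae ?_
  have hall : ∀ᵐ y, ∀ k, formALinear h k x y = (A y k : ℂ) * u y :=
    ae_all_iff.mpr fun k => formALinear_ae h k x
  filter_upwards [hall, hfin.coeFn_toLp] with y hy h3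
  rw [h3, norm_smul, mul_pow, norm_norm, EuclideanSpace.norm_sq_eq, Finset.sum_mul]
  refine Finset.sum_congr rfl fun k _ => ?_
  rw [hy k, norm_mul, mul_pow, Complex.norm_real]

/-- `A_k u` on the form space. -/
def formA (h : FieldAssumptions A V) (k : Fin 3) :
    formSpace V h.aestronglyMeasurable_V →L[ℂ] L2 :=
  (formALinear h k).mkContinuousOfExistsBound (by
    obtain ⟨C, hC0, hC⟩ := sum_norm_sq_formALinear_le h one_pos
    refine ⟨2 + C, fun x => ?_⟩
    have h1 := (Finset.single_le_sum (f := fun k => ‖formALinear h k x‖ ^ 2)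
      (fun k _ => sq_nonneg _) (Finset.mem_univ k)).trans (hC x)
    have h2 := abs_le_of_sq_le_sq' h1 (by positivity) |>.2
    have h3 := formSpace_norm_sq h.aestronglyMeasurable_V x
    have h4 : ‖formF h.aestronglyMeasurable_V x‖ ≤ ‖x‖ :=
      abs_le_of_sq_le_sq' (by nlinarith [sq_nonneg ‖formW h.aestronglyMeasurable_V x‖])
        (norm_nonneg _) |>.2
    have h5 : ‖formW h.aestronglyMeasurable_V x‖ ≤ ‖x‖ :=
      abs_le_of_sq_le_sq' (by nlinarith [sq_nonneg ‖formF h.aestronglyMeasurable_V x‖])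
        (norm_nonneg _) |>.2
    have h6 : ‖formU h.aestronglyMeasurable_V x‖ ≤ ‖x‖ := (norm_bessel_le _).trans h4
    nlinarith)

/-- `(-i∂_k + A_k) u` on the form space. -/
def formG (h : FieldAssumptions A V) (k : Fin 3) :
    formSpace V h.aestronglyMeasurable_V →L[ℂ] L2 :=
  momentum k ∘L formF h.aestronglyMeasurable_V + formA h k

lemma formG_ae (h : FieldAssumptions A V) (k : Fin 3) (x) :
    ∀ᵐ y, formG h k x y =
      momentum k (formF _ x) y + (A y k : ℂ) * formU h.aestronglyMeasurable_V x y := by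
  filter_upwards [Lp.coeFn_add (momentum k (formF h.aestronglyMeasurable_V x)) (formA h k x),
    formALinear_ae h k x] with y h1 h2
  rw [← h2]
  exact h1

lemma abs_momentumSymbol_mul_le (hθ : IsCutoff θ) (s : ℝ) (ξ : E3) :
    |momentumSymbol θ s ξ * besselWeight ξ| ≤ 2 * Real.pi := by
  rw [abs_of_nonneg (mul_nonneg (momentumSymbol_nonneg θ s ξ) (besselWeight_pos ξ).le)]
  have h1 := momentumSymbol_le hθ s ξ
  have h2 := norm_mul_besselWeight_le ξ
  have h3 := besselWeight_pos ξ
  calc momentumSymbol θ s ξ * besselWeight ξ ≤ 2 * Real.pi * ‖ξ‖ * besselWeight ξ := by gcongr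
    _ = 2 * Real.pi * (‖ξ‖ * besselWeight ξ) := by ring
    _ ≤ 2 * Real.pi := mul_le_of_le_one_right (by positivity) h2

/-- The Fourier transform of `|p| √θ_s(p) u`, in terms of `F`. -/
def symbolMul (hθ : IsCutoff θ) (s : ℝ) : L2 →L[ℂ] L2 :=
  mulL (fun ξ => momentumSymbol θ s ξ * besselWeight ξ)
    ((continuous_momentumSymbol hθ s).mul continuous_besselWeight).aestronglyMeasurable
    (abs_momentumSymbol_mul_le hθ s)

lemma besselMul_ae (F : L2) : ∀ᵐ ξ, besselMul F ξ = (besselWeight ξ : ℂ) * F ξ :=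
  mulL_ae continuous_besselWeight.aestronglyMeasurable abs_besselWeight_le F

lemma symbolMul_ae (hθ : IsCutoff θ) (s : ℝ) (F : L2) :
    ∀ᵐ ξ, symbolMul hθ s F ξ = (momentumSymbol θ s ξ : ℂ) * (𝓕 (bessel F) : L2) ξ := by
  rw [fourier_bessel]
  filter_upwards [mulL_ae ((continuous_momentumSymbol hθ s).mul
    continuous_besselWeight).aestronglyMeasurable (abs_momentumSymbol_mul_le hθ s) F,
    besselMul_ae F] with ξ h1 h2
  rw [h2, ← mul_assoc, ← Complex.ofReal_mul]
  exact h1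

/-- The momentum condition forces u ∈ H¹. Conversely, u ∈ H¹ and √V u ∈ L² make (-i∇+A)u square
integrable, by the relative bound on A. Thus `formSpace` parametrises the whole form domain. -/
lemma formData_iff (h : FieldAssumptions A V) (hθ : IsCutoff θ) (hs : 0 < s) {u : L2}
    {g : Fin 3 → L2} {w m : L2} : FormData A V θ s u g w m ↔
      ∃ x, formU h.aestronglyMeasurable_V x = u ∧ (∀ k, formG h k x = g k) ∧
        formW h.aestronglyMeasurable_V x = w ∧ symbolMul hθ s (formF _ x) = m := by
  constructor
  · intro hd
    obtain ⟨F, rfl⟩ := hd.exists_bessel hθ hs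
    obtain ⟨x, rfl, rfl⟩ := exists_formSpace h.aestronglyMeasurable_V hd.pot
    refine ⟨x, rfl, fun k => ?_, rfl, ?_⟩
    · ext1
      filter_upwards [(isMagneticDeriv_bessel_iff h k _ _).mp (hd.kin k), formG_ae h k x]
        with y h1 h2
      rw [h1, h2]; rfl
    · ext1
      filter_upwards [hd.mom, symbolMul_ae hθ s (formF h.aestronglyMeasurable_V x)] with ξ h1 h2
      rw [h1, h2]
  · rintro ⟨x, rfl, hg, rfl, rfl⟩
    obtain rfl : (fun k => formG h k x) = g := funext hg
    exact ⟨fun k => (isMagneticDeriv_bessel_iff h k _ _).mpr (formG_ae h k x), formW_ae _ x,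
      symbolMul_ae hθ s _⟩

/-- The wave functions of finite energy are total. -/
lemma eq_zero_of_inner_formU (h : FieldAssumptions A V) {f : L2}
    (hf : ∀ x, inner ℂ (formU h.aestronglyMeasurable_V x) f = 0) : f = 0 := by
  have key : ∀ φ : E3 → ℂ, ContDiff ℝ ∞ φ → HasCompactSupport φ → ∫ x, f x * φ x = 0 := by
    intro φ hφ hsp
    have hm : MemLp (fun x => star (φ x)) 2 volume :=
      memLp_star (hφ.continuous.memLp_of_hasCompactSupport hsp)
    rw [integral_mul_eq_inner (hφ.continuous.memLp_of_hasCompactSupport hsp)]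
    have hφ' : ContDiff ℝ ∞ fun x => star (φ x) := Complex.conjCLE.contDiff.comp hφ
    have hs' : HasCompactSupport fun x => star (φ x) :=
      hsp.comp_left (g := fun z : ℂ => star z) (by simp)
    set ψ : 𝓢(E3, ℂ) := hs'.toSchwartzMap hφ'
    have hψ : hm.toLp = ψ.toLp 2 := rfl
    have hw : Function.HasTemperateGrowth fun ξ : E3 => (1 + ‖ξ‖ ^ 2) ^ (1 / 2 : ℝ) :=
      Function.hasTemperateGrowth_one_add_norm_sq_rpow E3 _
    -- Inverting the Bessel weight exhibits the test function as an H¹ function; V ∈ L¹_loc then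
    -- puts it in the form domain.
    set F : 𝓢(E3, ℂ) := smulLeftCLM ℂ (fun ξ : E3 => (1 + ‖ξ‖ ^ 2) ^ (1 / 2 : ℝ)) (𝓕 ψ)
    have hF : bessel (F.toLp 2) = ψ.toLp 2 := by
      rw [bessel_toLp]
      congr 1
      have : smulLeftCLM ℂ besselWeight F = 𝓕 ψ := by
        ext ξ
        rw [smulLeftCLM_apply_apply hasTemperateGrowth_besselWeight, smulLeftCLM_apply_apply hw,
          smul_smul, besselWeight, ← Real.rpow_add (by positivity)]
        norm_num
      rw [this]
      exact FourierTransform.fourierInv_fourier_eq ψ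
    have hV2 : MemLp (fun x => (√(V x) : ℂ) * (bessel (F.toLp 2)) x) 2 volume := by
      rw [hF]
      have hm2 : AEStronglyMeasurable (fun x => (√(V x) : ℂ) * (ψ.toLp 2 volume) x) volume :=
        (Complex.continuous_ofReal.comp_aestronglyMeasurable
          (aestronglyMeasurable_sqrt h.aestronglyMeasurable_V)).mul (Lp.aestronglyMeasurable _)
      rw [memLp_two_iff_integrable_sq_norm hm2]
      have hi : Integrable (fun x => (‖φ x‖ ^ 2) • V x) volume :=
        h.V_loc.integrable_smul_left_of_hasCompactSupport (hφ.continuous.norm.pow 2)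
          (hsp.comp_left (g := fun z : ℂ => ‖z‖ ^ 2) (by simp))
      refine hi.congr ?_
      filter_upwards [coeFn_toLp ψ 2] with x hx
      have e : ψ x = star (φ x) := rfl
      rw [hx, norm_mul, mul_pow, Complex.norm_real, Real.norm_eq_abs, sq_abs,
        Real.sq_sqrt (h.V_nonneg x), e, norm_star, smul_eq_mul, mul_comm]
    obtain ⟨x, hx, -⟩ := exists_formSpace h.aestronglyMeasurable_V hV2.coeFn_toLp
    have := hf x
    rwa [formU, ContinuousLinearMap.comp_apply, hx, besselL_apply, hF, ← hψ] at this
  have h0 := ae_eq_of_integral_mul_eq (L2_locallyIntegrable f) (L2_locallyIntegrable (0 : L2))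
    fun φ hφ hsp => by
      rw [key φ hφ hsp]
      symm
      rw [integral_mul_eq_inner (hφ.continuous.memLp_of_hasCompactSupport hsp), inner_zero_right]
  exact Lp.ext h0

end FormSpace

/-! ### Coercivity, and the inverse of h̃ -/

section OneBody

variable {A : E3 → E3} {V θ : E3 → ℝ} {ε s : ℝ}

lemma norm_momentum (k : Fin 3) (F : L2) : ‖momentum k F‖ = ‖momentumMul k F‖ :=
  (Lp.fourierTransformₗᵢ E3 ℂ).symm.norm_map _

lemma norm_bessel (F : L2) : ‖bessel F‖ = ‖besselMul F‖ :=
  (Lp.fourierTransformₗᵢ E3 ℂ).symm.norm_map _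

lemma sum_norm_sq_momentum (F : L2) :
    ∑ k, ‖momentum k F‖ ^ 2 = ∫ ξ, (2 * Real.pi * ‖ξ‖ * besselWeight ξ) ^ 2 * ‖F ξ‖ ^ 2 := by
  simp only [norm_momentum]
  have h : ∀ k, ‖momentumMul k F‖ ^ 2 = ∫ ξ, momentumWeight k ξ ^ 2 * ‖F ξ‖ ^ 2 := fun k =>
    norm_sq_mulL _ _ F
  simp only [h]
  rw [← integral_finsetSum]
  · refine integral_congr_ae (Eventually.of_forall fun ξ => ?_)
    simp only [momentumWeight]
    rw [← Finset.sum_mul]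
    congr 1
    rw [mul_pow, mul_pow, EuclideanSpace.norm_sq_eq, Finset.mul_sum, Finset.sum_mul]
    refine Finset.sum_congr rfl fun k _ => ?_
    rw [Real.norm_eq_abs, sq_abs]; ring
  · intro k _
    refine (integrable_norm_sq (momentumMul k F)).congr ?_
    filter_upwards [mulL_ae (continuous_momentumWeight k).aestronglyMeasurable
      (abs_momentumWeight_le k) F] with ξ h1
    rw [momentumMul, h1, norm_mul, mul_pow, Complex.norm_real, Real.norm_eq_abs, sq_abs]

lemma integrable_bdd_mul_norm_sq {f : E3 → ℝ} (hf : Continuous f) {C : ℝ} (hC : ∀ ξ, |f ξ| ≤ C)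
    (F : L2) : Integrable (fun ξ => f ξ * ‖F ξ‖ ^ 2) volume :=
  (integrable_norm_sq F).bdd_mul hf.aestronglyMeasurable (Eventually.of_forall hC)

lemma abs_momentum_sq_le (ξ : E3) :
    |(2 * Real.pi * ‖ξ‖ * besselWeight ξ) ^ 2| ≤ (2 * Real.pi) ^ 2 := by
  rw [abs_of_nonneg (sq_nonneg _), mul_assoc]
  have h1 := norm_mul_besselWeight_le ξ
  have h2 : 0 ≤ ‖ξ‖ * besselWeight ξ := mul_nonneg (norm_nonneg _) (besselWeight_pos ξ).le
  exact pow_le_pow_left₀ (by positivity) (mul_le_of_le_one_right (by positivity) h1) 2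

lemma continuous_momentum_sq :
    Continuous fun ξ : E3 => (2 * Real.pi * ‖ξ‖ * besselWeight ξ) ^ 2 := by
  have := continuous_besselWeight
  fun_prop

/-- On the Fourier side, with w the Bessel weight, 1 = (1+|ξ|²)w² ≤ w² + (2π|ξ|)²w². -/
lemma norm_sq_le_bessel_add_momentum (F : L2) :
    ‖F‖ ^ 2 ≤ ‖bessel F‖ ^ 2 + ∑ k, ‖momentum k F‖ ^ 2 := by
  rw [sum_norm_sq_momentum, norm_bessel]
  have h1 : ‖besselMul F‖ ^ 2 = ∫ ξ, besselWeight ξ ^ 2 * ‖F ξ‖ ^ 2 := norm_sq_mulL _ _ F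
  have i1 : Integrable (fun ξ => besselWeight ξ ^ 2 * ‖F ξ‖ ^ 2) volume :=
    integrable_bdd_mul_norm_sq (continuous_besselWeight.pow 2) (C := 1) (fun ξ => by
      rw [Pi.pow_apply, abs_pow]; exact pow_le_one₀ (abs_nonneg _) (abs_besselWeight_le ξ)) F
  have i2 := integrable_bdd_mul_norm_sq continuous_momentum_sq abs_momentum_sq_le F
  rw [h1, ← integral_add i1 i2, norm_sq_eq_integral]
  refine integral_mono (integrable_norm_sq F) (i1.add i2) fun ξ => ?_
  change ‖F ξ‖ ^ 2 ≤ _ * _ + _ * _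
  rw [← add_mul]
  refine le_mul_of_one_le_left (sq_nonneg _) ?_
  have h2 := besselWeight_sq ξ
  have h3 : (1 : ℝ) ≤ (2 * Real.pi) ^ 2 := by nlinarith [Real.pi_gt_three]
  have h4 : (1 + ‖ξ‖ ^ 2) * besselWeight ξ ^ 2 = 1 := by
    rw [h2, mul_inv_cancel₀ (by positivity)]
  have h5 : 0 ≤ ‖ξ‖ ^ 2 * besselWeight ξ ^ 2 := by positivity
  nlinarith

/-- Because θ_s ≤ 1, subtracting (1-ε)p²θ_s(p) leaves at least εp². -/
lemma norm_sq_symbolMul_le (hθ : IsCutoff θ) (s : ℝ) (F : L2) :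
    ‖symbolMul hθ s F‖ ^ 2 ≤ ∑ k, ‖momentum k F‖ ^ 2 := by
  rw [sum_norm_sq_momentum]
  have h1 : ‖symbolMul hθ s F‖ ^ 2 =
      ∫ ξ, (momentumSymbol θ s ξ * besselWeight ξ) ^ 2 * ‖F ξ‖ ^ 2 := norm_sq_mulL _ _ F
  rw [h1]
  have hpt : ∀ ξ, (momentumSymbol θ s ξ * besselWeight ξ) ^ 2 ≤
      (2 * Real.pi * ‖ξ‖ * besselWeight ξ) ^ 2 := fun ξ => by
    have := momentumSymbol_le hθ s ξ
    have h0 := momentumSymbol_nonneg θ s ξ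
    have h3 := besselWeight_pos ξ
    gcongr
  refine integral_mono (integrable_bdd_mul_norm_sq (((continuous_momentumSymbol hθ s).mul
    continuous_besselWeight).pow 2) (C := (2 * Real.pi) ^ 2) (fun ξ => ?_) F)
    (integrable_bdd_mul_norm_sq continuous_momentum_sq abs_momentum_sq_le F) fun ξ => ?_
  · refine le_trans ?_ (abs_momentum_sq_le ξ)
    rw [abs_of_nonneg (sq_nonneg _), abs_of_nonneg (sq_nonneg _)]
    exact hpt ξ
  · exact mul_le_mul_of_nonneg_right (hpt ξ) (sq_nonneg _)

lemma norm_add_sq_ge {η : ℝ} (hη : 0 < η) (P a : L2) :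
    (1 - η) * ‖P‖ ^ 2 - η⁻¹ * ‖a‖ ^ 2 ≤ ‖P + a‖ ^ 2 := by
  have h1 : ‖P‖ - ‖a‖ ≤ ‖P + a‖ := by
    have := norm_sub_le (P + a) a
    rw [add_sub_cancel_right] at this
    linarith
  have h2 : ‖a‖ - ‖P‖ ≤ ‖P + a‖ := by
    have := norm_sub_le (P + a) P
    rw [add_sub_cancel_left] at this
    linarith
  have h3 : (‖P‖ - ‖a‖) ^ 2 ≤ ‖P + a‖ ^ 2 := sq_le_sq' (by linarith) h1
  have h4 : 0 ≤ η⁻¹ * (η * ‖P‖ - ‖a‖) ^ 2 := by positivity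
  have h5 : η⁻¹ * (η * ‖P‖ - ‖a‖) ^ 2 = η * ‖P‖ ^ 2 - 2 * ‖P‖ * ‖a‖ + η⁻¹ * ‖a‖ ^ 2 := by
    field_simp; ring
  nlinarith [sq_nonneg ‖a‖]

/-- The quadratic form of `h - (1-ε) p² θ_s(p)` is coercive, up to a shift. -/
lemma exists_coercive (h : FieldAssumptions A V) (hθ : IsCutoff θ) (hε₀ : 0 < ε) (hε₁ : ε < 1)
    (s : ℝ) : ∃ l c : ℝ, 0 < c ∧ ∀ x : formSpace V h.aestronglyMeasurable_V, c * ‖x‖ ^ 2 ≤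
      ∑ k, ‖formG h k x‖ ^ 2 + ‖formW h.aestronglyMeasurable_V x‖ ^ 2
        - (1 - ε) * ‖symbolMul hθ s (formF h.aestronglyMeasurable_V x)‖ ^ 2
        + l * ‖formU h.aestronglyMeasurable_V x‖ ^ 2 := by
  -- Separating A from p with η = ε/2 leaves (ε/2)p² after the subtraction. With δ = ε/8 the field
  -- costs 3ε/32 (‖F‖² + ‖w‖²) and a multiple of ‖u‖², which leaves room for the constant ε/4.
  obtain ⟨C, hC0, hC⟩ := sum_norm_sq_formALinear_le h (δ := ε / 8) (by positivity)
  refine ⟨ε / 2 + 6 / ε * C ^ 2, ε / 4, by positivity, fun x => ?_⟩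
  set F := formF h.aestronglyMeasurable_V x with hF
  set w := formW h.aestronglyMeasurable_V x
  set u := formU h.aestronglyMeasurable_V x with hu
  have hub : u = bessel F := rfl
  have h1 : (1 - ε / 2) * ∑ k, ‖momentum k F‖ ^ 2 - (ε / 2)⁻¹ * ∑ k, ‖formALinear h k x‖ ^ 2 ≤
      ∑ k, ‖formG h k x‖ ^ 2 := by
    rw [Finset.mul_sum, Finset.mul_sum, ← Finset.sum_sub_distrib]
    exact Finset.sum_le_sum fun k _ => norm_add_sq_ge (by positivity) _ _
  have h2 := norm_sq_symbolMul_le hθ s F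
  have h3 := norm_sq_le_bessel_add_momentum F
  have h4 := hC x
  have h5 := formSpace_norm_sq h.aestronglyMeasurable_V x
  rw [← hub] at h3
  rw [h5]
  set P := ∑ k, ‖momentum k F‖ ^ 2
  set a := ∑ k, ‖formALinear h k x‖ ^ 2
  have h6 : a ≤ 3 * ((ε / 8) ^ 2 * ‖F‖ ^ 2 + (ε / 8) ^ 2 * ‖w‖ ^ 2 + C ^ 2 * ‖u‖ ^ 2) := by
    refine h4.trans ?_
    nlinarith [sq_nonneg (ε / 8 * ‖F‖ - ε / 8 * ‖w‖), sq_nonneg (ε / 8 * ‖F‖ - C * ‖u‖),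
      sq_nonneg (ε / 8 * ‖w‖ - C * ‖u‖)]
  have h7 : (ε / 2)⁻¹ * a ≤
      3 * ε / 32 * ‖F‖ ^ 2 + 3 * ε / 32 * ‖w‖ ^ 2 + 6 / ε * C ^ 2 * ‖u‖ ^ 2 := by
    have := mul_le_mul_of_nonneg_left h6 (inv_nonneg.mpr (half_pos hε₀).le)
    refine this.trans (le_of_eq ?_)
    field_simp
    ring
  have h8 : (1 - ε) * ‖symbolMul hθ s F‖ ^ 2 ≤ (1 - ε) * P :=
    mul_le_mul_of_nonneg_left h2 (by linarith)
  have h9 : ε / 2 * ‖F‖ ^ 2 ≤ ε / 2 * (‖u‖ ^ 2 + P) := by gcongr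
  have h10 : 0 ≤ ‖w‖ ^ 2 := sq_nonneg _
  have h11 : 0 ≤ ‖F‖ ^ 2 := sq_nonneg _
  nlinarith [mul_nonneg hε₀.le h11, mul_nonneg (sub_pos.mpr hε₁).le h10]

lemma oneBodyRel_iff (h : FieldAssumptions A V) (hθ : IsCutoff θ) (hs : 0 < s) (u f : L2) :
    OneBodyRel A V θ ε s u f ↔ ∃ x, formU h.aestronglyMeasurable_V x = u ∧ ∀ y,
      ∑ k, inner ℂ (formG h k y) (formG h k x) + inner ℂ (formW _ y) (formW _ x)
        - ((1 - ε : ℝ) : ℂ) * inner ℂ (symbolMul hθ s (formF _ y)) (symbolMul hθ s (formF _ x)) =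
          inner ℂ (formU h.aestronglyMeasurable_V y) f := by
  constructor
  · rintro ⟨g, w, m, hd, hq⟩
    obtain ⟨x, rfl, hg, rfl, rfl⟩ := (formData_iff h hθ hs).mp hd
    refine ⟨x, rfl, fun y => ?_⟩
    have := hq _ _ _ _ ((formData_iff h hθ hs).mpr ⟨y, rfl, fun k => rfl, rfl, rfl⟩)
    simpa only [← hg] using this
  · rintro ⟨x, rfl, hx⟩
    refine ⟨_, _, _, (formData_iff h hθ hs).mpr ⟨x, rfl, fun k => rfl, rfl, rfl⟩,
      fun v g' w' m' hd => ?_⟩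
    obtain ⟨y, rfl, hg, rfl, rfl⟩ := (formData_iff h hθ hs).mp hd
    have := hx y
    simpa only [hg] using this

/-- The point is single-valuedness: over u = 0 coercivity forces the form-space vector to vanish, so
f is orthogonal to all wave functions of finite energy, which are total. -/
lemma oneBody_apply_iff (h : FieldAssumptions A V) (hθ : IsCutoff θ) (hε₀ : 0 < ε) (hε₁ : ε < 1)
    (hs : 0 < s) (u f : L2) :
    (∃ hu : u ∈ (oneBody A V θ ε s).domain, oneBody A V θ ε s ⟨u, hu⟩ = f) ↔
      OneBodyRel A V θ ε s u f := by
  have hsv : ∀ x ∈ oneBodyGraph A V θ ε s, x.1 = 0 → x.2 = 0 := by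
    rintro ⟨u, f⟩ hx (rfl : u = 0)
    obtain ⟨x, hx0, hx⟩ := (oneBodyRel_iff h hθ hs _ _).mp hx
    obtain ⟨l, c, hc, hco⟩ := exists_coercive h hθ hε₀ hε₁ s
    have hz : x = 0 := by
      have h1 := congrArg Complex.re (hx x)
      simp only [hx0, inner_zero_left, Complex.add_re, Complex.sub_re, Complex.re_ofReal_mul,
        re_inner_self, Complex.re_sum, Complex.zero_re] at h1
      have h2 := hco x
      rw [h1, hx0] at h2
      simp only [norm_zero] at h2
      have h3 : ‖x‖ ^ 2 ≤ 0 := by nlinarith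
      exact norm_eq_zero.mp (by nlinarith [norm_nonneg x])
    refine eq_zero_of_inner_formU h fun y => ?_
    rw [← hx y, hz]
    simp
  constructor
  · rintro ⟨hu, rfl⟩
    exact Submodule.mem_graph_toLinearPMap hsv ⟨u, hu⟩
  · intro hr
    have h' : (u, f) ∈ (oneBody A V θ ε s).graph := by
      rw [oneBody, Submodule.toLinearPMap_graph_eq _ hsv]; exact hr
    rw [LinearPMap.mem_graph_iff] at h'
    obtain ⟨y, h1, h2⟩ := h'
    obtain rfl : (y : L2) = u := h1
    exact ⟨y.2, h2⟩

instance nontrivial_L2 : Nontrivial L2 := by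
  refine ⟨0, (memLp_indicator_const 2 (measurableSet_closedBall (x := (0 : E3)) (ε := 1)) (1 : ℂ)
    (Or.inr (measure_closedBall_lt_top).ne)).toLp, fun h0 => ?_⟩
  have h1 := congrArg (‖·‖) h0
  simp only [norm_zero, Lp.norm_toLp] at h1
  rw [eLpNorm_indicator_const measurableSet_closedBall (by norm_num) (by norm_num)] at h1
  rw [eq_comm, ENNReal.toReal_eq_zero_iff] at h1
  simp at h1
  rcases h1 with h | ⟨h, -⟩ <;> linarith [Real.pi_pos]

/-- Pointwise (1+|ξ|²)⁻¹ ≤ π(1+π|ξ|²)⁻¹, because π ≥ 1. -/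
lemma norm_sq_besselMul_fourier_le (g : L2) : ‖besselMul (𝓕 g : L2)‖ ^ 2 ≤
    Real.pi * ∫ y, (inner ℂ g (translate y g)).re ∂yukawa := by
  rw [integral_re_inner_translate_yukawa]
  have h11 : ‖besselMul (𝓕 g : L2)‖ ^ 2 = ∫ ξ, besselWeight ξ ^ 2 * ‖(𝓕 g : L2) ξ‖ ^ 2 := norm_sq_mulL _ _ _
  rw [h11, ← integral_const_mul]
  have hpi := Real.pi_gt_three
  have hpos : ∀ ξ : E3, 0 < 1 + Real.pi * ‖ξ‖ ^ 2 := fun ξ => by positivity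
  refine integral_mono (integrable_bdd_mul_norm_sq (continuous_besselWeight.pow 2) (C := 1)
    (fun ξ => by rw [Pi.pow_apply, abs_pow]; exact pow_le_one₀ (abs_nonneg _) (abs_besselWeight_le ξ)) _)
    ((integrable_bdd_mul_norm_sq (f := fun ξ => (1 + Real.pi * ‖ξ‖ ^ 2)⁻¹)
      (Continuous.inv₀ (by fun_prop) fun ξ => (hpos ξ).ne') (C := 1) (fun ξ => ?_) _).const_mul _)
    fun ξ => ?_
  · rw [abs_of_pos (inv_pos.mpr (hpos ξ))]
    exact inv_le_one_of_one_le₀ (by nlinarith [sq_nonneg ‖ξ‖])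
  · change _ * _ ≤ _ * (_ * _)
    rw [← mul_assoc, besselWeight_sq]
    gcongr
    rw [← div_eq_mul_inv, ← one_div, div_le_div_iff₀ (by positivity) (hpos ξ)]
    nlinarith [sq_nonneg ‖ξ‖]

lemma exists_inverse_oneBody (h : FieldAssumptions A V) (hθ : IsCutoff θ) (hε₀ : 0 < ε)
    (hε₁ : ε < 1) (hs : 0 < s) {l c : ℝ} (hc : 0 < c)
    (hco : ∀ x : formSpace V h.aestronglyMeasurable_V, c * ‖x‖ ^ 2 ≤
      ∑ k, ‖formG h k x‖ ^ 2 + ‖formW h.aestronglyMeasurable_V x‖ ^ 2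
        - (1 - ε) * ‖symbolMul hθ s (formF h.aestronglyMeasurable_V x)‖ ^ 2
        + l * ‖formU h.aestronglyMeasurable_V x‖ ^ 2) :
    ∃ B : L2 →L[ℂ] L2, B.IsPositive ∧ IsInverseOf (subConst (oneBody A V θ ε s) (-l)) B := by
  obtain ⟨B₀, hB₀, hinv₀⟩ := exists_form_inverse (fun k => formG h k) (formW h.aestronglyMeasurable_V)
    (symbolMul hθ s ∘L formF h.aestronglyMeasurable_V) (formU h.aestronglyMeasurable_V)
    (e := 1 - ε) hc hco
  refine ⟨B₀, hB₀, ?_⟩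
  intro u f
  rw [← hinv₀]
  have e : (∃ hu : u ∈ (subConst (oneBody A V θ ε s) (-l)).domain,
      subConst (oneBody A V θ ε s) (-l) ⟨u, hu⟩ = f) ↔
      ∃ hu : u ∈ (oneBody A V θ ε s).domain, oneBody A V θ ε s ⟨u, hu⟩ = f - (l : ℂ) • u := by
    refine exists_congr fun hu => ?_
    rw [subConst_apply, eq_sub_iff_add_eq]
    push_cast
    rw [neg_smul, sub_neg_eq_add]
  rw [e, oneBody_apply_iff h hθ hε₀ hε₁ hs, oneBodyRel_iff h hθ hs]
  refine exists_congr fun x => and_congr_right fun hx => forall_congr' fun y => ?_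
  rw [inner_sub_right, inner_smul_right, eq_sub_iff_add_eq, hx]
  rfl

/-- The operator `h̃` has a positive inverse `B ≤ 1`, dominated by the Yukawa convolution. -/
theorem exists_inverse_hTilde (h : FieldAssumptions A V) (hθ : IsCutoff θ) (hε₀ : 0 < ε)
    (hε₁ : ε < 1) (hs : 0 < s) : ∃ B : L2 →L[ℂ] L2, B.IsPositive ∧
      IsInverseOf (hTilde A V θ ε s) B ∧ (∀ f, ‖B f‖ ^ 2 ≤ (inner ℂ f (B f)).re) ∧
      ∃ C : ℝ, 0 < C ∧
        ∀ g : L2, (inner ℂ g (B g)).re ≤ C * ∫ y, (inner ℂ g (translate y g)).re ∂yukawa := by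
  obtain ⟨l, c, hc, hco⟩ := exists_coercive h hθ hε₀ hε₁ s
  obtain ⟨B₀, hB₀, hI₀⟩ := exists_inverse_oneBody h hθ hε₀ hε₁ hs hc hco
  obtain ⟨B, hB, hI, hle⟩ := exists_inverse_subConst_infSpectrum hB₀ hI₀
  refine ⟨B, hB, hI, hle, ?_⟩
  set κ := infSpectrum (subConst (oneBody A V θ ε s) 1) with hκ
  refine ⟨(1 + |κ + l|) / c * Real.pi, by positivity, fun g => ?_⟩
  obtain ⟨hd, hg⟩ := (hI (B g) g).mpr rfl
  rw [subConst_apply] at hg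
  obtain ⟨x, hx, hform⟩ := (oneBodyRel_iff h hθ hs _ _).mp
    ((oneBody_apply_iff h hθ hε₀ hε₁ hs (B g) (g + (κ : ℂ) • B g)).mp
      ⟨hd, eq_add_of_sub_eq hg⟩)
  set F := formF h.aestronglyMeasurable_V x with hF
  set D := (inner ℂ g (B g)).re with hD
  have hDs : (inner ℂ (B g) g).re = D := by rw [hD, ← hB.symm_apply]
  -- The equation for u = Bg tested with u itself: q(u) = ⟨u,g⟩ + κ‖u‖². Coercivity and ‖Bg‖² ≤ D
  -- then bound ‖F‖² by a multiple of D.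
  have h1 := congrArg Complex.re (hform x)
  simp only [hx, Complex.add_re, Complex.sub_re, Complex.re_ofReal_mul, re_inner_self,
    Complex.re_sum, inner_add_right, inner_smul_right, hDs] at h1
  rw [← hF, re_inner_self] at h1
  have h2 := hco x
  rw [← hF, h1, hx] at h2
  have h3 : ‖B g‖ ^ 2 ≤ D := hle g
  have hD0 : 0 ≤ D := le_trans (sq_nonneg _) h3
  have h4 : ‖F‖ ^ 2 ≤ ‖x‖ ^ 2 := by
    rw [formSpace_norm_sq]; linarith [sq_nonneg ‖formW h.aestronglyMeasurable_V x‖]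
  have h5 : c * ‖F‖ ^ 2 ≤ (1 + |κ + l|) * D := by
    have h6 : (κ + l) * ‖B g‖ ^ 2 ≤ |κ + l| * D :=
      mul_le_mul (le_abs_self _) h3 (sq_nonneg _) (abs_nonneg _)
    nlinarith
  -- Duality between H¹ and its dual; as ‖F‖² is at most a multiple of D, one factor √D cancels.
  have h7 : D ≤ ‖F‖ * ‖besselMul (𝓕 g : L2)‖ := by
    have e1 : inner ℂ (B g) g = inner ℂ F (besselMul (𝓕 g : L2)) := by
      rw [← hx, ← Lp.inner_fourier_eq]
      change inner ℂ (𝓕 (bessel F) : L2) _ = _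
      rw [fourier_bessel]
      exact mulL_isSymmetric _ _ _ _
    rw [← hDs, e1]
    exact (Complex.re_le_norm _).trans (norm_inner_le_norm _ _)
  set b := ‖besselMul (𝓕 g : L2)‖ with hb
  have h8 : D ≤ (1 + |κ + l|) / c * b ^ 2 := by
    have h9 : D ^ 2 ≤ ‖F‖ ^ 2 * b ^ 2 := by
      rw [← mul_pow]; gcongr
    have h10 : c * D ^ 2 ≤ (1 + |κ + l|) * D * b ^ 2 := by nlinarith [sq_nonneg b]
    rcases hD0.eq_or_lt with h0 | h0
    · rw [← h0]; positivity
    · rw [div_mul_eq_mul_div, le_div_iff₀ hc]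
      have : D * (D * c) ≤ D * ((1 + |κ + l|) * b ^ 2) := by nlinarith
      exact le_of_mul_le_mul_left this h0
  refine h8.trans ?_
  rw [mul_assoc]
  gcongr
  exact norm_sq_besselMul_fourier_le g

end OneBody

/-! ### How the potential depends on a single particle -/

section Combinatorics

variable {θ U : E3 → ℝ} {N : ℕ} {R a : ℝ}

open Classical in
/-- The contribution of the pair `(i, j)` to the potential of the particles in `S`. -/
def pairTerm (θ U : E3 → ℝ) (R : ℝ) (S : Finset (Fin N)) (x : Config N) (i j : Fin N) : ℝ :=
  if i ∈ S ∧ j ∈ S ∧ j ≠ i then scalePotential U R (x i - x j) *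
    ∏ k ∈ S with k ≠ i ∧ k ≠ j, scaleCutoff θ (2 * R) (x j - x k) else 0

/-- The nearest-neighbour potential of the particles in `S`. -/
def partialPotential (θ U : E3 → ℝ) (R : ℝ) (S : Finset (Fin N)) (x : Config N) : ℝ :=
  ∑ i, ∑ j, pairTerm θ U R S x i j

lemma partialPotential_univ (θ U : E3 → ℝ) (R : ℝ) (x : Config N) :
    partialPotential θ U R Finset.univ x = dysonPotential θ U N R x := by
  unfold partialPotential dysonPotential
  refine Finset.sum_congr rfl fun i _ => ?_
  rw [Finset.sum_filter]
  refine Finset.sum_congr rfl fun j _ => ?_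
  simp only [pairTerm, Finset.mem_univ, true_and]

lemma IsSoftPotential.exists_bound (hU : IsSoftPotential a U) : ∃ M : ℝ, 0 < M ∧ ∀ x, U x ≤ M := by
  have hc : HasCompactSupport U := by
    refine HasCompactSupport.intro (isCompact_closedBall (0 : E3) 1) fun x hx => ?_
    by_contra h
    exact hx (mem_closedBall_zero_iff.mpr (hU.support x h).2)
  obtain ⟨M, hM⟩ := hU.smooth.continuous.bounded_above_of_compact_support hc
  refine ⟨M + 1, ?_, fun x => ?_⟩
  · linarith [(norm_nonneg _).trans (hM 0)]
  · linarith [(le_abs_self _).trans (hM x)]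

lemma pairTerm_nonneg (hθ : IsCutoff θ) (hU : IsSoftPotential a U) (hR : 0 < R)
    (S : Finset (Fin N)) (x : Config N) (i j : Fin N) : 0 ≤ pairTerm θ U R S x i j := by
  unfold pairTerm
  split_ifs
  · refine mul_nonneg ?_ (Finset.prod_nonneg fun k _ => hθ.nonneg _)
    exact mul_nonneg (by positivity) (hU.nonneg _)
  · exact le_rfl

lemma pairTerm_le (hθ : IsCutoff θ) {M : ℝ} (hM0 : 0 < M) (hM : ∀ x, U x ≤ M)
    (hU : IsSoftPotential a U) (hR : 0 < R)
    (S : Finset (Fin N)) (x : Config N) (i j : Fin N) :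
    pairTerm θ U R S x i j ≤ M * (R ^ 3)⁻¹ := by
  unfold pairTerm
  split_ifs
  · have h1 : scalePotential U R (x i - x j) ≤ M * (R ^ 3)⁻¹ := by
      rw [scalePotential, mul_comm]; gcongr; exact hM _
    have h2 : 0 ≤ scalePotential U R (x i - x j) := mul_nonneg (by positivity) (hU.nonneg _)
    refine (mul_le_of_le_one_right h2 ?_).trans h1
    exact Finset.prod_le_one (fun k _ => hθ.nonneg _) fun k _ => hθ.le_one _
  · positivity

lemma partialPotential_nonneg (hθ : IsCutoff θ) (hU : IsSoftPotential a U) (hR : 0 < R)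
    (S : Finset (Fin N)) (x : Config N) : 0 ≤ partialPotential θ U R S x :=
  Finset.sum_nonneg fun i _ => Finset.sum_nonneg fun j _ => pairTerm_nonneg hθ hU hR S x i j

lemma exists_abs_partialPotential_le (hθ : IsCutoff θ) (hU : IsSoftPotential a U) (hR : 0 < R)
    (S : Finset (Fin N)) : ∃ C : ℝ, ∀ x : Config N, |partialPotential θ U R S x| ≤ C := by
  obtain ⟨M, hM0, hM⟩ := hU.exists_bound
  refine ⟨∑ _i : Fin N, ∑ _j : Fin N, M * (R ^ 3)⁻¹, fun x => ?_⟩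
  rw [abs_of_nonneg (partialPotential_nonneg hθ hU hR S x)]
  exact Finset.sum_le_sum fun i _ => Finset.sum_le_sum fun j _ =>
    pairTerm_le hθ hM0 hM hU hR S x i j

lemma continuous_partialPotential (hθ : IsCutoff θ) (hU : IsSoftPotential a U) (R : ℝ)
    (S : Finset (Fin N)) : Continuous (partialPotential θ U R S) := by
  have h1 := hθ.smooth.continuous
  have h2 := hU.smooth.continuous
  unfold partialPotential
  refine continuous_finsetSum _ fun i _ => continuous_finsetSum _ fun j _ => ?_
  unfold pairTerm
  split_ifs
  · unfold scalePotential scaleCutoff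
    fun_prop
  · exact continuous_const

/-- This independence is why the potential of the other particles commutes with operators acting on
the l-th one. -/
lemma partialPotential_update {S : Finset (Fin N)} {l : Fin N} (hl : l ∉ S) (x : Config N)
    (y : E3) : partialPotential θ U R S (Function.update x l y) = partialPotential θ U R S x := by
  have h : ∀ i ∈ S, Function.update x l y i = x i := fun i hi =>
    Function.update_of_ne (fun e : i = l => hl (e ▸ hi)) _ _
  unfold partialPotential pairTerm
  refine Finset.sum_congr rfl fun i _ => Finset.sum_congr rfl fun j _ => ?_
  split_ifs with hc
  · rw [h i hc.1, h j hc.2.1]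
    congr 1
    refine Finset.prod_congr rfl fun k hk => ?_
    rw [h k (Finset.mem_filter.mp hk).1]
  · rfl

/-- The geometric constraints on the pairs whose contribution depends on the particle `l`. -/
lemma pairTerm_ne (hθ : IsCutoff θ) (hU : IsSoftPotential a U) (hR : 0 < R) {x : Config N}
    {l i j : Fin N}
    (h : pairTerm θ U R Finset.univ x i j ≠ pairTerm θ U R (Finset.univ.erase l) x i j) :
    j ≠ i ∧ ‖x i - x j‖ ≤ R ∧ ‖x j - x l‖ ≤ 4 * R ∧
      ∀ k, ‖x j - x k‖ ≤ 2 * R → k = i ∨ k = j ∨ k = l := by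
  have hji : j ≠ i := by
    rintro rfl
    simp [pairTerm] at h
  have hUR : ‖x i - x j‖ ≤ R := by
    by_contra hcon
    have h0 : scalePotential U R (x i - x j) = 0 := by
      rw [scalePotential]
      by_contra hne
      have := (hU.support _ (right_ne_zero_of_mul hne)).2
      rw [norm_smul, Real.norm_of_nonneg (by positivity), inv_mul_le_iff₀ hR, mul_one] at this
      exact hcon this
    simp [pairTerm, h0] at h
  refine ⟨hji, hUR, ?_, fun k hk => ?_⟩
  -- If x_l is farther than 4R from x_j, then l is neither i nor j and its factor θ_{2R}(x_j - x_l)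
  -- is one: removing l changes nothing.
  · by_contra hcon
    have hjl : j ≠ l := by
      rintro rfl
      rw [sub_self, norm_zero] at hcon
      exact hcon (by positivity)
    have hil : i ≠ l := by
      rintro rfl
      rw [norm_sub_rev] at hcon
      exact hcon (by linarith)
    apply h
    simp only [pairTerm, Finset.mem_univ, Finset.mem_erase, and_true, hjl, hil, Ne,
      not_false_iff, hji, if_true]
    congr 1
    symm
    refine Finset.prod_subset (fun k hk => ?_) fun k hk hk' => ?_
    · simp only [Finset.mem_filter, Finset.mem_univ, true_and] at hk ⊢
      exact hk.2
    · have hkl : k = l := by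
        by_contra hkl
        simp only [Finset.mem_filter, Finset.mem_univ, Finset.mem_erase, true_and, and_true,
          hkl, not_false_iff, Ne] at hk hk'
        exact hk' hk
      rw [hkl, scaleCutoff]
      refine hθ.eq_one _ ?_
      rw [norm_smul, Real.norm_of_nonneg (by positivity), le_inv_mul_iff₀ (by positivity)]
      linarith [not_le.mp hcon]
  -- A further particle within 2R of x_j makes the product of cutoffs vanish, with or without l.
  · by_contra hcon
    rw [not_or, not_or] at hcon
    obtain ⟨hki, hkj, hkl⟩ := hcon
    have hz : scaleCutoff θ (2 * R) (x j - x k) = 0 := by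
      refine hθ.eq_zero _ ?_
      rw [norm_smul, Real.norm_of_nonneg (by positivity), inv_mul_le_iff₀ (by positivity)]
      linarith
    have hz' : ∀ S : Finset (Fin N), k ∈ S → pairTerm θ U R S x i j = 0 := fun S hS => by
      unfold pairTerm
      split_ifs
      · rw [Finset.prod_eq_zero (i := k) (by simp [hS, hki, hkj]) hz, mul_zero]
      · rfl
    exact h ((hz' _ (Finset.mem_univ k)).trans (hz' _ (by simp [hkl])).symm)

/-- The cell of side `R / 2` containing `y`. -/
def cell (R : ℝ) (y : E3) : Fin 3 → ℤ := fun k => ⌊y k / (R / 2)⌋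

/-- The coordinates differ by less than R/2 each, and √3/2 ≤ 1. -/
lemma norm_sub_le_of_cell_eq (hR : 0 < R) {y z : E3} (h : cell R y = cell R z) : ‖y - z‖ ≤ R := by
  refine abs_le_of_sq_le_sq' ?_ hR.le |>.2
  rw [EuclideanSpace.norm_sq_eq]
  have hk : ∀ k, ‖(y - z) k‖ ^ 2 ≤ R ^ 2 / 4 := fun k => by
    have h1 := Int.abs_sub_lt_one_of_floor_eq_floor (congrFun h k)
    rw [← sub_div, abs_div, abs_of_pos (half_pos hR), div_lt_one (half_pos hR)] at h1
    rw [PiLp.sub_apply, Real.norm_eq_abs]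
    nlinarith [abs_nonneg (y k - z k)]
  refine (Finset.sum_le_sum fun k _ => hk k).trans ?_
  simp
  nlinarith [sq_nonneg R]

lemma cell_mem (hR : 0 < R) {y : E3} (h : ‖y‖ ≤ 4 * R) :
    cell R y ∈ Fintype.piFinset fun _ : Fin 3 => Finset.Icc (-8 : ℤ) 8 := by
  rw [Fintype.mem_piFinset]
  intro k
  have h1 : |y k| ≤ 4 * R := (PiLp.norm_apply_le y k).trans h
  rw [abs_le] at h1
  rw [Finset.mem_Icc, cell]
  constructor
  · rw [Int.le_floor, le_div_iff₀ (half_pos hR)]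
    push_cast; linarith
  · refine Int.floor_le_iff.mpr ?_
    rw [div_lt_iff₀ (half_pos hR)]
    push_cast; linarith

open Classical in
/-- The number of pairs whose contribution depends on the particle `l` is bounded. -/
lemma card_pairTerm_ne_le (hθ : IsCutoff θ) (hU : IsSoftPotential a U) (hR : 0 < R) (x : Config N)
    (l : Fin N) :
    (Finset.univ.filter fun p : Fin N × Fin N => pairTerm θ U R Finset.univ x p.1 p.2 ≠
      pairTerm θ U R (Finset.univ.erase l) x p.1 p.2).card ≤ 9 * 17 ^ 3 := by
  set P := Finset.univ.filter fun p : Fin N × Fin N => pairTerm θ U R Finset.univ x p.1 p.2 ≠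
      pairTerm θ U R (Finset.univ.erase l) x p.1 p.2 with hP
  have hmem : ∀ p ∈ P, _ := fun p hp => pairTerm_ne hθ hU hR (Finset.mem_filter.mp hp).2
  have hmaps : ∀ p ∈ P, cell R (x p.2 - x l) ∈
      Fintype.piFinset fun _ : Fin 3 => Finset.Icc (-8 : ℤ) 8 := fun p hp =>
    cell_mem hR (hmem p hp).2.2.1
  -- There are 17³ cells, indexed by [-8,8]³ as 4R is eight sides. Fix a pair q in a cell. Any other
  -- pair p in it has its second particle within R and its first within 2R of x_{q.2}, so both
  -- indices lie in {q.1, q.2, l}: at most 9 pairs.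
  refine (Finset.card_le_mul_card_image_of_maps_to hmaps 9 fun b _ => ?_).trans ?_
  · rcases (P.filter fun p => cell R (x p.2 - x l) = b).eq_empty_or_nonempty with h0 | ⟨q, hq⟩
    · rw [h0]; simp
    · obtain ⟨hqP, hqb⟩ := Finset.mem_filter.mp hq
      obtain ⟨-, -, -, hq4⟩ := hmem q hqP
      have hsub : (P.filter fun p => cell R (x p.2 - x l) = b) ⊆
          ({q.1, q.2, l} : Finset (Fin N)) ×ˢ ({q.1, q.2, l} : Finset (Fin N)) := by
        intro p hp
        obtain ⟨hpP, hpb⟩ := Finset.mem_filter.mp hp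
        obtain ⟨-, hp2, -, -⟩ := hmem p hpP
        have h1 : ‖x q.2 - x p.2‖ ≤ R := by
          have := norm_sub_le_of_cell_eq hR (hqb.trans hpb.symm)
          rwa [sub_sub_sub_cancel_right] at this
        have h2 : ‖x q.2 - x p.1‖ ≤ 2 * R := by
          have e : x q.2 - x p.1 = (x q.2 - x p.2) - (x p.1 - x p.2) := by abel
          rw [e]
          exact (norm_sub_le _ _).trans (by linarith)
        have h3 := hq4 p.1 h2
        have h4 := hq4 p.2 (by linarith)
        simp only [Finset.mem_product, Finset.mem_insert, Finset.mem_singleton]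
        exact ⟨h3, h4⟩
      refine (Finset.card_le_card hsub).trans ?_
      rw [Finset.card_product]
      have := Finset.card_le_three (a := q.1) (b := q.2) (c := l)
      exact Nat.mul_le_mul this this
  · rw [Fintype.card_piFinset]
    simp

/-- Removing one particle changes the potential by at most `O(R⁻³)`, and not at all if that
particle is far from the others. -/
theorem exists_sub_partialPotential_sq_le (hθ : IsCutoff θ) (hU : IsSoftPotential a U) :
    ∃ C : ℝ, 0 < C ∧ ∀ (n : ℕ) (R : ℝ), 0 < R → ∀ (x : Config (n + 1)) (l : Fin (n + 1)),
      (partialPotential θ U R Finset.univ x -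
        partialPotential θ U R (Finset.univ.erase l) x) ^ 2 ≤
      C * (R ^ 6)⁻¹ * ∑ k with k ≠ l, nearInd l k (4 * R) x := by
  classical
  obtain ⟨M, hM0, hM⟩ := hU.exists_bound
  refine ⟨(9 * 17 ^ 3 * M) ^ 2, by positivity, fun n R hR x l => ?_⟩
  set D : Fin (n + 1) × Fin (n + 1) → ℝ := fun p => pairTerm θ U R Finset.univ x p.1 p.2 -
    pairTerm θ U R (Finset.univ.erase l) x p.1 p.2 with hD
  have hsum : partialPotential θ U R Finset.univ x -
      partialPotential θ U R (Finset.univ.erase l) x = ∑ p, D p := by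
    rw [partialPotential, partialPotential, ← Finset.sum_sub_distrib, Fintype.sum_prod_type]
    exact Finset.sum_congr rfl fun i _ => (Finset.sum_sub_distrib _ _).symm
  have hDb : ∀ p, |D p| ≤ M * (R ^ 3)⁻¹ := fun p => by
    have h1 := pairTerm_nonneg hθ hU hR Finset.univ x p.1 p.2
    have h2 := pairTerm_nonneg hθ hU hR (Finset.univ.erase l) x p.1 p.2
    have h3 := pairTerm_le hθ hM0 hM hU hR Finset.univ x p.1 p.2
    have h4 := pairTerm_le hθ hM0 hM hU hR (Finset.univ.erase l) x p.1 p.2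
    rw [abs_le]
    constructor <;> simp only [hD] <;> linarith
  have hn0 : ∀ k, 0 ≤ nearInd l k (4 * R) x := fun k => by
    unfold nearInd; exact Set.indicator_nonneg (fun _ _ => zero_le_one) _
  by_cases hall : ∀ p, D p = 0
  · rw [hsum, Finset.sum_eq_zero fun p _ => hall p]
    have : 0 ≤ ∑ k with k ≠ l, nearInd l k (4 * R) x := Finset.sum_nonneg fun k _ => hn0 k
    simp only [ne_eq, OfNat.ofNat_ne_zero, not_false_eq_true, zero_pow]
    positivity
  · push Not at hall
    obtain ⟨p, hp⟩ := hall
    obtain ⟨h1, h2, h3, -⟩ := pairTerm_ne hθ hU hR (sub_ne_zero.mp hp)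
    -- Any affected pair has a member other than l within 4R of it, so the sum of indicators is at
    -- least one whenever the difference is nonzero.
    obtain ⟨k, hkl, hk⟩ : ∃ k, k ≠ l ∧ ‖x l - x k‖ ≤ 4 * R := by
      by_cases hl : p.2 = l
      · refine ⟨p.1, fun e => h1 (hl.trans e.symm), ?_⟩
        rw [hl, norm_sub_rev] at h2
        linarith
      · exact ⟨p.2, hl, by rwa [norm_sub_rev]⟩
    have hone : 1 ≤ ∑ k with k ≠ l, nearInd l k (4 * R) x := by
      have e : nearInd l k (4 * R) x = 1 := by
        unfold nearInd
        exact Set.indicator_of_mem (s := {x : Config (n + 1) | ‖x l - x k‖ ≤ 4 * R}) hk 1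
      rw [← e]
      exact Finset.single_le_sum (f := fun k => nearInd l k (4 * R) x) (fun k _ => hn0 k)
        (by simp [hkl])
    have habs : |∑ p, D p| ≤ 9 * 17 ^ 3 * (M * (R ^ 3)⁻¹) := by
      rw [← Finset.sum_filter_ne_zero]
      refine (Finset.abs_sum_le_sum_abs _ _).trans ?_
      refine (Finset.sum_le_card_nsmul _ _ _ fun p _ => hDb p).trans ?_
      rw [nsmul_eq_mul]
      gcongr
      have := card_pairTerm_ne_le hθ hU hR x l
      simp only [hD, ne_eq, sub_eq_zero] at this ⊢
      exact_mod_cast this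
    rw [hsum, ← sq_abs]
    calc |∑ p, D p| ^ 2 ≤ (9 * 17 ^ 3 * (M * (R ^ 3)⁻¹)) ^ 2 := by gcongr
      _ = (9 * 17 ^ 3 * M) ^ 2 * (R ^ 6)⁻¹ := by
        rw [show R ^ 6 = (R ^ 3) ^ 2 by ring, ← inv_pow]; ring
      _ ≤ _ := le_mul_of_one_le_right (by positivity) hone

end Combinatorics

/-! ### Sums of unbounded operators and the abstract square inequality -/

section UnboundedSums

variable {H : Type*} [NormedAddCommGroup H] [InnerProductSpace ℂ H] {ι : Type*}

lemma mem_domain_sum (T : ι → H →ₗ.[ℂ] H) (S : Finset ι) {ψ : H}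
    (h : ψ ∈ (∑ j ∈ S, T j).domain) : ∀ j ∈ S, ψ ∈ (T j).domain := by
  classical
  induction S using Finset.induction_on with
  | empty => simp
  | insert a S ha ih =>
    rw [Finset.sum_insert ha, LinearPMap.add_domain] at h
    intro j hj
    rcases Finset.mem_insert.mp hj with rfl | hj
    · exact h.1
    · exact ih h.2 j hj

lemma sum_apply_eq (T : ι → H →ₗ.[ℂ] H) (S : Finset ι) {ψ : H} {f : ι → H}
    (hf : ∀ j ∈ S, ∃ h : ψ ∈ (T j).domain, T j ⟨ψ, h⟩ = f j) :
    ∃ h : ψ ∈ (∑ j ∈ S, T j).domain, (∑ j ∈ S, T j) ⟨ψ, h⟩ = ∑ j ∈ S, f j := by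
  classical
  induction S using Finset.induction_on with
  | empty => exact ⟨trivial, rfl⟩
  | insert a S ha ih =>
    obtain ⟨h1, e1⟩ := ih fun j hj => hf j (Finset.mem_insert_of_mem hj)
    obtain ⟨h2, e2⟩ := hf a (Finset.mem_insert_self _ _)
    rw [Finset.sum_insert ha, Finset.sum_insert ha]
    exact ⟨⟨h2, h1⟩, by
      rw [← e1, ← e2]
      exact LinearPMap.add_apply _ _ ⟨ψ, h2, h1⟩⟩

/-- This dictionary replaces domain questions by the existence of vectors f_j = T_jψ, so later
estimates involve bounded operators only. -/
lemma sum_apply_iff [Fintype ι] {T : ι → H →ₗ.[ℂ] H} {B : ι → H →L[ℂ] H}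
    (hT : ∀ j, IsInverseOf (T j) (B j)) {ψ φ : H} :
    (∃ h : ψ ∈ (∑ j, T j).domain, (∑ j, T j) ⟨ψ, h⟩ = φ) ↔
      ∃ f : ι → H, (∀ j, B j (f j) = ψ) ∧ ∑ j, f j = φ := by
  constructor
  · rintro ⟨h, rfl⟩
    have hd := mem_domain_sum T _ h
    have hd' := fun j => hd j (Finset.mem_univ j)
    refine ⟨fun j => T j ⟨ψ, hd' j⟩, fun j => ((hT j _ _).mp ⟨hd' j, rfl⟩).symm, ?_⟩
    obtain ⟨h', e⟩ := sum_apply_eq T Finset.univ (f := fun j => T j ⟨ψ, hd' j⟩)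
      fun j _ => ⟨hd' j, rfl⟩
    exact e.symm
  · rintro ⟨f, hf, rfl⟩
    exact sum_apply_eq T Finset.univ fun j _ => (hT j _ _).mpr (hf j).symm

lemma mulOp_apply {N : ℕ} {F : Config N → ℝ} (hF : AEStronglyMeasurable F volume) {C : ℝ}
    (hC : ∀ x, |F x| ≤ C) (Ψ : L2N N) :
    ∃ h : Ψ ∈ (mulOp N F).domain, mulOp N F ⟨Ψ, h⟩ = mulL F hF hC Ψ := by
  have hsv : ∀ x ∈ mulGraph N F, x.1 = 0 → x.2 = 0 := by
    rintro ⟨Ψ, Φ⟩ h (rfl : Ψ = 0)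
    ext1
    have h' : ∀ᵐ x : Config N, Φ x = (F x : ℂ) * (0 : L2N N) x := h
    filter_upwards [h'] with x h1
    simp [h1]
  have h' : (Ψ, mulL F hF hC Ψ) ∈ (mulOp N F).graph := by
    rw [mulOp, Submodule.toLinearPMap_graph_eq _ hsv]
    exact mulL_ae hF hC Ψ
  rw [LinearPMap.mem_graph_iff] at h'
  obtain ⟨y, h1, h2⟩ := h'
  obtain rfl : (y : L2N N) = Ψ := h1
  exact ⟨y.2, h2⟩

/-- A lower bound for `‖∑ fⱼ + c w‖` when `w` is, up to a small error, in the positive direction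
of each `fⱼ`. -/
lemma norm_sq_sum_add_ge [Fintype ι] [DecidableEq ι] (f a e : ι → H) (w : H) {c K : ℝ} (hc : 0 ≤ c)
    (hw : ∀ j, w = a j + e j) (ha : ∀ j, 0 ≤ (inner ℂ (f j) (a j)).re)
    (he : ∀ j, ‖e j‖ ^ 2 ≤ K * ∑ k with k ≠ j, (inner ℂ (f j) (f k)).re)
    (hf : ∀ j, 0 ≤ ∑ k with k ≠ j, (inner ℂ (f j) (f k)).re) (hcK : 4 * c ^ 2 * K ≤ 1) :
    1 / 3 * ‖∑ j, f j‖ ^ 2 ≤ ‖∑ j, f j + (c : ℂ) • w‖ ^ 2 := by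
  have h1 : ‖∑ j, f j‖ ^ 2 = ∑ j, (‖f j‖ ^ 2 + ∑ k with k ≠ j, (inner ℂ (f j) (f k)).re) := by
    rw [← re_inner_self, sum_inner, Complex.re_sum]
    refine Finset.sum_congr rfl fun j _ => ?_
    rw [inner_sum, Complex.re_sum, Finset.filter_ne', ← re_inner_self,
      Finset.add_sum_erase _ (fun k => (inner ℂ (f j) (f k)).re) (Finset.mem_univ j)]
  have h2 : ‖∑ j, f j + (c : ℂ) • w‖ ^ 2 = ‖∑ j, f j‖ ^ 2 +
      2 * (c * ∑ j, (inner ℂ (f j) w).re) + ‖(c : ℂ) • w‖ ^ 2 := by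
    rw [@norm_add_sq ℂ, inner_smul_right, sum_inner, RCLike.re_eq_complex_re,
      Complex.re_ofReal_mul, Complex.re_sum]
  -- Young gives c‖f_j‖‖e_j‖ ≤ ¼‖f_j‖² + c²‖e_j‖², and 4c²K ≤ 1 makes the last term a quarter of the
  -- pair sum. Summed and doubled, the cross terms lose at most half of ‖∑ f_j‖², leaving ½ ≥ 1/3.
  have h3 : ∀ j, -(1 / 4 * (‖f j‖ ^ 2 + ∑ k with k ≠ j, (inner ℂ (f j) (f k)).re)) ≤
      c * (inner ℂ (f j) w).re := by
    intro j
    rw [hw j, inner_add_right, Complex.add_re, mul_add]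
    have h4 : -(‖f j‖ * ‖e j‖) ≤ (inner ℂ (f j) (e j)).re :=
      (abs_le.mp ((Complex.abs_re_le_norm _).trans (norm_inner_le_norm _ _))).1
    have h5 := mul_nonneg hc (ha j)
    have h6 : c * -(‖f j‖ * ‖e j‖) ≤ c * (inner ℂ (f j) (e j)).re :=
      mul_le_mul_of_nonneg_left h4 hc
    have h7 : c ^ 2 * ‖e j‖ ^ 2 ≤ 1 / 4 * ∑ k with k ≠ j, (inner ℂ (f j) (f k)).re := by
      have := mul_le_mul_of_nonneg_left (he j) (sq_nonneg c)
      nlinarith [hf j]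
    nlinarith [sq_nonneg (1 / 2 * ‖f j‖ - c * ‖e j‖)]
  have h8 := Finset.sum_le_sum fun j (_ : j ∈ Finset.univ) => h3 j
  rw [Finset.sum_neg_distrib, ← Finset.mul_sum, ← h1, ← Finset.mul_sum] at h8
  rw [h2]
  nlinarith [sq_nonneg ‖(c : ℂ) • w‖, sq_nonneg ‖∑ j, f j‖]

/-- Since (QPQ)f = Q(PQf) and the positive operator QPQ commutes with Q, the result for commuting
pairs applies. With Q = h⁻¹ and ψ = Qf it says Re⟨hψ, Pψ⟩ ≥ 0. -/
lemma re_inner_mul_nonneg_of_commute [CompleteSpace H] {P Q : H →L[ℂ] H} (hP : P.IsPositive)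
    (hQ : Q.IsPositive) (hc : Commute P Q) (hi : Function.Injective Q) (f : H) :
    0 ≤ (inner ℂ f (P (Q f))).re := by
  have hS : (Q * P * Q).IsPositive := by
    refine isPositive_of_forall (fun x y => ?_) fun x => ?_
    · change inner ℂ (Q (P (Q x))) y = inner ℂ x (Q (P (Q y)))
      rw [hQ.symm_apply, hP.symm_apply, hQ.symm_apply]
    · change 0 ≤ (inner ℂ x (Q (P (Q x)))).re
      rw [← hQ.symm_apply]
      exact hP.re_nonneg _
  refine re_inner_nonneg_of_commute hS hQ ?_ hi (f := f) (g := P (Q f)) rfl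
  exact ((Commute.refl Q).mul_left hc).mul_left (Commute.refl Q)

end UnboundedSums

/-! ### The interaction as a bounded multiplication operator -/

section Potential

variable {θ U : E3 → ℝ} {N : ℕ} {R a : ℝ}

/-- Multiplication by the potential of the particles in `S`. -/
def potL (hθ : IsCutoff θ) (hU : IsSoftPotential a U) (hR : 0 < R) (S : Finset (Fin N)) :
    L2N N →L[ℂ] L2N N :=
  mulL (partialPotential θ U R S) (continuous_partialPotential hθ hU R S).aestronglyMeasurable
    (exists_abs_partialPotential_le hθ hU hR S).choose_spec

lemma potL_ae (hθ : IsCutoff θ) (hU : IsSoftPotential a U) (hR : 0 < R) (S : Finset (Fin N))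
    (Ψ : L2N N) : ∀ᵐ x, potL hθ hU hR S Ψ x = (partialPotential θ U R S x : ℂ) * Ψ x :=
  mulL_ae _ _ Ψ

lemma potL_isPositive (hθ : IsCutoff θ) (hU : IsSoftPotential a U) (hR : 0 < R)
    (S : Finset (Fin N)) : (potL hθ hU hR S).IsPositive :=
  mulL_isPositive _ _ (partialPotential_nonneg hθ hU hR S)

lemma partialPotential_univ_perm (θ U : E3 → ℝ) (R : ℝ) (σ : Equiv.Perm (Fin N)) (x : Config N) :
    partialPotential θ U R Finset.univ (fun i => x (σ i)) =
      partialPotential θ U R Finset.univ x := by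
  unfold partialPotential
  rw [← Equiv.sum_comp σ fun i => ∑ j, pairTerm θ U R Finset.univ x i j]
  refine Finset.sum_congr rfl fun i _ => ?_
  rw [← Equiv.sum_comp σ fun j => pairTerm θ U R Finset.univ x (σ i) j]
  refine Finset.sum_congr rfl fun j _ => ?_
  unfold pairTerm
  simp only [Finset.mem_univ, true_and, ne_eq, EmbeddingLike.apply_eq_iff_eq]
  congr 2
  exact Finset.prod_equiv σ (by simp) fun k _ => rfl

lemma permute_potL (hθ : IsCutoff θ) (hU : IsSoftPotential a U) (hR : 0 < R)
    (σ : Equiv.Perm (Fin N)) (Ψ : L2N N) :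
    permute σ (potL hθ hU hR Finset.univ Ψ) = potL hθ hU hR Finset.univ (permute σ Ψ) := by
  ext1
  filter_upwards [permute_ae σ (potL hθ hU hR Finset.univ Ψ), permute_ae σ Ψ,
    potL_ae hθ hU hR Finset.univ (permute σ Ψ),
    (measurePreserving_perm σ).quasiMeasurePreserving.ae (potL_ae hθ hU hR Finset.univ Ψ)]
    with x h1 h2 h3 h4
  rw [h1, h3, h2, h4, partialPotential_univ_perm]

lemma pairTerm_le_nearInd {n : ℕ} (hθ : IsCutoff θ) {M : ℝ} (hM0 : 0 < M) (hM : ∀ x, U x ≤ M)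
    (hU : IsSoftPotential a U) (hR : 0 < R) (x : Config (n + 1)) (i j : Fin (n + 1)) :
    pairTerm θ U R Finset.univ x i j ≤
      if i ≠ j then M * (R ^ 3)⁻¹ * nearInd i j R x else 0 := by
  have hn0 : 0 ≤ nearInd i j R x := by
    unfold nearInd; exact Set.indicator_nonneg (fun _ _ => zero_le_one) _
  split_ifs with hij
  · by_cases hd : ‖x i - x j‖ ≤ R
    · have e : nearInd i j R x = 1 := by
        unfold nearInd
        exact Set.indicator_of_mem (s := {x : Config (n + 1) | ‖x i - x j‖ ≤ R}) hd 1
      rw [e, mul_one]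
      exact pairTerm_le hθ hM0 hM hU hR _ _ _ _
    · have h0 : scalePotential U R (x i - x j) = 0 := by
        rw [scalePotential]
        by_contra hne
        have := (hU.support _ (right_ne_zero_of_mul hne)).2
        rw [norm_smul, Real.norm_of_nonneg (by positivity), inv_mul_le_iff₀ hR, mul_one] at this
        exact hd this
      have h1 : pairTerm θ U R Finset.univ x i j = 0 := by simp [pairTerm, h0]
      rw [h1]
      positivity
  · have h1 : pairTerm θ U R Finset.univ x i j = 0 := by
      rw [not_not] at hij
      simp [pairTerm, hij]
    rw [h1]

lemma integrable_nearInd_mul {n : ℕ} (i j : Fin (n + 1)) (r : ℝ) (Ψ : L2N (n + 1)) :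
    Integrable (fun x => nearInd i j r x * ‖Ψ x‖ ^ 2) volume :=
  (integrable_norm_sq Ψ).bdd_mul (aestronglyMeasurable_nearInd i j r)
    (Eventually.of_forall (abs_nearInd_le i j r))

/-- The potential energy is controlled by the probability of close encounters. -/
lemma re_inner_potL_le {n : ℕ} (hθ : IsCutoff θ) {M : ℝ} (hM0 : 0 < M) (hM : ∀ x, U x ≤ M)
    (hU : IsSoftPotential a U) (hR : 0 < R) (Ψ : L2N (n + 1)) :
    (inner ℂ Ψ (potL hθ hU hR Finset.univ Ψ)).re ≤
      M * (R ^ 3)⁻¹ * ∑ i, ∑ j with i ≠ j, ‖nearProj i j R Ψ‖ ^ 2 := by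
  have e1 : (inner ℂ Ψ (potL hθ hU hR Finset.univ Ψ)).re =
      ∫ x, partialPotential θ U R Finset.univ x * ‖Ψ x‖ ^ 2 := re_inner_mulL _ _ Ψ
  have e2 : M * (R ^ 3)⁻¹ * ∑ i, ∑ j with i ≠ j, ‖nearProj i j R Ψ‖ ^ 2 =
      ∫ x, M * (R ^ 3)⁻¹ * ∑ i, ∑ j with i ≠ j, nearInd i j R x * ‖Ψ x‖ ^ 2 := by
    rw [integral_const_mul, integral_finsetSum _ fun i _ => integrable_finsetSum _ fun j _ =>
      integrable_nearInd_mul i j R Ψ]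
    congr 1
    refine Finset.sum_congr rfl fun i _ => ?_
    rw [integral_finsetSum _ fun j _ => integrable_nearInd_mul i j R Ψ]
    exact Finset.sum_congr rfl fun j _ => norm_sq_nearProj i j R Ψ
  rw [e1, e2]
  refine integral_mono ?_ ?_ fun x => ?_
  · exact (integrable_norm_sq Ψ).bdd_mul
      (continuous_partialPotential hθ hU R Finset.univ).aestronglyMeasurable
      (Eventually.of_forall (exists_abs_partialPotential_le hθ hU hR Finset.univ).choose_spec)
  · exact (integrable_finsetSum _ fun i _ => integrable_finsetSum _ fun j _ =>
      integrable_nearInd_mul i j R Ψ).const_mul _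
  · change partialPotential θ U R Finset.univ x * ‖Ψ x‖ ^ 2 ≤ _
    have : partialPotential θ U R Finset.univ x ≤
        M * (R ^ 3)⁻¹ * ∑ i, ∑ j with i ≠ j, nearInd i j R x := by
      rw [Finset.mul_sum]
      refine Finset.sum_le_sum fun i _ => ?_
      rw [Finset.mul_sum, Finset.sum_filter]
      exact Finset.sum_le_sum fun j _ => pairTerm_le_nearInd hθ hM0 hM hU hR x i j
    refine (mul_le_mul_of_nonneg_right this (sq_nonneg _)).trans (le_of_eq ?_)
    simp only [Finset.sum_mul, mul_assoc]

/-- The error made by removing one particle from the potential is controlled by the probability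
of close encounters with it. -/
lemma norm_sq_potL_sub_le {n : ℕ} (hθ : IsCutoff θ) (hU : IsSoftPotential a U) (hR : 0 < R) {C : ℝ}
    {l : Fin (n + 1)}
    (hC : ∀ x : Config (n + 1), (partialPotential θ U R Finset.univ x -
        partialPotential θ U R (Finset.univ.erase l) x) ^ 2 ≤
      C * (R ^ 6)⁻¹ * ∑ k with k ≠ l, nearInd l k (4 * R) x) (Ψ : L2N (n + 1)) :
    ‖potL hθ hU hR Finset.univ Ψ - potL hθ hU hR (Finset.univ.erase l) Ψ‖ ^ 2 ≤
      C * (R ^ 6)⁻¹ * ∑ k with k ≠ l, ‖nearProj l k (4 * R) Ψ‖ ^ 2 := by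
  have e2 : C * (R ^ 6)⁻¹ * ∑ k with k ≠ l, ‖nearProj l k (4 * R) Ψ‖ ^ 2 =
      ∫ x, C * (R ^ 6)⁻¹ * ∑ k with k ≠ l, nearInd l k (4 * R) x * ‖Ψ x‖ ^ 2 := by
    rw [integral_const_mul, integral_finsetSum _ fun j _ => integrable_nearInd_mul l j (4 * R) Ψ]
    congr 1
    exact Finset.sum_congr rfl fun j _ => norm_sq_nearProj l j (4 * R) Ψ
  rw [e2, norm_sq_eq_integral]
  refine integral_mono_ae (integrable_norm_sq _) ?_ ?_
  · exact (integrable_finsetSum _ fun j _ => integrable_nearInd_mul l j (4 * R) Ψ).const_mul _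
  · filter_upwards [Lp.coeFn_sub (potL hθ hU hR Finset.univ Ψ)
      (potL hθ hU hR (Finset.univ.erase l) Ψ), potL_ae hθ hU hR Finset.univ Ψ,
      potL_ae hθ hU hR (Finset.univ.erase l) Ψ] with x h1 h2 h3
    rw [h1, Pi.sub_apply, h2, h3, ← sub_mul, ← Complex.ofReal_sub, norm_mul, mul_pow,
      Complex.norm_real, Real.norm_eq_abs, sq_abs]
    refine (mul_le_mul_of_nonneg_right (hC x) (sq_nonneg _)).trans (le_of_eq ?_)
    simp only [Finset.sum_mul, mul_assoc]

end Potential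

/-! ### Minimisers of quadratic forms -/

section GroundStates

variable {H : Type*} [NormedAddCommGroup H] [InnerProductSpace ℂ H]

/-- The Euler--Lagrange equation for a minimiser of a quadratic form, tested against `η`. -/
lemma inner_eq_of_minimal {ψ η Hψ Hη : H} {E : ℝ} (hn : ‖ψ‖ = 1) (hE : (inner ℂ ψ Hψ).re = E)
    (hsym : inner ℂ η Hψ = inner ℂ Hη ψ)
    (hmin : ∀ z : ℂ, E * ‖ψ + z • η‖ ^ 2 ≤ (inner ℂ (ψ + z • η) (Hψ + z • Hη)).re) :
    inner ℂ η (Hψ - (E : ℂ) • ψ) = 0 := by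
  set χ := inner ℂ η (Hψ - (E : ℂ) • ψ) with hχ
  set q : ℝ := (inner ℂ η Hη).re - E * ‖η‖ ^ 2 with hq
  have hdiff : ∀ z : ℂ, 0 ≤ 2 * ((starRingEnd ℂ) z * χ).re + ‖z‖ ^ 2 * q := by
    intro z
    have h1 := hmin z
    have h2 : (inner ℂ (ψ + z • η) (Hψ + z • Hη)).re =
        E + 2 * ((starRingEnd ℂ) z * inner ℂ η Hψ).re + ‖z‖ ^ 2 * (inner ℂ η Hη).re := by
      have e1 : inner ℂ ψ Hη = (starRingEnd ℂ) (inner ℂ η Hψ) := by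
        rw [hsym, inner_conj_symm]
      rw [inner_add_left, inner_add_right, inner_add_right, inner_smul_left, inner_smul_left,
        inner_smul_right, inner_smul_right, e1]
      simp only [Complex.add_re, hE]
      have e2 : (z * (starRingEnd ℂ) (inner ℂ η Hψ)).re =
          ((starRingEnd ℂ) z * inner ℂ η Hψ).re := by
        generalize inner ℂ η Hψ = w
        simp [Complex.mul_re]
      have e3 : ((starRingEnd ℂ) z * (z * inner ℂ η Hη)).re = ‖z‖ ^ 2 * (inner ℂ η Hη).re := by
        rw [← mul_assoc, Complex.conj_mul', ← Complex.ofReal_pow, Complex.re_ofReal_mul]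
      rw [e2, e3]; ring
    have h3 : ‖ψ + z • η‖ ^ 2 =
        1 + 2 * ((starRingEnd ℂ) z * inner ℂ η ψ).re + ‖z‖ ^ 2 * ‖η‖ ^ 2 := by
      rw [add_comm ψ, @norm_add_sq ℂ, hn, norm_smul, mul_pow, inner_smul_left,
        RCLike.re_eq_complex_re]
      ring
    rw [h2, h3] at h1
    have h4 : ((starRingEnd ℂ) z * χ).re =
        ((starRingEnd ℂ) z * inner ℂ η Hψ).re - E * ((starRingEnd ℂ) z * inner ℂ η ψ).re := by
      rw [hχ, inner_sub_right, inner_smul_right, mul_sub, Complex.sub_re, mul_left_comm,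
        Complex.re_ofReal_mul]
    rw [h4, hq]
    linarith
  -- For this z the linear term is -2‖χ‖²/(|q|+1), whereas the quadratic one is at most
  -- ‖χ‖²/(|q|+1); hence χ = 0.
  have h5 := hdiff (((-(|q| + 1)⁻¹ : ℝ) : ℂ) * χ)
  have h6 : ((starRingEnd ℂ) (((-(|q| + 1)⁻¹ : ℝ) : ℂ) * χ) * χ).re =
      -(|q| + 1)⁻¹ * ‖χ‖ ^ 2 := by
    rw [map_mul, Complex.conj_ofReal, mul_assoc, Complex.conj_mul', ← Complex.ofReal_pow,
      ← Complex.ofReal_mul, Complex.ofReal_re]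
  rw [h6, norm_mul, mul_pow, Complex.norm_real, Real.norm_eq_abs, sq_abs] at h5
  have hpos : 0 < |q| + 1 := by positivity
  have h7 : (|q| + 1)⁻¹ * q ≤ 1 := by
    rw [inv_mul_le_iff₀ hpos]
    linarith [le_abs_self q]
  have h8 : 0 < (|q| + 1)⁻¹ := inv_pos.mpr hpos
  by_contra hne
  have h9 : 0 < ‖χ‖ ^ 2 := by
    have := norm_pos_iff.mpr hne
    positivity
  have h10 : 0 < (|q| + 1)⁻¹ * ‖χ‖ ^ 2 := mul_pos h8 h9
  nlinarith

/-- Homogeneity removes the normalisation of competitors, as needed for variations ψ + zη. -/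
lemma IsGroundState.le_of_mem {P : H → Prop} {T : H →ₗ.[ℂ] H} {ψ : H} (hg : IsGroundState P T ψ)
    (hP : ∀ (c : ℂ) φ, P φ → P (c • φ)) {Tψ : H} (hψ : ∃ h : ψ ∈ T.domain, T ⟨ψ, h⟩ = Tψ)
    {φ Tφ : H} (hφ : ∃ h : φ ∈ T.domain, T ⟨φ, h⟩ = Tφ) (hPφ : P φ) :
    (inner ℂ ψ Tψ).re * ‖φ‖ ^ 2 ≤ (inner ℂ φ Tφ).re := by
  obtain ⟨-, -, h1, hmin⟩ := hg
  obtain ⟨h2, rfl⟩ := hψ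
  obtain ⟨h3, rfl⟩ := hφ
  rcases eq_or_ne φ 0 with rfl | hne
  · simp
  have hn : 0 < ‖φ‖ := norm_pos_iff.mpr hne
  have h4 := hmin (((‖φ‖⁻¹ : ℝ) : ℂ) • φ) (T.domain.smul_mem _ h3) (hP _ _ hPφ) (by
    rw [norm_smul, Complex.norm_real, norm_inv, norm_norm, inv_mul_cancel₀ hn.ne'])
  have h5 : T ⟨((‖φ‖⁻¹ : ℝ) : ℂ) • φ, T.domain.smul_mem _ h3⟩ = ((‖φ‖⁻¹ : ℝ) : ℂ) • T ⟨φ, h3⟩ :=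
    T.map_smul _ ⟨φ, h3⟩
  rw [h5, inner_smul_left, inner_smul_right, Complex.conj_ofReal, Complex.re_ofReal_mul,
    Complex.re_ofReal_mul, ← mul_assoc, ← mul_inv, ← sq, le_inv_mul_iff₀ (by positivity)] at h4
  rw [mul_comm]
  exact h4

end GroundStates

/-! ### The square inequality and the Schrödinger equation -/

section ManyBody

variable {n : ℕ} {B : L2 →L[ℂ] L2} {A : E3 → E3} {V θ U : E3 → ℝ} {ε s R a c : ℝ}

lemma sumH_apply_iff (hI : IsInverseOf (hTilde A V θ ε s) B) {Ψ Φ : L2N (n + 1)} :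
    (∃ h : Ψ ∈ (sumH A V θ ε s (n + 1)).domain, sumH A V θ ε s (n + 1) ⟨Ψ, h⟩ = Φ) ↔
      ∃ f : Fin (n + 1) → L2N (n + 1), (∀ j, lift j B (f j) = Ψ) ∧ ∑ j, f j = Φ :=
  sum_apply_iff fun j => isInverseOf_actOn hI j

/-- The interaction is bounded for fixed N and R, so it does not restrict the domain. -/
lemma effectiveHamiltonian_apply_iff (hI : IsInverseOf (hTilde A V θ ε s) B) (hθ : IsCutoff θ)
    (hU : IsSoftPotential a U) (hR : 0 < R) {Ψ Φ : L2N (n + 1)} :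
    (∃ h : Ψ ∈ (effectiveHamiltonian A V θ U ε s (n + 1) R).domain,
      effectiveHamiltonian A V θ U ε s (n + 1) R ⟨Ψ, h⟩ = Φ) ↔
      ∃ f : Fin (n + 1) → L2N (n + 1), (∀ j, lift j B (f j) = Ψ) ∧
        ∑ j, f j + (((1 - ε) ^ 2 / (n + 1 : ℕ) : ℝ) : ℂ) • potL hθ hU hR Finset.univ Ψ = Φ := by
  have hW : ∃ h : Ψ ∈ (mulOp (n + 1) (dysonPotential θ U (n + 1) R)).domain,
      mulOp (n + 1) (dysonPotential θ U (n + 1) R) ⟨Ψ, h⟩ = potL hθ hU hR Finset.univ Ψ := by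
    have e : dysonPotential θ U (n + 1) R = partialPotential θ U R Finset.univ :=
      funext fun x => (partialPotential_univ θ U R x).symm
    rw [e]
    exact mulOp_apply _ _ Ψ
  obtain ⟨hWd, hWe⟩ := hW
  constructor
  · rintro ⟨h, rfl⟩
    obtain ⟨f, hf, hfe⟩ := (sumH_apply_iff hI).mp ⟨h.1, rfl⟩
    refine ⟨f, hf, ?_⟩
    rw [hfe, ← hWe]
    exact (LinearPMap.add_apply _ _ ⟨Ψ, h⟩).symm
  · rintro ⟨f, hf, rfl⟩
    obtain ⟨h, he⟩ := (sumH_apply_iff hI).mpr ⟨f, hf, rfl⟩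
    refine ⟨⟨h, hWd⟩, ?_⟩
    rw [← he, ← hWe]
    exact LinearPMap.add_apply (sumH A V θ ε s (n + 1))
      ((((1 - ε) ^ 2 / (n + 1 : ℕ) : ℝ) : ℂ) • mulOp (n + 1) (dysonPotential θ U (n + 1) R))
      ⟨Ψ, h, hWd⟩

/-- The two-body bound `1(|x_i - x_j| ≤ r) ≤ K r³ h_i h_j`, for `h = B⁻¹`. -/
def NearBound (B : L2 →L[ℂ] L2) (K : ℝ) : Prop :=
  ∀ (n : ℕ) (i j : Fin (n + 1)), i ≠ j → ∀ r : ℝ, 0 < r → ∀ f g ψ : L2N (n + 1),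
    lift i B f = ψ → lift j B g = ψ → ‖nearProj i j r ψ‖ ^ 2 ≤ K * r ^ 3 * (inner ℂ f g).re

lemma exists_nearBound (hB : B.IsPositive) (hi : Function.Injective B) {C₁ : ℝ} (hC₁ : 0 < C₁)
    (hY : ∀ g : L2, (inner ℂ g (B g)).re ≤ C₁ * ∫ y, (inner ℂ g (translate y g)).re ∂yukawa) :
    ∃ K : ℝ, 0 < K ∧ NearBound B K := by
  obtain ⟨C, hC, hν⟩ := lintegral_yukawa_closedBall
  refine ⟨C₁ ^ 2 * (C * 8), by positivity, fun n i j hij r hr f g ψ hf hg => ?_⟩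
  refine (two_body_bound (ν := yukawa) hB hi hC₁ hY hij (C := C * (2 * r) ^ 3) (by positivity)
    (hν (2 * r) (by positivity)) hf hg).trans (le_of_eq ?_)
  ring

/-- The main inequality, for wave functions in the common domain. -/
lemma norm_sq_sum_le (hB : B.IsPositive) (hi : Function.Injective B) {K : ℝ}
    (hK : NearBound B K) (hθ : IsCutoff θ) (hU : IsSoftPotential a U) (hR : 0 < R) {C : ℝ}
    (hC0 : 0 < C) (hC : ∀ (x : Config (n + 1)) (l : Fin (n + 1)),
      (partialPotential θ U R Finset.univ x -
        partialPotential θ U R (Finset.univ.erase l) x) ^ 2 ≤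
      C * (R ^ 6)⁻¹ * ∑ k with k ≠ l, nearInd l k (4 * R) x)
    (hc : 0 ≤ c) (hcK : 4 * c ^ 2 * (64 * C * K * (R ^ 3)⁻¹) ≤ 1)
    {f : Fin (n + 1) → L2N (n + 1)} {Ψ : L2N (n + 1)} (hf : ∀ j, lift j B (f j) = Ψ) :
    1 / 3 * ‖∑ j, f j‖ ^ 2 ≤ ‖∑ j, f j + (c : ℂ) • potL hθ hU hR Finset.univ Ψ‖ ^ 2 := by
  refine norm_sq_sum_add_ge f (fun j => potL hθ hU hR (Finset.univ.erase j) Ψ)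
    (fun j => potL hθ hU hR Finset.univ Ψ - potL hθ hU hR (Finset.univ.erase j) Ψ) _ hc
    (fun j => (add_sub_cancel _ _).symm) (fun j => ?_) (fun j => ?_) (fun j => ?_) hcK
  · have hcomm : Commute (potL hθ hU hR (Finset.univ.erase j)) (lift j B) :=
      (lift_commute_mulL B _ _ fun x y => partialPotential_update (by simp) x y).symm
    have := re_inner_mul_nonneg_of_commute (potL_isPositive hθ hU hR (Finset.univ.erase j))
      (lift_isPositive j hB) hcomm (lift_injective j hi) (f j)
    rwa [hf] at this
  · refine (norm_sq_potL_sub_le hθ hU hR (fun x => hC x j) Ψ).trans ?_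
    -- The two-body bound at radius 4R contributes (4R)³ = 64R³, which against R⁻⁶ leaves 64CK R⁻³.
    have h1 : ∑ k with k ≠ j, ‖nearProj j k (4 * R) Ψ‖ ^ 2 ≤
        ∑ k with k ≠ j, K * (4 * R) ^ 3 * (inner ℂ (f j) (f k)).re :=
      Finset.sum_le_sum fun k hk => hK n j k (Finset.mem_filter.mp hk).2.symm _ (by positivity)
        _ _ _ (hf j) (hf k)
    rw [← Finset.mul_sum] at h1
    refine (mul_le_mul_of_nonneg_left h1 (by positivity)).trans (le_of_eq ?_)
    field_simp
    ring
  · refine Finset.sum_nonneg fun k hk => ?_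
    exact re_inner_nonneg_of_commute (lift_isPositive j hB) (lift_isPositive k hB)
      (lift_commute (Finset.mem_filter.mp hk).2.symm B B) (lift_injective k hi)
      ((hf j).trans (hf k).symm)

lemma isBosonic_smul (z : ℂ) {Ψ : L2N (n + 1)} (h : IsBosonic (n + 1) Ψ) :
    IsBosonic (n + 1) (z • Ψ) := by
  rw [isBosonic_iff] at h ⊢
  intro σ
  rw [map_smul, h σ]

lemma isBosonic_add {Ψ Φ : L2N (n + 1)} (h : IsBosonic (n + 1) Ψ) (h' : IsBosonic (n + 1) Φ) :
    IsBosonic (n + 1) (Ψ + Φ) := by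
  rw [isBosonic_iff] at h h' ⊢
  intro σ
  rw [map_add, h σ, h' σ]

/-- Product states in the domain of `h` are total. -/
lemma eq_zero_of_inner_tensor_range (hB : B.IsPositive) (hi : Function.Injective B)
    {χ : L2N (n + 1)} (h : ∀ g : Fin (n + 1) → L2, inner ℂ (tensor fun k => B (g k)) χ = 0) :
    χ = 0 := by
  classical
  -- B is transferred from the product onto χ one factor at a time; a vanishing `lift j B χ` forces
  -- χ = 0.
  have key : ∀ S : Finset (Fin (n + 1)), ∀ χ : L2N (n + 1),
      (∀ g : Fin (n + 1) → L2,
        inner ℂ (tensor fun k => if k ∈ S then B (g k) else g k) χ = 0) → χ = 0 := by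
    intro S
    induction S using Finset.induction_on with
    | empty => exact fun χ h => eq_zero_of_inner_tensor fun g => by simpa using h g
    | insert j S hj ih =>
      intro χ h
      refine lift_injective j hi ?_
      rw [map_zero]
      refine ih _ fun g => ?_
      rw [← (lift_isPositive j hB).symm_apply, lift_tensor]
      rw [← h g]
      congr 2
      ext1 k
      by_cases hk : k = j
      · subst hk
        simp [hj]
      · simp [hk]
  exact key Finset.univ χ fun g => by simpa using h g

/-- The action of the Hamiltonian is symmetric. -/
lemma inner_hamiltonian_symm (hB : B.IsPositive) (hθ : IsCutoff θ) (hU : IsSoftPotential a U)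
    (hR : 0 < R) {f g : Fin (n + 1) → L2N (n + 1)} {Ψ Φ : L2N (n + 1)}
    (hf : ∀ j, lift j B (f j) = Ψ) (hg : ∀ j, lift j B (g j) = Φ) :
    inner ℂ Φ (∑ j, f j + (c : ℂ) • potL hθ hU hR Finset.univ Ψ) =
      inner ℂ (∑ j, g j + (c : ℂ) • potL hθ hU hR Finset.univ Φ) Ψ := by
  rw [inner_add_right, inner_add_left, inner_smul_right, inner_smul_left, Complex.conj_ofReal,
    (potL_isPositive hθ hU hR Finset.univ).symm_apply, inner_sum, sum_inner]
  congr 1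
  refine Finset.sum_congr rfl fun j _ => ?_
  rw [← hg j, (lift_isPositive j hB).symm_apply, hf j]

/-- Each f_j is determined by Ψ, so a relabelling that fixes Ψ can only relabel the family. -/
lemma permute_eq_of_lift (hi : Function.Injective B) {f : Fin (n + 1) → L2N (n + 1)}
    {Ψ : L2N (n + 1)} (hf : ∀ j, lift j B (f j) = Ψ) (hb : ∀ σ, permute σ Ψ = Ψ)
    (σ : Equiv.Perm (Fin (n + 1))) (j : Fin (n + 1)) : permute σ (f j) = f (σ j) := by
  refine lift_injective (σ j) hi ?_
  rw [← permute_lift, hf, hb, hf]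

/-- Symmetrised product states lie in the domain of the Hamiltonian. -/
lemma symmetrized_tensor (B : L2 →L[ℂ] L2) (g : Fin (n + 1) → L2) :
    ∃ f : Fin (n + 1) → L2N (n + 1), ∀ j,
      lift j B (f j) = ∑ σ : Equiv.Perm (Fin (n + 1)), permute σ (tensor fun k => B (g k)) := by
  -- In the term σ particle j carries the factor with index σ⁻¹(j); removing B there inverts `lift j
  -- B`.
  refine ⟨fun j => ∑ σ : Equiv.Perm (Fin (n + 1)),
    permute σ (tensor (Function.update (fun k => B (g k)) (σ.symm j) (g (σ.symm j)))),
    fun j => ?_⟩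
  rw [map_sum]
  refine Finset.sum_congr rfl fun σ _ => ?_
  have h1 := permute_lift σ (σ.symm j) B
    (tensor (Function.update (fun k => B (g k)) (σ.symm j) (g (σ.symm j))))
  rw [Equiv.apply_symm_apply] at h1
  rw [← h1, lift_tensor]
  congr 2
  simp

lemma isBosonic_symmetrized (T : L2N (n + 1)) :
    IsBosonic (n + 1) (∑ σ : Equiv.Perm (Fin (n + 1)), permute σ T) := by
  rw [isBosonic_iff]
  intro τ
  rw [map_sum]
  simp only [permute_mul]
  exact Equiv.sum_comp (Equiv.mulLeft τ) fun σ => permute σ T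

/-- A bosonic ground state solves the Schrödinger equation. -/
lemma IsGroundState.eigen (hB : B.IsPositive) (hI : IsInverseOf (hTilde A V θ ε s) B)
    (hθ : IsCutoff θ) (hU : IsSoftPotential a U) (hR : 0 < R) {Ψ : L2N (n + 1)}
    (hg : IsGroundState (IsBosonic (n + 1)) (effectiveHamiltonian A V θ U ε s (n + 1) R) Ψ)
    {f : Fin (n + 1) → L2N (n + 1)} (hf : ∀ j, lift j B (f j) = Ψ) {HΨ : L2N (n + 1)}
    (hH : ∑ j, f j + (((1 - ε) ^ 2 / (n + 1 : ℕ) : ℝ) : ℂ) • potL hθ hU hR Finset.univ Ψ = HΨ) :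
    HΨ = ((inner ℂ Ψ HΨ).re : ℂ) • Ψ := by
  have hi := hI.injective
  have hb := isBosonic_iff.mp hg.1
  set E := (inner ℂ Ψ HΨ).re with hE
  -- As HΨ - EΨ is itself symmetric, its pairing with a symmetrised product is (n+1)! times its
  -- pairing with the product; bosonic variations therefore suffice.
  have hHb : ∀ σ, permute σ HΨ = HΨ := fun σ => by
    rw [← hH, map_add, map_smul, permute_potL, hb σ, map_sum]
    congr 1
    simp only [permute_eq_of_lift hi hf hb]
    exact Equiv.sum_comp σ f
  rw [← sub_eq_zero]
  refine eq_zero_of_inner_tensor_range hB hi fun g => ?_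
  set T := tensor fun k => B (g k) with hT
  obtain ⟨fη, hfη⟩ := symmetrized_tensor B g
  set η := ∑ σ : Equiv.Perm (Fin (n + 1)), permute σ T with hη
  have hperp : inner ℂ η (HΨ - (E : ℂ) • Ψ) = 0 := by
    refine inner_eq_of_minimal (Hη := ∑ j, fη j +
      (((1 - ε) ^ 2 / (n + 1 : ℕ) : ℝ) : ℂ) • potL hθ hU hR Finset.univ η) hg.2.1 rfl ?_ fun z => ?_
    · rw [← hH]
      exact inner_hamiltonian_symm hB hθ hU hR hf hfη
    · refine hg.le_of_mem (fun z φ h => isBosonic_smul z h)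
        ((effectiveHamiltonian_apply_iff hI hθ hU hR).mpr ⟨f, hf, hH⟩)
        ((effectiveHamiltonian_apply_iff hI hθ hU hR).mpr ⟨fun j => f j + z • fη j,
          fun j => by rw [map_add, map_smul, hf, hfη], ?_⟩)
        (isBosonic_add hg.1 (isBosonic_smul z (isBosonic_symmetrized T)))
      rw [← hH, Finset.sum_add_distrib, ← Finset.smul_sum, map_add, map_smul]
      module
  have h1 : inner ℂ η (HΨ - (E : ℂ) • Ψ) =
      (Fintype.card (Equiv.Perm (Fin (n + 1))) : ℂ) * inner ℂ T (HΨ - (E : ℂ) • Ψ) := by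
    rw [hη, sum_inner]
    have h2 : ∀ σ : Equiv.Perm (Fin (n + 1)), inner ℂ (permute σ T) (HΨ - (E : ℂ) • Ψ) =
        inner ℂ T (HΨ - (E : ℂ) • Ψ) := fun σ => by
      have h3 : permute σ (HΨ - (E : ℂ) • Ψ) = HΨ - (E : ℂ) • Ψ := by
        rw [map_sub, map_smul, hHb, hb]
      conv_lhs => rw [← h3]
      exact (permute σ).inner_map_map _ _
    rw [Finset.sum_congr rfl fun σ _ => h2 σ, Finset.sum_const, nsmul_eq_mul, Finset.card_univ]
  rw [hperp, eq_comm, mul_eq_zero] at h1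
  exact h1.resolve_left (by exact_mod_cast Fintype.card_ne_zero)

lemma exists_perm_map {ι : Type*} [DecidableEq ι] {i j k l : ι} (hij : i ≠ j) (hkl : k ≠ l) :
    ∃ σ : Equiv.Perm ι, σ i = k ∧ σ j = l := by
  refine ⟨Equiv.swap (Equiv.swap i k j) l * Equiv.swap i k, ?_, ?_⟩
  · rw [Equiv.Perm.mul_apply, Equiv.swap_apply_left, Equiv.swap_apply_of_ne_of_ne _ hkl]
    intro h
    have := (Equiv.swap i k).injective (h.symm.trans (Equiv.swap_apply_left i k).symm)
    exact hij this.symm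
  · rw [Equiv.Perm.mul_apply, Equiv.swap_apply_left]

/-- For bosons all pair correlations agree, hence are bounded by the average. -/
lemma pair_le_of_norm_sum (hi : Function.Injective B)
    {f : Fin (n + 1) → L2N (n + 1)} {Ψ : L2N (n + 1)} (hf : ∀ j, lift j B (f j) = Ψ)
    (hb : ∀ σ, permute σ Ψ = Ψ) {i j : Fin (n + 1)} (hij : i ≠ j) :
    ((n + 1 : ℕ) : ℝ) * n * (inner ℂ (f i) (f j)).re ≤ ‖∑ k, f k‖ ^ 2 := by
  have hall : ∀ k l, k ≠ l → (inner ℂ (f k) (f l)).re = (inner ℂ (f i) (f j)).re := by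
    intro k l hkl
    obtain ⟨σ, h1, h2⟩ := exists_perm_map hij hkl
    rw [← h1, ← h2, ← permute_eq_of_lift hi hf hb, ← permute_eq_of_lift hi hf hb]
    rw [(permute σ).inner_map_map]
  rw [← re_inner_self, sum_inner, Complex.re_sum]
  have h3 : ∀ k, (n : ℝ) * (inner ℂ (f i) (f j)).re ≤ (inner ℂ (f k) (∑ l, f l)).re := by
    intro k
    rw [inner_sum, Complex.re_sum,
      ← Finset.add_sum_erase _ (fun l => (inner ℂ (f k) (f l)).re) (Finset.mem_univ k),
      Finset.sum_congr rfl fun l hl => hall k l (Finset.ne_of_mem_erase hl).symm,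
      Finset.sum_const, Finset.card_erase_of_mem (Finset.mem_univ k), Finset.card_univ,
      Fintype.card_fin, nsmul_eq_mul, re_inner_self]
    simp only [Nat.add_sub_cancel]
    linarith [sq_nonneg ‖f k‖]
  refine le_trans (le_of_eq ?_) (Finset.sum_le_sum fun k _ => h3 k)
  rw [Finset.sum_const, Finset.card_univ, Fintype.card_fin, nsmul_eq_mul, mul_assoc]

end ManyBody

/-! ### The ground state energy and the second moment -/

section Energy

variable {n : ℕ} {B : L2 →L[ℂ] L2} {A : E3 → E3} {V θ U : E3 → ℝ} {ε s R a c : ℝ}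

lemma norm_tensor {N : ℕ} (f : Fin N → L2) : ‖tensor f‖ ^ 2 = ∏ k, ‖f k‖ ^ 2 := by
  have h : ((‖tensor f‖ ^ 2 : ℝ) : ℂ) = ((∏ k, ‖f k‖ ^ 2 : ℝ) : ℂ) := by
    push_cast
    rw [← RCLike.ofReal_eq_complex_ofReal, ← inner_self_eq_norm_sq_to_K, inner_tensor]
    exact Finset.prod_congr rfl fun k _ => inner_self_eq_norm_sq_to_K _
  exact_mod_cast h

/-- A condensate trial state has energy of order `N`. -/
lemma exists_trial_energy_le {K : ℝ} (hK0 : 0 < K) (hK : NearBound B K)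
    (hi : Function.Injective B) (hθ : IsCutoff θ) (hU : IsSoftPotential a U) :
    ∃ C : ℝ, 0 < C ∧ ∀ (n : ℕ) (R : ℝ) (hR : 0 < R) (c : ℝ), 0 ≤ c → c ≤ ((n + 1 : ℕ) : ℝ)⁻¹ →
      ∃ (Φ : L2N (n + 1)) (f : Fin (n + 1) → L2N (n + 1)), ‖Φ‖ = 1 ∧ IsBosonic (n + 1) Φ ∧
        (∀ j, lift j B (f j) = Φ) ∧
        (inner ℂ Φ (∑ j, f j + (c : ℂ) • potL hθ hU hR Finset.univ Φ)).re ≤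
          C * (n + 1 : ℕ) := by
  obtain ⟨M, hM0, hM⟩ := hU.exists_bound
  obtain ⟨g₀, hg₀⟩ := exists_ne (0 : L2)
  have hBg : B g₀ ≠ 0 := fun h => hg₀ (hi (h.trans (map_zero B).symm))
  -- The condensate is built on u = Bg with ‖u‖ = 1; h̃_j replaces its j-th factor u by g.
  set g : L2 := ((‖B g₀‖⁻¹ : ℝ) : ℂ) • g₀ with hg
  have hu : ‖B g‖ = 1 := by
    rw [hg, map_smul, norm_smul, Complex.norm_real, norm_inv, norm_norm,
      inv_mul_cancel₀ (norm_ne_zero_iff.mpr hBg)]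
  refine ⟨‖g‖ + M * K * ‖g‖ ^ 2 + 1, by positivity, fun n R hR c hc hcn => ?_⟩
  set u := B g with hu'
  set Φ : L2N (n + 1) := tensor fun _ => u with hΦ
  set f : Fin (n + 1) → L2N (n + 1) := fun j => tensor (Function.update (fun _ => u) j g) with hf
  have hΦn : ‖Φ‖ = 1 := by
    have h1 : ‖Φ‖ ^ 2 = 1 := by rw [hΦ, norm_tensor]; simp [hu]
    exact (pow_eq_one_iff_of_nonneg (norm_nonneg _) two_ne_zero).mp h1
  have hfn : ∀ j, ‖f j‖ = ‖g‖ := fun j => by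
    have h1 : ‖f j‖ ^ 2 = ‖g‖ ^ 2 := by
      rw [hf, norm_tensor, ← Finset.mul_prod_erase _ _ (Finset.mem_univ j),
        Finset.prod_eq_one fun k hk => ?_]
      · simp
      · rw [Function.update_of_ne (Finset.ne_of_mem_erase hk), hu, one_pow]
    exact (pow_left_inj₀ (norm_nonneg _) (norm_nonneg _) two_ne_zero).mp h1
  have hlift : ∀ j, lift j B (f j) = Φ := fun j => by
    rw [hf, lift_tensor]
    simp only [Function.update_self, Function.update_idem]
    rw [← hu', Function.update_eq_self_iff.mpr rfl]
  have hsum : (inner ℂ Φ (∑ j, f j)).re ≤ ‖g‖ * (n + 1 : ℕ) := by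
    rw [inner_sum, Complex.re_sum]
    refine (Finset.sum_le_card_nsmul _ _ ‖g‖ fun j _ => ?_).trans (le_of_eq ?_)
    · refine (Complex.re_le_norm _).trans ((norm_inner_le_norm _ _).trans (le_of_eq ?_))
      rw [hΦn, hfn, one_mul]
    · rw [Finset.card_univ, Fintype.card_fin, nsmul_eq_mul, mul_comm]
  -- The two-body bound cancels the R⁻³ of the interaction, so each pair costs at most MK‖g‖²,
  -- uniformly in R.
  have hpot : (inner ℂ Φ (potL hθ hU hR Finset.univ Φ)).re ≤
      M * K * ‖g‖ ^ 2 * ((n + 1 : ℕ) : ℝ) ^ 2 := by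
    refine (re_inner_potL_le hθ hM0 hM hU hR Φ).trans ?_
    have h1 : ∀ i, ∑ j with i ≠ j, ‖nearProj i j R Φ‖ ^ 2 ≤
        (n + 1 : ℕ) * (K * R ^ 3 * ‖g‖ ^ 2) := fun i => by
      refine (Finset.sum_le_card_nsmul _ _ (K * R ^ 3 * ‖g‖ ^ 2) fun j hj => ?_).trans ?_
      · refine (hK n i j (Finset.mem_filter.mp hj).2 R hR _ _ _ (hlift i) (hlift j)).trans ?_
        refine mul_le_mul_of_nonneg_left ?_ (by positivity)
        refine (Complex.re_le_norm _).trans ((norm_inner_le_norm _ _).trans (le_of_eq ?_))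
        rw [hfn, hfn, sq]
      · rw [nsmul_eq_mul]
        refine mul_le_mul_of_nonneg_right ?_ (by positivity)
        exact_mod_cast (Finset.card_filter_le _ _).trans (by simp)
    refine (mul_le_mul_of_nonneg_left (Finset.sum_le_sum fun i _ => h1 i)
      (by positivity)).trans (le_of_eq ?_)
    rw [Finset.sum_const, Finset.card_univ, Fintype.card_fin, nsmul_eq_mul]
    field_simp
  refine ⟨Φ, f, hΦn, ?_, hlift, ?_⟩
  · rw [isBosonic_iff]
    intro σ
    rw [hΦ, permute_tensor]
    rfl
  · rw [inner_add_right, inner_smul_right, Complex.add_re, Complex.re_ofReal_mul]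
    have hN : (0 : ℝ) < (n + 1 : ℕ) := by positivity
    have h2 : c * (inner ℂ Φ (potL hθ hU hR Finset.univ Φ)).re ≤
        ((n + 1 : ℕ) : ℝ)⁻¹ * (M * K * ‖g‖ ^ 2 * ((n + 1 : ℕ) : ℝ) ^ 2) :=
      (mul_le_mul_of_nonneg_left hpot hc).trans (mul_le_mul_of_nonneg_right hcn (by positivity))
    have h3 : ((n + 1 : ℕ) : ℝ)⁻¹ * (M * K * ‖g‖ ^ 2 * ((n + 1 : ℕ) : ℝ) ^ 2) =
        M * K * ‖g‖ ^ 2 * (n + 1 : ℕ) := by field_simp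
    rw [h3] at h2
    linarith

lemma re_inner_hamiltonian_nonneg (hB : B.IsPositive) (hθ : IsCutoff θ) (hU : IsSoftPotential a U)
    (hR : 0 < R) (hc : 0 ≤ c) {f : Fin (n + 1) → L2N (n + 1)} {Ψ : L2N (n + 1)}
    (hf : ∀ j, lift j B (f j) = Ψ) :
    0 ≤ (inner ℂ Ψ (∑ j, f j + (c : ℂ) • potL hθ hU hR Finset.univ Ψ)).re := by
  rw [inner_add_right, inner_smul_right, Complex.add_re, Complex.re_ofReal_mul, inner_sum,
    Complex.re_sum]
  refine add_nonneg (Finset.sum_nonneg fun j _ => ?_) (mul_nonneg hc ?_)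
  · rw [← hf j]
    exact (lift_isPositive j hB).re_inner_nonneg_left _
  · exact (potL_isPositive hθ hU hR Finset.univ).re_inner_nonneg_right _

/-- The second moment of a bosonic ground state whose energy is at most `C N`. -/
lemma IsGroundState.pair_le (hB : B.IsPositive) (hI : IsInverseOf (hTilde A V θ ε s) B)
    (hθ : IsCutoff θ) (hU : IsSoftPotential a U) (hR : 0 < R) {Ψ : L2N (n + 1)} {C : ℝ}
    (hn : 1 ≤ n)
    (hg : IsGroundState (IsBosonic (n + 1)) (effectiveHamiltonian A V θ U ε s (n + 1) R) Ψ)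
    {f : Fin (n + 1) → L2N (n + 1)} (hf : ∀ j, lift j B (f j) = Ψ)
    (hE : (inner ℂ Ψ (∑ j, f j +
      (((1 - ε) ^ 2 / (n + 1 : ℕ) : ℝ) : ℂ) • potL hθ hU hR Finset.univ Ψ)).re ≤ C * (n + 1 : ℕ))
    (hsq : 1 / 3 * ‖∑ j, f j‖ ^ 2 ≤ ‖∑ j, f j +
      (((1 - ε) ^ 2 / (n + 1 : ℕ) : ℝ) : ℂ) • potL hθ hU hR Finset.univ Ψ‖ ^ 2)
    {i j : Fin (n + 1)} (hij : i ≠ j) : (inner ℂ (f i) (f j)).re ≤ 6 * C ^ 2 := by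
  have h0 := re_inner_hamiltonian_nonneg hB hθ hU hR
    (c := (1 - ε) ^ 2 / (n + 1 : ℕ)) (by positivity) hf
  have h1 := hg.eigen hB hI hθ hU hR hf rfl
  set HΨ := ∑ j, f j + (((1 - ε) ^ 2 / (n + 1 : ℕ) : ℝ) : ℂ) • potL hθ hU hR Finset.univ Ψ
  -- By the eigenvalue equation the norm of HΨ is the energy itself, so part 1 controls ‖∑ f_k‖² by
  -- 3E².
  have h2 : ‖HΨ‖ = (inner ℂ Ψ HΨ).re := by
    conv_lhs => rw [h1]
    rw [norm_smul, hg.2.1, mul_one, Complex.norm_real, Real.norm_of_nonneg h0]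
  have h3 := pair_le_of_norm_sum hI.injective hf (isBosonic_iff.mp hg.1) hij
  have h4 : ‖HΨ‖ ^ 2 ≤ (C * (n + 1 : ℕ)) ^ 2 := by
    rw [h2]
    exact pow_le_pow_left₀ h0 hE 2
  have hn' : (1 : ℝ) ≤ n := by exact_mod_cast hn
  have hpos : (0 : ℝ) < ((n + 1 : ℕ) : ℝ) * n := by positivity
  refine le_of_mul_le_mul_left (h3.trans ?_) hpos
  have h5 : ‖∑ k, f k‖ ^ 2 ≤ 3 * (C * (n + 1 : ℕ)) ^ 2 := by linarith
  refine h5.trans ?_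
  push_cast
  -- This is 3C²(n+1)² ≤ 6C²n(n+1), that is n+1 ≤ 2n: the origin of the factor 6.
  have h6 : (0 : ℝ) ≤ C ^ 2 * (n + 1) * (n - 1) :=
    mul_nonneg (by positivity) (by linarith)
  nlinarith

/-- The smallness condition on the coupling holds as soon as `N^{2/3} R` is large. -/
lemma eventually_coupling_small {R : ℕ → ℝ} (L : ℝ)
    (hR : Tendsto (fun N : ℕ => R N / (N : ℝ) ^ (-(2 / 3) : ℝ)) atTop atTop) :
    ∀ᶠ N : ℕ in atTop, 0 < R N ∧ L ≤ (N : ℝ) ^ 2 * R N ^ 3 := by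
  filter_upwards [hR.eventually_ge_atTop (max L 1), eventually_ge_atTop 1] with N h1 h2
  have hN : (0 : ℝ) < N := by exact_mod_cast h2
  have hp : 0 < (N : ℝ) ^ (-(2 / 3) : ℝ) := Real.rpow_pos_of_pos hN _
  -- In terms of t = N^{2/3}R one has N²R³ = t³, and t³ ≥ t once t ≥ 1.
  set t := R N / (N : ℝ) ^ (-(2 / 3) : ℝ) with ht
  have ht1 : 1 ≤ t := (le_max_right _ _).trans h1
  have hRt : R N = t * (N : ℝ) ^ (-(2 / 3) : ℝ) := by rw [ht]; field_simp
  have h3 : ((N : ℝ) ^ (-(2 / 3) : ℝ)) ^ 3 = ((N : ℝ) ^ 2)⁻¹ := by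
    rw [← Real.rpow_natCast, ← Real.rpow_mul hN.le, ← Real.rpow_natCast, ← Real.rpow_neg hN.le]
    norm_num
  refine ⟨by rw [hRt]; positivity, ?_⟩
  rw [hRt, mul_pow, h3, mul_left_comm, mul_inv_cancel₀ (by positivity), mul_one]
  exact ((le_max_left _ _).trans h1).trans (le_self_pow₀ ht1 three_ne_zero)

end Energy

end DysonGas

end

/-! ### Assembly of the square inequality and the energy bound -/

theorem lemma3p1 (A : E3 → E3) (V θ U : E3 → ℝ) (a ε s : ℝ)
    (hAV : FieldAssumptions A V) (hθ : IsCutoff θ) (hU : IsSoftPotential a U)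
    (hε₀ : 0 < ε) (hε₁ : ε < 1) (hs : 0 < s) :
    ∃ C : ℝ, ∀ R : ℕ → ℝ,
      Filter.Tendsto (fun N : ℕ => R N / (N : ℝ) ^ (-(2 / 3) : ℝ)) Filter.atTop Filter.atTop →
      ∀ᶠ N : ℕ in Filter.atTop,
        SqGe (effectiveHamiltonian A V θ U ε s N (R N)) (1 / 3) (sumH A V θ ε s N) ∧
        ∀ Ψ : L2N N,
          IsGroundState (IsBosonic N) (effectiveHamiltonian A V θ U ε s N (R N)) Ψ →
          ∀ i j : Fin N, i ≠ j →
            ∃ (hi : Ψ ∈ (actOn N (hTilde A V θ ε s) i).domain)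
              (hj : Ψ ∈ (actOn N (hTilde A V θ ε s) j).domain),
              (inner ℂ (actOn N (hTilde A V θ ε s) i ⟨Ψ, hi⟩)
                (actOn N (hTilde A V θ ε s) j ⟨Ψ, hj⟩)).re ≤ C := by
  obtain ⟨B, hB, hI, -, C₁, hC₁, hY⟩ := exists_inverse_hTilde hAV hθ hε₀ hε₁ hs
  have hinj := hI.injective
  obtain ⟨K, hK0, hK⟩ := exists_nearBound hB hinj hC₁ hY
  obtain ⟨D, hD0, hD⟩ := exists_sub_partialPotential_sq_le hθ hU
  obtain ⟨C₀, hC₀, htrial⟩ := exists_trial_energy_le hK0 hK hinj hθ hU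
  refine ⟨6 * C₀ ^ 2, fun R hR => ?_⟩
  -- With c ≤ 1/N the smallness condition 4c²·64DK R⁻³ ≤ 1 follows from N²R³ ≥ 256DK. N ≥ 2 makes
  -- N-1 positive in the count of pairs.
  filter_upwards [eventually_coupling_small (256 * D * K) hR, eventually_ge_atTop 2]
    with N ⟨hRN, hL⟩ hN
  obtain ⟨n, rfl⟩ : ∃ n, N = n + 1 := ⟨N - 1, by omega⟩
  have hN0 : (0 : ℝ) < (n + 1 : ℕ) := by positivity
  set c : ℝ := (1 - ε) ^ 2 / (n + 1 : ℕ) with hc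
  have hc0 : 0 ≤ c := by positivity
  have hcN : c ≤ ((n + 1 : ℕ) : ℝ)⁻¹ := by
    rw [hc, div_eq_mul_inv]
    exact mul_le_of_le_one_left (by positivity) (pow_le_one₀ (by linarith) (by linarith))
  have hcK : 4 * c ^ 2 * (64 * D * K * (R (n + 1) ^ 3)⁻¹) ≤ 1 := by
    have h1 : c ^ 2 ≤ (((n + 1 : ℕ) : ℝ) ^ 2)⁻¹ := by
      rw [← inv_pow]
      exact pow_le_pow_left₀ hc0 hcN 2
    have h2 : 4 * c ^ 2 * (64 * D * K * (R (n + 1) ^ 3)⁻¹) ≤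
        4 * (((n + 1 : ℕ) : ℝ) ^ 2)⁻¹ * (64 * D * K * (R (n + 1) ^ 3)⁻¹) := by gcongr
    refine h2.trans ?_
    have h3 : 4 * (((n + 1 : ℕ) : ℝ) ^ 2)⁻¹ * (64 * D * K * (R (n + 1) ^ 3)⁻¹) =
        256 * D * K / (((n + 1 : ℕ) : ℝ) ^ 2 * R (n + 1) ^ 3) := by
      field_simp
      ring
    rw [h3, div_le_one (by positivity)]
    exact hL
  have hmain : ∀ (f : Fin (n + 1) → L2N (n + 1)) (Ψ : L2N (n + 1)), (∀ j, lift j B (f j) = Ψ) →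
      1 / 3 * ‖∑ j, f j‖ ^ 2 ≤
        ‖∑ j, f j + (c : ℂ) • potL hθ hU hRN Finset.univ Ψ‖ ^ 2 := fun f Ψ hf =>
    norm_sq_sum_le hB hinj hK hθ hU hRN hD0 (hD n (R (n + 1)) hRN) hc0 hcK hf
  refine ⟨fun Ψ hΨ => ?_, fun Ψ hg i j hij => ?_⟩
  · obtain ⟨f, hf, hfe⟩ := (effectiveHamiltonian_apply_iff hI hθ hU hRN).mp ⟨hΨ, rfl⟩
    obtain ⟨hT, hTe⟩ := (sumH_apply_iff hI).mpr ⟨f, hf, rfl⟩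
    refine ⟨hT, ?_⟩
    rw [hTe, ← hfe]
    exact hmain f Ψ hf
  · obtain ⟨hΨ, -⟩ := hg.2.2
    obtain ⟨f, hf, hfe⟩ := (effectiveHamiltonian_apply_iff hI hθ hU hRN).mp ⟨hΨ, rfl⟩
    obtain ⟨hi, hie⟩ := (isInverseOf_actOn hI i Ψ (f i)).mpr (hf i).symm
    obtain ⟨hj, hje⟩ := (isInverseOf_actOn hI j Ψ (f j)).mpr (hf j).symm
    refine ⟨hi, hj, ?_⟩
    rw [hie, hje]
    obtain ⟨Φ, g, hΦ, hΦb, hgΦ, hle⟩ := htrial n (R (n + 1)) hRN c hc0 hcN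
    refine hg.pair_le hB hI hθ hU hRN (by omega) hf ?_ (hmain f Ψ hf) hij
    have h1 := hg.le_of_mem (fun z φ h => isBosonic_smul z h)
      ((effectiveHamiltonian_apply_iff hI hθ hU hRN).mpr ⟨f, hf, rfl⟩)
      ((effectiveHamiltonian_apply_iff hI hθ hU hRN).mpr ⟨g, hgΦ, rfl⟩) hΦb
    rw [hΦ, one_pow, mul_one] at h1
    exact h1.trans hle
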